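/- Let $\{T(x,t):(x,t)\in\mathbb S^2\times\mathbb Z\}$ be a real-valued, zero-mean random field on a probability space $(\Omega,\mathfrak F,\mathbb P)$, jointly measurable in $(x,\omega)$ for every $t$, with $\mathbb E|T(x,t)|^2<\infty$, which is isotropic stationary: $\mathbb E[T(x,t)T(y,s)]=\mathbb E[T(gx,t+h)T(gy,s+h)]$ for all $x,y\in\mathbb S^2$, $g\in SO(3)$, $t,s,h\in\mathbb Z$. Let $dx$ be the surface measure of $\mathbb S^2$ (total mass $4\pi$) and $\langle f,g\rangle_2=\int_{\mathbb S^2} f(x)\overline{g(x)}\,dx$ on $L^2(\mathbb S^2;\mathbb C)$. Assume that the autocovariance kernels $r_t(x,y)=\mathbb E[T(x,t)T(y,0)]$ are continuous on $\mathbb S^2\times\mathbb S^2$ and that the operators $(\mathscr R_t h)(x)=\int_{\mathbb S^2}r_t(x,y)h(y)\,dy$ on $L^2(\mathbb S^2;\mathbb C)$ satisfy $\sum_{t\in\mathbb Z}\|\mathscr R_t\|_{\mathrm{TR}}<\infty$, where $\|\cdot\|_{\mathrm{TR}}$ is the trace norm. Let $\{Y_{\ell,m}:\ell\ge 0,\ -\ell\le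 m\le \ell\}$ be orthonormal in $L^2(\mathbb S^2;\mathbb C)$, each $Y_{\ell,m}$ being a spherical harmonic of degree $\ell$ (the restriction to $\mathbb S^2$ of a homogeneous harmonic polynomial of degree $\ell$). Put $a_{\ell,m}(t)=\int_{\mathbb S^2}T(x,t)\overline{Y_{\ell,m}(x)}\,dx$, $C_\ell(t)=\mathbb E[a_{\ell,m}(t)\overline{a_{\ell,m}(0)}]$ (which does not depend on $m$; take $m=0$) and $f_\ell(\lambda)=\frac1{2\pi}\sum_{t\in\mathbb Z}e^{-it\lambda}C_\ell(t)$. Let $T_t$ be the random element of $L^2(\mathbb S^2)$ given by $T(\cdot,t)$. For $g:[-\pi,\pi]\to\mathbb C$ and a process $X_\lambda$, $-\pi\le\lambda\le\pi$, with values in $E=\mathbb C$ or $E=L^2(\mathbb S^2;\mathbb C)$, a square-integrable $E$-valued random element $I$ is written $I=\int_{-\pi}^{\pi}g(\lambda)\,dX_\lambda$ if $$\mathbb E\Big\|I-\sum_{j=1}^J g(\lambda_j)(X_{\lambda_{j+1}}-X_{\lambda_j})\Big\|_E^2\to0$$ as the mesh of the partition $-\pi=\lambda_1<\dots<\lambda_{J+1}=\pi$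 tends to $0$. Call a process $\{Z_\lambda:-\pi\le\lambda\le\pi\}$ of square-integrable random elements of $L^2(\mathbb S^2;\mathbb C)$ a Cramér process of $T$ if $\mathbb E\|Z_\lambda\|_2^2=\sum_{\ell\ge0}(2\ell+1)\int_{-\pi}^{\lambda}f_\ell(\nu)\,d\nu$ for all $\lambda\in[-\pi,\pi]$, $\mathbb E\langle Z_{\lambda_1}-Z_{\lambda_2},Z_{\lambda_3}-Z_{\lambda_4}\rangle_2=0$ whenever $\lambda_1>\lambda_2\ge\lambda_3>\lambda_4$ in $[-\pi,\pi]$, and $T_t=\int_{-\pi}^{\pi}e^{it\lambda}\,dZ_\lambda$ for every $t\in\mathbb Z$. Then a Cramér process of $T$ exists, and for every Cramér process $Z$ of $T$, with $\alpha_{\ell,m}(\lambda)=\langle Z_\lambda,Y_{\ell,m}\rangle_2$: 1. the integrals $\int_{-\pi}^{\pi}e^{it\lambda}\,d\alpha_{\ell,m}(\lambda)$ exist in the sense above and, for every $t\in\mathbb Z$ and every $x\in\mathbb S^2$, $$\mathbb E\Big|T(x,t)-\sum_{\ell=0}^{L}\sum_{m=-\ell}^{\ell}\int_{-\pi}^{\pi}e^{it\lambda}\,d\alpha_{\ell,m}(\lambda)\,Y_{\ell,m}(x)\Big|^2\to0,\qquad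 L\to\infty;$$ 2. for all $\ell,\ell'\ge 0$, $|m|\le\ell$, $|m'|\le\ell'$ and $\omega,\beta\in[-\pi,\pi]$, $$\mathbb E\big[\alpha_{\ell,m}(\omega)\overline{\alpha_{\ell',m'}(\beta)}\big]=\delta_{\ell}^{\ell'}\delta_m^{m'}\int_{-\pi}^{\min(\omega,\beta)}f_\ell(\lambda)\,d\lambda .$$ -/

import Mathlib

open MeasureTheory Filter Topology
open scoped ENNReal ComplexConjugate

/-- Euclidean three-space. -/
abbrev Space3 : Type := EuclideanSpace ℝ (Fin 3)

/-- The unit sphere of Euclidean three-space. -/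
abbrev Sph2 : Type := Metric.sphere (0 : Space3) 1

/-- The surface (area) measure on the unit sphere, of total mass `4π`. -/
noncomputable abbrev sphArea : Measure Sph2 := (volume : Measure Space3).toSphere

/-- The complex Hilbert space of square-integrable functions on the sphere. -/
abbrev SphL2 : Type := Lp ℂ 2 sphArea

/-! ### The trace norm -/

/-- The trace norm `tr |A|`, with `|A| = (A* A)^(1/2)`, as an extended nonnegative real. The trace
of the positive operator `|A|`, that is, `∑ ⟨|A| e, e⟩` over any orthonormal basis, is written
as the supremum of the sums over finite orthonormal sets. -/
noncomputable def traceNorm {E : Type*} [NormedAddCommGroup E] [InnerProductSpace ℂ E]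
    [CompleteSpace E] (A : E →L[ℂ] E) : ℝ≥0∞ :=
  ⨆ (s : Finset E) (_ : Orthonormal ℂ (fun v : s => (v : E))),
    ∑ v ∈ s, ENNReal.ofReal (inner ℂ v (CFC.abs A v)).re

/-! ### Integral operators with continuous kernels -/

theorem sphKernel_bound (k : Sph2 → Sph2 → ℝ) (hk : Continuous fun p : Sph2 × Sph2 => k p.1 p.2) :
    ∃ M : ℝ, 0 ≤ M ∧ ∀ x y, ‖(k x y : ℂ)‖ ≤ M := by
  obtain ⟨M, hM⟩ := isCompact_univ.exists_bound_of_continuousOn hk.continuousOn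
  refine ⟨max M 0, le_max_right _ _, fun x y => ?_⟩
  rw [Complex.norm_real]
  exact (hM (x, y) (Set.mem_univ _)).trans (le_max_left _ _)

theorem sphL2_integrable (h : SphL2) : Integrable (fun y => h y) sphArea :=
  (Lp.memLp h).integrable (by norm_num)

theorem sphKernel_integrable (k : Sph2 → Sph2 → ℝ)
    (hk : Continuous fun p : Sph2 × Sph2 => k p.1 p.2) (h : SphL2) (x : Sph2) :
    Integrable (fun y => (k x y : ℂ) * h y) sphArea := by
  obtain ⟨M, -, hM⟩ := sphKernel_bound k hk
  refine (sphL2_integrable h).bdd_mul (c := M) ?_ (Eventually.of_forall (hM x))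
  have : Continuous fun y => (k x y : ℂ) :=
    Complex.continuous_ofReal.comp (hk.comp (Continuous.prodMk_right x))
  exact this.aestronglyMeasurable

theorem sphL2_l1_le (h : SphL2) :
    ∫ y, ‖h y‖ ∂sphArea ≤ (sphArea Set.univ ^ (1 / 2 : ℝ)).toReal * ‖h‖ := by
  have h1 := eLpNorm_le_eLpNorm_mul_rpow_measure_univ (p := 1) (q := 2) (μ := sphArea)
    (f := fun y => h y) (by norm_num) (Lp.aestronglyMeasurable h)
  rw [integral_norm_eq_lintegral_enorm (Lp.aestronglyMeasurable h), ← eLpNorm_one_eq_lintegral_enorm,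
    Lp.norm_def, ← ENNReal.toReal_mul, mul_comm]
  refine ENNReal.toReal_mono (ENNReal.mul_ne_top (Lp.eLpNorm_ne_top h) ?_) (h1.trans_eq ?_)
  · exact ENNReal.rpow_ne_top_of_nonneg (by norm_num) (measure_ne_top _ _)
  · norm_num

theorem sphKernel_integral_bound (k : Sph2 → Sph2 → ℝ)
    (hk : Continuous fun p : Sph2 × Sph2 => k p.1 p.2) :
    ∃ C : ℝ, 0 ≤ C ∧ ∀ (h : SphL2) (x : Sph2), ‖∫ y, (k x y : ℂ) * h y ∂sphArea‖ ≤ C * ‖h‖ := by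
  obtain ⟨M, hM0, hM⟩ := sphKernel_bound k hk
  refine ⟨M * (sphArea Set.univ ^ (1 / 2 : ℝ)).toReal, by positivity, fun h x => ?_⟩
  calc ‖∫ y, (k x y : ℂ) * h y ∂sphArea‖
      ≤ ∫ y, M * ‖h y‖ ∂sphArea := by
        refine norm_integral_le_of_norm_le ((sphL2_integrable h).norm.const_mul M)
          (Eventually.of_forall fun y => ?_)
        rw [norm_mul]
        exact mul_le_mul_of_nonneg_right (hM x y) (norm_nonneg _)
    _ = M * ∫ y, ‖h y‖ ∂sphArea := integral_const_mul _ _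
    _ ≤ M * ((sphArea Set.univ ^ (1 / 2 : ℝ)).toReal * ‖h‖) :=
        mul_le_mul_of_nonneg_left (sphL2_l1_le h) hM0
    _ = _ := by ring

theorem sphKernel_memLp (k : Sph2 → Sph2 → ℝ)
    (hk : Continuous fun p : Sph2 × Sph2 => k p.1 p.2) (h : SphL2) :
    MemLp (fun x => ∫ y, (k x y : ℂ) * h y ∂sphArea) 2 sphArea := by
  obtain ⟨C, -, hC⟩ := sphKernel_integral_bound k hk
  refine MemLp.of_bound ?_ (C * ‖h‖) (Eventually.of_forall (hC h))
  have h1 : AEStronglyMeasurable (fun p : Sph2 × Sph2 => (k p.1 p.2 : ℂ) * h p.2)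
      (sphArea.prod sphArea) :=
    (Complex.continuous_ofReal.comp hk).aestronglyMeasurable.mul
      (Lp.aestronglyMeasurable h).comp_snd
  exact h1.integral_prod_right'

/-- The operator `(K h)(x) = ∫ k(x,y) h(y) dy` on `L²` of the sphere, for a continuous kernel `k`. -/
noncomputable def kernelOperator (k : Sph2 → Sph2 → ℝ)
    (hk : Continuous fun p : Sph2 × Sph2 => k p.1 p.2) : SphL2 →L[ℂ] SphL2 :=
  LinearMap.mkContinuousOfExistsBound
    { toFun := fun h => (sphKernel_memLp k hk h).toLp (fun x => ∫ y, (k x y : ℂ) * h y ∂sphArea)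
      map_add' := fun h g => by
        rw [← MemLp.toLp_add]
        refine MemLp.toLp_congr _ _ (Eventually.of_forall fun x => ?_)
        rw [Pi.add_apply, ← integral_add (sphKernel_integrable k hk h x)
          (sphKernel_integrable k hk g x)]
        refine integral_congr_ae ?_
        filter_upwards [Lp.coeFn_add h g] with y hy
        rw [hy, Pi.add_apply, mul_add]
      map_smul' := fun c h => by
        rw [RingHom.id_apply, ← MemLp.toLp_const_smul]
        refine MemLp.toLp_congr _ _ (Eventually.of_forall fun x => ?_)
        rw [Pi.smul_apply, ← integral_smul]
        refine integral_congr_ae ?_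
        filter_upwards [Lp.coeFn_smul c h] with y hy
        rw [hy, Pi.smul_apply, smul_eq_mul, smul_eq_mul]
        ring }
    (by
      obtain ⟨C, hC0, hC⟩ := sphKernel_integral_bound k hk
      refine ⟨(measureUnivNNReal sphArea : ℝ) ^ ((2 : ℝ≥0∞).toReal)⁻¹ * C, fun h => ?_⟩
      rw [mul_assoc]
      refine Lp.norm_le_of_ae_bound (by positivity) ?_
      filter_upwards [(sphKernel_memLp k hk h).coeFn_toLp] with x hx
      exact (congrArg norm hx).trans_le (hC h x))

theorem kernelOperator_apply (k : Sph2 → Sph2 → ℝ)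
    (hk : Continuous fun p : Sph2 × Sph2 => k p.1 p.2) (h : SphL2) :
    kernelOperator k hk h =ᵐ[sphArea] fun x => ∫ y, (k x y : ℂ) * h y ∂sphArea :=
  (sphKernel_memLp k hk h).coeFn_toLp

/-! ### Spherical harmonics -/

/-- A spherical harmonic of degree `l`: the restriction to the sphere of a complex homogeneous
polynomial of degree `l` in three variables with vanishing Laplacian. -/
def IsSphericalHarmonic (l : ℕ) (u : Sph2 → ℂ) : Prop :=
  ∃ p : MvPolynomial (Fin 3) ℂ, p.IsHomogeneous l ∧
    ∑ i, MvPolynomial.pderiv i (MvPolynomial.pderiv i p) = 0 ∧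
    ∀ x : Sph2, u x = MvPolynomial.eval (fun i => ((x : Space3) i : ℂ)) p

/-- `Y l m`, for `l ≥ 0` and `-l ≤ m ≤ l`, are orthonormal spherical harmonics, with `2 l + 1` of
them in degree `l`; the values of `Y l m` for other integers `m` are irrelevant. -/
structure IsSphericalHarmonicBasis (Y : ℕ → ℤ → Sph2 → ℂ) : Prop where
  harmonic : ∀ (l : ℕ) (m : ℤ), |m| ≤ l → IsSphericalHarmonic l (Y l m)
  orthonormal : ∀ (l l' : ℕ) (m m' : ℤ), |m| ≤ l → |m'| ≤ l' →
    ∫ x, Y l m x * conj (Y l' m' x) ∂sphArea = if l = l' ∧ m = m' then 1 else 0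

/-! ### Isotropic stationary random fields -/

section Field

variable {Ω : Type*} [MeasurableSpace Ω]

/-- The action of a linear isometry of three-space on the sphere. -/
noncomputable def sphRotate (g : Space3 ≃ₗᵢ[ℝ] Space3) (x : Sph2) : Sph2 :=
  ⟨g x, by simp⟩

/-- A real, zero-mean, isotropic stationary space-time spherical random field with finite second
moments. The rotations are the linear isometries of determinant one. -/
structure IsIsotropicStationary (P : Measure Ω) (T : Sph2 → ℤ → Ω → ℝ) : Prop where
  measurable : ∀ t, Measurable fun p : Sph2 × Ω => T p.1 t p.2
  memLp : ∀ x t, MemLp (T x t) 2 P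
  mean_zero : ∀ x t, ∫ ω, T x t ω ∂P = 0
  invariant : ∀ (x y : Sph2) (g : Space3 ≃ₗᵢ[ℝ] Space3) (t s h : ℤ),
    LinearMap.det (g.toLinearEquiv : Space3 →ₗ[ℝ] Space3) = 1 →
    ∫ ω, T x t ω * T y s ω ∂P =
      ∫ ω, T (sphRotate g x) (t + h) ω * T (sphRotate g y) (s + h) ω ∂P

/-- The autocovariance kernel `r_t(x,y) = E[T(x,t) T(y,0)]`. -/
noncomputable def autocovKernel (P : Measure Ω) (T : Sph2 → ℤ → Ω → ℝ) (t : ℤ) (x y : Sph2) : ℝ :=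
  ∫ ω, T x t ω * T y 0 ω ∂P

open Classical in
/-- The random element `T_t` of `L²` of the sphere given by the field `T(·,t)`; it is set to `0` at
the outcomes (a null set, for the fields considered) whose path is not square integrable. -/
noncomputable def fieldElement (T : Sph2 → ℤ → Ω → ℝ) (t : ℤ) (ω : Ω) : SphL2 :=
  if h : MemLp (fun x => (T x t ω : ℂ)) 2 sphArea then h.toLp (fun x => (T x t ω : ℂ)) else 0

/-- The harmonic coefficient `a_{l,m}(t) = ∫ T(x,t) conj (Y_{l,m}(x)) dx`. -/
noncomputable def harmonicCoeff (Y : ℕ → ℤ → Sph2 → ℂ) (T : Sph2 → ℤ → Ω → ℝ) (l : ℕ) (m t : ℤ)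
    (ω : Ω) : ℂ :=
  ∫ x, (T x t ω : ℂ) * conj (Y l m x) ∂sphArea

/-- `C_l(t) = E[a_{l,m}(t) conj (a_{l,m}(0))]`, which does not depend on `m` for an isotropic
stationary field; the index `m = 0` is used. -/
noncomputable def angularCov (P : Measure Ω) (Y : ℕ → ℤ → Sph2 → ℂ) (T : Sph2 → ℤ → Ω → ℝ) (l : ℕ)
    (t : ℤ) : ℂ :=
  ∫ ω, harmonicCoeff Y T l 0 t ω * conj (harmonicCoeff Y T l 0 0 ω) ∂P

/-- The spectral density `f_l(ν) = (2π)⁻¹ ∑_t e^{-itν} C_l(t)`. -/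
noncomputable def spectralDensity (P : Measure Ω) (Y : ℕ → ℤ → Sph2 → ℂ) (T : Sph2 → ℤ → Ω → ℝ)
    (l : ℕ) (ν : ℝ) : ℂ :=
  (2 * Real.pi : ℂ)⁻¹ * ∑' t : ℤ, Complex.exp (-(Complex.I * t * ν)) * angularCov P Y T l t

/-! ### Mean-square Stieltjes integrals and the Cramér process -/

/-- `I = ∫_{-π}^{π} g(ν) dZ_ν` as a mean-square Riemann–Stieltjes limit: the sums
`∑_j g(u_j) (Z_{u_{j+1}} - Z_{u_j})` over partitions `-π = u_0 < ⋯ < u_J = π` tend to `I` in mean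
square as the mesh of the partition tends to zero. -/
def IsStieltjesIntegral {E : Type*} [NormedAddCommGroup E] [NormedSpace ℂ E] (P : Measure Ω)
    (g : ℝ → ℂ) (Z : ℝ → Ω → E) (I : Ω → E) : Prop :=
  MemLp I 2 P ∧ ∀ ε : ℝ≥0∞, 0 < ε → ∃ δ : ℝ, 0 < δ ∧ ∀ (J : ℕ) (u : ℕ → ℝ),
    u 0 = -Real.pi → u J = Real.pi → (∀ j < J, u j < u (j + 1)) →
    (∀ j < J, u (j + 1) - u j < δ) →
    ∫⁻ ω, ‖I ω - ∑ j ∈ Finset.range J, g (u j) • (Z (u (j + 1)) ω - Z (u j) ω)‖ₑ ^ 2 ∂P < ε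

/-- The character `ν ↦ e^{itν}`. -/
noncomputable def charFn (t : ℤ) (ν : ℝ) : ℂ := Complex.exp (Complex.I * t * ν)

/-- `Z_ν`, `-π ≤ ν ≤ π`, is the process of the Cramér representation of `T`: the `Z_ν` are random
elements of `L²` of the sphere with `E ‖Z_ν‖² = ∑_l (2l+1) ∫_{-π}^{ν} f_l`, their increments are
orthogonal, and `T_t = ∫_{-π}^{π} e^{itν} dZ_ν` for every `t`. These properties determine every
`Z_ν` up to almost sure equality. -/
structure IsCramerProcess (P : Measure Ω) (Y : ℕ → ℤ → Sph2 → ℂ) (T : Sph2 → ℤ → Ω → ℝ)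
    (Z : ℝ → Ω → SphL2) : Prop where
  memLp : ∀ ν ∈ Set.Icc (-Real.pi) Real.pi, MemLp (Z ν) 2 P
  hasSum_norm : ∀ ν ∈ Set.Icc (-Real.pi) Real.pi,
    HasSum (fun l : ℕ => (2 * l + 1 : ℂ) * ∫ θ in (-Real.pi)..ν, spectralDensity P Y T l θ)
      (((∫ ω, ‖Z ν ω‖ ^ 2 ∂P : ℝ)) : ℂ)
  orthogonal : ∀ ν₁ ∈ Set.Icc (-Real.pi) Real.pi, ∀ ν₂ ∈ Set.Icc (-Real.pi) Real.pi,
    ∀ ν₃ ∈ Set.Icc (-Real.pi) Real.pi, ∀ ν₄ ∈ Set.Icc (-Real.pi) Real.pi,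
    ν₂ < ν₁ → ν₃ ≤ ν₂ → ν₄ < ν₃ →
    ∫ ω, inner ℂ (Z ν₃ ω - Z ν₄ ω) (Z ν₁ ω - Z ν₂ ω) ∂P = 0
  representation : ∀ t : ℤ, IsStieltjesIntegral P (charFn t) Z (fieldElement T t)

/-- `α_{l,m}(ν) = ⟨Z_ν, Y_{l,m}⟩ = ∫ Z_ν(x) conj (Y_{l,m}(x)) dx`. -/
noncomputable def incrementCoeff (Y : ℕ → ℤ → Sph2 → ℂ) (Z : ℝ → Ω → SphL2) (l : ℕ) (m : ℤ) (ν : ℝ)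
    (ω : Ω) : ℂ :=
  ∫ x, Z ν ω x * conj (Y l m x) ∂sphArea

end Field

/-! Isotropy makes each kernel r_t zonal, a function of the angle between its arguments, because
rotations act transitively on pairs of points with a given angle. By the Funk–Hecke formula
(`IsSphericalHarmonicBasis.funkHecke`) every harmonic of degree l is then an eigenfunction of the
operator R_t, with an eigenvalue depending on l and t only; `angularCov_eigenvalue` identifies it as
C_l(t). Hence coefficients a_{l,m} with different indices are uncorrelated, and the covariance of
a_{l,m}(t) and a_{l,m}(s) is C_l(t - s). Since the harmonics form a Hilbert basis of eigenvectors,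
the trace norm of R_t dominates the sum over (l,m) of |C_l(t)|. So C_l(t) is absolutely summable
over all (l,m,t); the densities f_l are continuous, bounded by `specBound`, with Fourier
coefficients C_l(t), and the bounds have a finite sum K over all (l,m).

The covariance of the (l,m) coefficients of T_s and T_t is therefore the integral of e^{i(t-s)ν}
f_l(ν), and e^{itν} ↦ T_t extends to a bounded operator A (`spectralOp`) from L²(-π,π) to L²(Ω;
L²(S²)) satisfying ⟨Af, Ag⟩ = ∑ ⟨f, f_l g⟩, the sum being over (l,m). The images Z_ν = A 1_{(-π,ν]}
form a Cramér process: step functions go to Stieltjes sums, and characters are uniform limits of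
step functions.

Conversely, for any Cramér process the normalisation and the orthogonality of increments bound a
Stieltjes sum by √K times the L² norm of the step function with the same weights
(`norm_stieltjesSum_le`). In the limit ‖A p - Z_ν‖ ≤ √K ‖p - 1_{(-π,ν]}‖ for every trigonometric
polynomial p, so density forces Z_ν = A 1_{(-π,ν]} (`toL2_eq_cramer`). The covariance formula is
then the identity for A applied to indicators.

For the expansion, pairing the representation of T_t with Y_{l,m} shows that the integrals are the
coefficients a_{l,m}(t). By Pythagoras the mean-square error at x is r_0(x,x) - ∑_{l≤L} C_l(0)
K_l(x,x), with K_l the reproducing kernel of degree l. It tends to zero because both r_0 and K_l are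
constant on the diagonal, so that Parseval's identity integrated over the sphere already gives the
pointwise sum (`hasSum_angularCov_zero`). -/

/-! ### Rotations of the sphere -/

theorem exists_isometry_map_pair (x y x' y' : Sph2)
    (h : inner ℝ (x : Space3) (y : Space3) = inner ℝ (x' : Space3) (y' : Space3)) :
    ∃ g : Space3 ≃ₗᵢ[ℝ] Space3, g x = x' ∧ g y = y' ∧
      (LinearMap.det (g.toLinearEquiv : Space3 →ₗ[ℝ] Space3) = 1 ∨
        LinearMap.det (g.toLinearEquiv : Space3 →ₗ[ℝ] Space3) = -1) := by
  have hn : ∀ z : Sph2, ‖(z : Space3)‖ = 1 := fun z => by simp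
  -- Two mirror reflections: the first carries `x` to `x'`, the second carries the image of `y` to
  -- `y'` and fixes `x'` because the angles agree. Either one degenerates to the identity when its
  -- two points coincide, so only the determinant up to sign is known.
  set g₁ := (ℝ ∙ ((x : Space3) - x'))ᗮ.reflection with hg₁
  have h₁ : g₁ x = x' := Submodule.reflection_sub (by rw [hn, hn])
  set y₁ := g₁ y with hy₁
  set g₂ := (ℝ ∙ (y₁ - (y' : Space3)))ᗮ.reflection with hg₂
  have h₂ : g₂ y₁ = y' := Submodule.reflection_sub (by rw [hy₁, g₁.norm_map, hn, hn])
  have h₃ : g₂ x' = x' := by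
    refine Submodule.reflection_mem_subspace_eq_self ?_
    rw [Submodule.mem_orthogonal_singleton_iff_inner_right, inner_sub_left, sub_eq_zero,
      real_inner_comm (x' : Space3) y', ← h, hy₁, ← h₁, g₁.inner_map_map, real_inner_comm]
  refine ⟨g₁.trans g₂, by simp [h₁, h₃], by simp [← hy₁, h₂], ?_⟩
  have : ((g₁.trans g₂).toLinearEquiv : Space3 →ₗ[ℝ] Space3) =
      g₂.toLinearMap ∘ₗ g₁.toLinearMap := rfl
  rw [this, LinearMap.det_comp, hg₁, hg₂, Submodule.det_reflection, Submodule.det_reflection,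
    ← pow_add]
  exact neg_one_pow_eq_or ℝ _

theorem exists_ne_zero_orthogonal_pair (x y : Space3) :
    ∃ n : Space3, n ≠ 0 ∧ inner ℝ n x = 0 ∧ inner ℝ n y = 0 := by
  have hd : Module.finrank ℝ (Submodule.span ℝ (Set.range ![x, y])) ≤ 2 := by
    exact (finrank_range_le_card (R := ℝ) ![x, y]).trans (by simp)
  have ht : (Submodule.span ℝ (Set.range ![x, y]))ᗮ ≠ ⊥ := by
    intro hb
    rw [Submodule.orthogonal_eq_bot_iff] at hb
    rw [hb, finrank_top] at hd
    simp at hd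
  obtain ⟨n, hn, hn0⟩ := Submodule.exists_mem_ne_zero_of_ne_bot ht
  rw [Submodule.mem_orthogonal'] at hn
  exact ⟨n, hn0, hn x (Submodule.subset_span ⟨0, rfl⟩), hn y (Submodule.subset_span ⟨1, rfl⟩)⟩

/-- The rotation group acts transitively on the pairs of points with a given angle. -/
theorem exists_rotation_map_pair (x y x' y' : Sph2)
    (h : inner ℝ (x : Space3) (y : Space3) = inner ℝ (x' : Space3) (y' : Space3)) :
    ∃ g : Space3 ≃ₗᵢ[ℝ] Space3, LinearMap.det (g.toLinearEquiv : Space3 →ₗ[ℝ] Space3) = 1 ∧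
      sphRotate g x = x' ∧ sphRotate g y = y' := by
  obtain ⟨g, hx, hy, hd | hd⟩ := exists_isometry_map_pair x y x' y' h
  · exact ⟨g, hd, Subtype.ext hx, Subtype.ext hy⟩
  -- A determinant -1 is corrected by the reflection in a plane containing both target points.
  obtain ⟨n, hn0, hnx, hny⟩ := exists_ne_zero_orthogonal_pair (x' : Space3) y'
  set r := (ℝ ∙ n)ᗮ.reflection with hr
  have hfix : ∀ z : Space3, inner ℝ n z = 0 → r z = z := fun z hz =>
    Submodule.reflection_mem_subspace_eq_self
      (Submodule.mem_orthogonal_singleton_iff_inner_right.2 hz)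
  refine ⟨g.trans r, ?_, Subtype.ext ?_, Subtype.ext ?_⟩
  · have : ((g.trans r).toLinearEquiv : Space3 →ₗ[ℝ] Space3) =
        r.toLinearMap ∘ₗ (g.toLinearEquiv : Space3 →ₗ[ℝ] Space3) := rfl
    rw [this, LinearMap.det_comp, hd, hr, Submodule.det_reflection,
      Submodule.orthogonal_orthogonal, finrank_span_singleton hn0]
    norm_num
  · change r (g x) = x'
    rw [hx, hfix _ hnx]
  · change r (g y) = y'
    rw [hy, hfix _ hny]

/-- A kernel on the sphere whose value at a pair of points depends on their angle only. -/
def IsZonalKernel {α : Type*} (k : Sph2 → Sph2 → α) : Prop :=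
  ∀ x y x' y' : Sph2, inner ℝ (x : Space3) (y : Space3) = inner ℝ (x' : Space3) (y' : Space3) →
    k x y = k x' y'

theorem IsZonalKernel.of_rotation {α : Type*} {k : Sph2 → Sph2 → α}
    (h : ∀ (g : Space3 ≃ₗᵢ[ℝ] Space3) (x y : Sph2), k (sphRotate g x) (sphRotate g y) = k x y) :
    IsZonalKernel k := fun x y x' y' hxy => by
  obtain ⟨g, -, rfl, rfl⟩ := exists_rotation_map_pair x y x' y' hxy
  exact (h g x y).symm

theorem IsZonalKernel.rotate {α : Type*} {k : Sph2 → Sph2 → α} (hk : IsZonalKernel k)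
    (g : Space3 ≃ₗᵢ[ℝ] Space3) (x y : Sph2) : k (sphRotate g x) (sphRotate g y) = k x y :=
  hk _ _ _ _ (g.inner_map_map _ _)

theorem IsZonalKernel.symm {α : Type*} {k : Sph2 → Sph2 → α} (hk : IsZonalKernel k) (x y : Sph2) :
    k x y = k y x := hk _ _ _ _ (real_inner_comm _ _)

theorem IsZonalKernel.diag {α : Type*} {k : Sph2 → Sph2 → α} (hk : IsZonalKernel k) (x y : Sph2) :
    k x x = k y y := hk _ _ _ _ (by simp)

theorem continuous_sphRotate (g : Space3 ≃ₗᵢ[ℝ] Space3) : Continuous (sphRotate g) :=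
  (g.continuous.comp continuous_subtype_val).subtype_mk _

theorem sphRotate_symm_apply (g : Space3 ≃ₗᵢ[ℝ] Space3) (x : Sph2) :
    sphRotate g (sphRotate g.symm x) = x := Subtype.ext (g.apply_symm_apply x)

theorem sphRotate_apply_symm (g : Space3 ≃ₗᵢ[ℝ] Space3) (x : Sph2) :
    sphRotate g.symm (sphRotate g x) = x := Subtype.ext (g.symm_apply_apply x)

-- The area of `s` is, up to a fixed factor, the volume of the cone `(0,1) • s`. An isometry
-- commutes with scalars, so it carries cones to cones, and it preserves volume.
open scoped Pointwise in
theorem measurePreserving_sphRotate (g : Space3 ≃ₗᵢ[ℝ] Space3) :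
    MeasurePreserving (sphRotate g) sphArea sphArea := by
  refine ⟨(continuous_sphRotate g).measurable, Measure.ext fun s hs => ?_⟩
  rw [Measure.map_apply (continuous_sphRotate g).measurable hs,
    Measure.toSphere_apply' _ hs,
    Measure.toSphere_apply' _ ((continuous_sphRotate g).measurable hs)]
  congr 1
  have : Set.Ioo (0 : ℝ) 1 • ((↑) '' (sphRotate g ⁻¹' s) : Set Space3) =
      g ⁻¹' (Set.Ioo (0 : ℝ) 1 • ((↑) '' s : Set Space3)) := by
    ext z
    simp only [Set.mem_smul, Set.mem_image, Set.mem_preimage]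
    constructor
    · rintro ⟨r, hr, -, ⟨w, hw, rfl⟩, rfl⟩
      exact ⟨r, hr, _, ⟨_, hw, rfl⟩, by simp [sphRotate]⟩
    · rintro ⟨r, hr, -, ⟨w, hw, rfl⟩, hz⟩
      refine ⟨r, hr, _, ⟨sphRotate g.symm w, by rwa [sphRotate_symm_apply], rfl⟩, ?_⟩
      apply g.injective
      rw [← hz, map_smul]
      simp [sphRotate]
  rw [this]
  exact g.measurePreserving.measure_preimage_emb g.toHomeomorph.measurableEmbedding _

theorem integral_sphRotate {E : Type*} [NormedAddCommGroup E] [NormedSpace ℝ E]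
    (g : Space3 ≃ₗᵢ[ℝ] Space3) (f : Sph2 → E) :
    ∫ x, f (sphRotate g x) ∂sphArea = ∫ x, f x ∂sphArea := by
  let e : Sph2 ≃ₜ Sph2 :=
    { toFun := sphRotate g
      invFun := sphRotate g.symm
      left_inv := sphRotate_apply_symm g
      right_inv := sphRotate_symm_apply g
      continuous_toFun := continuous_sphRotate g
      continuous_invFun := continuous_sphRotate g.symm }
  exact (measurePreserving_sphRotate g).integral_comp e.measurableEmbedding f

theorem sphArea_real_pos : 0 < sphArea.real Set.univ := by
  rw [Measure.real, ENNReal.toReal_pos_iff]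
  exact ⟨(Measure.measure_univ_pos).2 (Measure.toSphere_ne_zero _), measure_lt_top _ _⟩

theorem Continuous.integrable_sphArea {E : Type*} [NormedAddCommGroup E] {f : Sph2 → E}
    (hf : Continuous f) : Integrable f sphArea :=
  hf.integrable_of_hasCompactSupport (HasCompactSupport.of_compactSpace f)

/-! ### Polynomial functions on the sphere -/

/-- The monomial function `x₀ᵃ x₁ᵇ x₂ᶜ` on the sphere. -/
noncomputable def sphMonomial (a b c : ℕ) (x : Sph2) : ℂ :=
  ((x : Space3) 0 : ℂ) ^ a * ((x : Space3) 1 : ℂ) ^ b * ((x : Space3) 2 : ℂ) ^ c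

/-- The space of polynomial functions of degree less than `n` on the sphere. -/
noncomputable def sphPoly (n : ℕ) : Submodule ℂ (Sph2 → ℂ) :=
  Submodule.span ℂ {f | ∃ a b c : ℕ, a + b + c < n ∧ f = sphMonomial a b c}

theorem sphMonomial_mem {n a b c : ℕ} (h : a + b + c < n) : sphMonomial a b c ∈ sphPoly n :=
  Submodule.subset_span ⟨a, b, c, h, rfl⟩

theorem sphPoly_le {n : ℕ} {S : Submodule ℂ (Sph2 → ℂ)}
    (h : ∀ a b c : ℕ, a + b + c < n → sphMonomial a b c ∈ S) : sphPoly n ≤ S :=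
  Submodule.span_le.2 (by rintro _ ⟨a, b, c, hn, rfl⟩; exact h a b c hn)

theorem sphPoly_mono {n m : ℕ} (h : n ≤ m) : sphPoly n ≤ sphPoly m :=
  sphPoly_le fun _ _ _ h' => sphMonomial_mem (h'.trans_le h)

theorem continuous_sphCoord (i : Fin 3) : Continuous fun x : Sph2 => ((x : Space3) i : ℂ) := by
  fun_prop

theorem continuous_sphMonomial (a b c : ℕ) : Continuous (sphMonomial a b c) := by
  unfold sphMonomial
  fun_prop

theorem continuous_of_mem_sphPoly {n : ℕ} {f : Sph2 → ℂ} (hf : f ∈ sphPoly n) : Continuous f := by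
  refine Submodule.span_induction ?_ continuous_const (fun _ _ _ _ h₁ h₂ => h₁.add h₂)
    (fun c _ _ h => h.const_smul c) hf
  rintro _ ⟨a, b, c, -, rfl⟩
  exact continuous_sphMonomial a b c

theorem mul_mem_sphPoly {n m : ℕ} {f g : Sph2 → ℂ} (hf : f ∈ sphPoly (n + 1))
    (hg : g ∈ sphPoly (m + 1)) : f * g ∈ sphPoly (n + m + 1) := by
  have h1 : ∀ a b c : ℕ, a + b + c < n + 1 → ∀ g ∈ sphPoly (m + 1),
      sphMonomial a b c * g ∈ sphPoly (n + m + 1) := by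
    intro a b c h g hg
    refine (sphPoly_le (S := (sphPoly (n + m + 1)).comap
      (LinearMap.mulLeft ℂ (sphMonomial a b c))) fun a' b' c' h' => ?_) hg
    have : sphMonomial a b c * sphMonomial a' b' c' =
        sphMonomial (a + a') (b + b') (c + c') := by
      ext x
      simp only [sphMonomial, Pi.mul_apply]
      ring
    rw [Submodule.mem_comap, LinearMap.mulLeft_apply, this]
    exact sphMonomial_mem (by omega)
  exact (sphPoly_le (S := (sphPoly (n + m + 1)).comap (LinearMap.mulRight ℂ g))
    fun a b c h => h1 a b c h g hg) hf

theorem one_mem_sphPoly : (1 : Sph2 → ℂ) ∈ sphPoly 1 := by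
  convert sphMonomial_mem (n := 1) (a := 0) (b := 0) (c := 0) (by norm_num) using 1
  ext x
  simp [sphMonomial]

theorem sphCoord_mem (i : Fin 3) : (fun x : Sph2 => ((x : Space3) i : ℂ)) ∈ sphPoly 2 := by
  fin_cases i
  · convert sphMonomial_mem (n := 2) (a := 1) (b := 0) (c := 0) (by norm_num) using 1
    ext x; simp [sphMonomial]
  · convert sphMonomial_mem (n := 2) (a := 0) (b := 1) (c := 0) (by norm_num) using 1
    ext x; simp [sphMonomial]
  · convert sphMonomial_mem (n := 2) (a := 0) (b := 0) (c := 1) (by norm_num) using 1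
    ext x; simp [sphMonomial]

theorem pow_mem_sphPoly {f : Sph2 → ℂ} (hf : f ∈ sphPoly 2) (k : ℕ) : f ^ k ∈ sphPoly (k + 1) := by
  induction k with
  | zero => simpa using one_mem_sphPoly
  | succ k ih => rw [pow_succ]; exact mul_mem_sphPoly ih hf

/-- The rotated coordinates are linear forms in the original ones, so a rotated monomial is a
product of linear forms of the same total degree. -/
theorem sphPoly_rotate {n : ℕ} {f : Sph2 → ℂ} (hf : f ∈ sphPoly n)
    (g : Space3 ≃ₗᵢ[ℝ] Space3) : (fun x => f (sphRotate g x)) ∈ sphPoly n := by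
  have hl : ∀ i : Fin 3, (fun x : Sph2 => ((sphRotate g x : Space3) i : ℂ)) ∈ sphPoly 2 := by
    intro i
    have : (fun x : Sph2 => ((sphRotate g x : Space3) i : ℂ)) =
        ∑ j : Fin 3, ((g (EuclideanSpace.single j 1) i : ℝ) : ℂ) •
          fun x : Sph2 => ((x : Space3) j : ℂ) := by
      ext x
      have hx : (x : Space3) = ∑ j : Fin 3, (x : Space3) j • EuclideanSpace.single j (1 : ℝ) := by
        ext k
        fin_cases k <;> simp [Fin.sum_univ_three]
      have hg : g x = ∑ j : Fin 3, (x : Space3) j • g (EuclideanSpace.single j (1 : ℝ)) := by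
        conv_lhs => rw [hx]
        simp only [map_sum, map_smul]
      simp only [sphRotate, hg, Finset.sum_apply, Pi.smul_apply, smul_eq_mul, Fin.sum_univ_three,
        PiLp.add_apply, PiLp.smul_apply]
      push_cast
      ring
    rw [this]
    exact Submodule.sum_mem _ fun j _ => Submodule.smul_mem _ _ (sphCoord_mem j)
  refine (sphPoly_le (S := (sphPoly n).comap (LinearMap.funLeft ℂ ℂ (sphRotate g)))
    fun a b c h => ?_) hf
  have := mul_mem_sphPoly (mul_mem_sphPoly (pow_mem_sphPoly (hl 0) a) (pow_mem_sphPoly (hl 1) b))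
    (pow_mem_sphPoly (hl 2) c)
  exact sphPoly_mono h this

theorem sphPoly_conj {n : ℕ} {f : Sph2 → ℂ} (hf : f ∈ sphPoly n) :
    (fun x => conj (f x)) ∈ sphPoly n := by
  refine Submodule.span_induction (p := fun f _ => (fun x => conj (f x)) ∈ sphPoly n)
    ?_ ?_ ?_ ?_ hf
  · rintro _ ⟨a, b, c, h, rfl⟩
    convert sphMonomial_mem h using 1
    ext x
    simp [sphMonomial]
  · simp only [Pi.zero_apply, map_zero]
    exact Submodule.zero_mem _
  · intro f g _ _ hf hg
    simp only [Pi.add_apply, map_add]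
    exact Submodule.add_mem _ hf hg
  · intro c f _ hf
    simp only [Pi.smul_apply, smul_eq_mul, map_mul]
    exact Submodule.smul_mem _ (conj c) hf

theorem IsSphericalHarmonic.mem_sphPoly {l : ℕ} {u : Sph2 → ℂ} (hu : IsSphericalHarmonic l u) :
    u ∈ sphPoly (l + 1) := by
  obtain ⟨p, hp, -, hup⟩ := hu
  have : u = ∑ d ∈ p.support, p.coeff d • sphMonomial (d 0) (d 1) (d 2) := by
    ext x
    rw [hup, MvPolynomial.eval_eq', Finset.sum_apply]
    refine Finset.sum_congr rfl fun d _ => ?_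
    simp [sphMonomial, Fin.prod_univ_three]
  rw [this]
  refine Submodule.sum_mem _ fun d hd => Submodule.smul_mem _ _ (sphMonomial_mem ?_)
  have := hp (MvPolynomial.mem_support_iff.1 hd)
  rw [Finsupp.weight_apply, Finsupp.sum_fintype _ _ (by simp), Fin.sum_univ_three] at this
  simp at this
  omega

theorem sphCoord_sq_sum (x : Sph2) : ((x : Space3) 0) ^ 2 + ((x : Space3) 1) ^ 2 +
    ((x : Space3) 2) ^ 2 = 1 := by
  have h : ‖(x : Space3)‖ ^ 2 = 1 := by simp
  rw [EuclideanSpace.norm_sq_eq, Fin.sum_univ_three] at h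
  simpa using h

/-- The monomials of degree less than `n` that are of degree at most one in the last variable. -/
noncomputable def reducedMonomial (n : ℕ) :
    (Σ l : Fin n, Fin (l + 1) ⊕ Fin l) → Sph2 → ℂ
  | ⟨l, .inl a⟩ => sphMonomial a (l - a) 0
  | ⟨l, .inr a⟩ => sphMonomial a (l - 1 - a) 1

/-- On the sphere x₂² = 1 - x₀² - x₁², which lowers the exponent of x₂ by two without raising the
total degree. -/
theorem sphPoly_le_span_reducedMonomial (n : ℕ) :
    sphPoly n ≤ Submodule.span ℂ (Set.range (reducedMonomial n)) := by
  refine sphPoly_le fun a b c => ?_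
  induction c using Nat.strong_induction_on generalizing a b with
  | _ c ih =>
    intro h
    match c, ih, h with
    | 0, _, h =>
      refine Submodule.subset_span ⟨⟨⟨a + b, by omega⟩, .inl ⟨a, by simp⟩⟩, ?_⟩
      simp [reducedMonomial]
    | 1, _, h =>
      refine Submodule.subset_span ⟨⟨⟨a + b + 1, by omega⟩, .inr ⟨a, by simp⟩⟩, ?_⟩
      simp [reducedMonomial]
    | c + 2, ih, h =>
      have : sphMonomial a b (c + 2) =
          sphMonomial a b c - sphMonomial (a + 2) b c - sphMonomial a (b + 2) c := by
        ext x
        have hx : (((x : Space3) 0 : ℂ)) ^ 2 + ((x : Space3) 1 : ℂ) ^ 2 +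
            ((x : Space3) 2 : ℂ) ^ 2 = 1 := by
          have := congrArg (fun r : ℝ => (r : ℂ)) (sphCoord_sq_sum x)
          push_cast at this
          exact this
        simp only [sphMonomial, Pi.sub_apply]
        linear_combination (((x : Space3) 0 : ℂ)) ^ a * ((x : Space3) 1 : ℂ) ^ b *
            ((x : Space3) 2 : ℂ) ^ c * hx
      rw [this]
      exact Submodule.sub_mem _ (Submodule.sub_mem _ (ih c (by omega) a b (by omega))
        (ih c (by omega) (a + 2) b (by omega))) (ih c (by omega) a (b + 2) (by omega))

instance sphPoly_finiteDimensional (n : ℕ) : FiniteDimensional ℂ (sphPoly n) := by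
  have := FiniteDimensional.span_of_finite ℂ (Set.finite_range (reducedMonomial n))
  exact Submodule.finiteDimensional_of_le (sphPoly_le_span_reducedMonomial n)

/-- In degree l there are l + 1 reduced monomials free of x₂ and l linear in x₂. An upper bound
suffices, as the orthonormal harmonics provide the matching lower bound. -/
theorem finrank_sphPoly_le (n : ℕ) :
    Module.finrank ℂ (sphPoly n) ≤ ∑ l : Fin n, (2 * (l : ℕ) + 1) := by
  have := FiniteDimensional.span_of_finite ℂ (Set.finite_range (reducedMonomial n))
  refine (Submodule.finrank_mono (sphPoly_le_span_reducedMonomial n)).trans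
    ((finrank_range_le_card (R := ℂ) (reducedMonomial n)).trans_eq ?_)
  rw [Fintype.card_sigma]
  refine Finset.sum_congr rfl fun l _ => ?_
  simp
  omega

/-! ### Zonal polynomials -/

/-- On the meridian x₁ = 0, symmetrising under x₀ ↦ -x₀ kills the odd powers of x₀, while the even
powers become powers of 1 - x₂². What is left is a polynomial in x₂, of no larger degree. -/
theorem exists_polynomial_of_mem_sphPoly {n : ℕ} {f : Sph2 → ℂ} (hf : f ∈ sphPoly n) :
    ∃ q ∈ Polynomial.degreeLT ℂ n, ∀ x y : Sph2, (x : Space3) 1 = 0 → (y : Space3) 1 = 0 →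
      (y : Space3) 0 = -(x : Space3) 0 → (y : Space3) 2 = (x : Space3) 2 →
      f x + f y = 2 * q.eval ((x : Space3) 2 : ℂ) := by
  refine Submodule.span_induction (p := fun f _ => ∃ q ∈ Polynomial.degreeLT ℂ n, ∀ x y : Sph2,
      (x : Space3) 1 = 0 → (y : Space3) 1 = 0 →
      (y : Space3) 0 = -(x : Space3) 0 → (y : Space3) 2 = (x : Space3) 2 →
      f x + f y = 2 * q.eval ((x : Space3) 2 : ℂ)) ?_ ?_ ?_ ?_ hf
  · rintro _ ⟨a, b, c, h, rfl⟩
    rcases Nat.eq_zero_or_pos b with rfl | hb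
    · rcases Nat.even_or_odd' a with ⟨k, rfl | rfl⟩
      · refine ⟨(1 - Polynomial.X ^ 2) ^ k * Polynomial.X ^ c, ?_, ?_⟩
        · rw [Polynomial.mem_degreeLT]
          refine lt_of_le_of_lt (Polynomial.degree_le_of_natDegree_le (n := 2 * k + c) ?_)
            (by exact_mod_cast h)
          compute_degree
          simp [mul_comm]
        · intro x y hx hy h0 h2
          have hs := sphCoord_sq_sum x
          rw [hx] at hs
          have hs' : (((x : Space3) 0 : ℂ)) ^ 2 = 1 - ((x : Space3) 2 : ℂ) ^ 2 := by
            norm_cast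
            linarith
          simp only [sphMonomial, h0, h2, hx, hy, pow_mul, Complex.ofReal_neg, neg_sq, hs']
          simp
          ring
      · refine ⟨0, Submodule.zero_mem _, fun x y hx hy h0 h2 => ?_⟩
        simp [sphMonomial, h0, h2, pow_succ, pow_mul]
    · refine ⟨0, Submodule.zero_mem _, fun x y hx hy h0 h2 => ?_⟩
      simp [sphMonomial, hx, hy, hb.ne']
  · exact ⟨0, Submodule.zero_mem _, by simp⟩
  · rintro f g _ _ ⟨p, hp, hp'⟩ ⟨q, hq, hq'⟩
    refine ⟨p + q, Submodule.add_mem _ hp hq, fun x y hx hy h0 h2 => ?_⟩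
    simp only [Pi.add_apply, Polynomial.eval_add]
    linear_combination hp' x y hx hy h0 h2 + hq' x y hx hy h0 h2
  · rintro c f _ ⟨p, hp, hp'⟩
    refine ⟨c • p, Submodule.smul_mem _ _ hp, fun x y hx hy h0 h2 => ?_⟩
    simp only [Pi.smul_apply, smul_eq_mul, Polynomial.eval_smul]
    linear_combination c * hp' x y hx hy h0 h2

/-- The north pole. -/
noncomputable def northPole : Sph2 := ⟨EuclideanSpace.single 2 1, by simp⟩

theorem inner_northPole (x : Sph2) :
    inner ℝ (x : Space3) (northPole : Space3) = (x : Space3) 2 := by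
  simp [northPole, EuclideanSpace.inner_single_right]

/-- A function on the sphere that depends on the last coordinate only. -/
def IsZonal (f : Sph2 → ℂ) : Prop := ∀ x y : Sph2, (x : Space3) 2 = (y : Space3) 2 → f x = f y

theorem IsZonalKernel.isZonal {k : Sph2 → Sph2 → ℂ} (hk : IsZonalKernel k) :
    IsZonal fun x => k x northPole := fun x y h =>
  hk _ _ _ _ (by rw [inner_northPole, inner_northPole, h])

/-- A zonal function takes the same value at `x` and at the two points of the meridian x₁ = 0 at the
height of `x`, so symmetrising there loses nothing. -/
theorem IsZonal.exists_polynomial {n : ℕ} {f : Sph2 → ℂ} (hz : IsZonal f) (hf : f ∈ sphPoly n) :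
    ∃ q ∈ Polynomial.degreeLT ℂ n, ∀ x : Sph2, f x = q.eval ((x : Space3) 2 : ℂ) := by
  obtain ⟨q, hq, h⟩ := exists_polynomial_of_mem_sphPoly hf
  refine ⟨q, hq, fun x => ?_⟩
  have hs := sphCoord_sq_sum x
  have h0 : 0 ≤ 1 - ((x : Space3) 2) ^ 2 := by
    nlinarith [sq_nonneg ((x : Space3) 0), sq_nonneg ((x : Space3) 1)]
  have hr := Real.sq_sqrt h0
  set r := Real.sqrt (1 - ((x : Space3) 2) ^ 2)
  let y₁ : Sph2 := ⟨!₂[r, 0, (x : Space3).ofLp 2], by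
    simp [EuclideanSpace.norm_eq, Fin.sum_univ_three, hr]⟩
  let y₂ : Sph2 := ⟨!₂[-r, 0, (x : Space3).ofLp 2], by
    simp [EuclideanSpace.norm_eq, Fin.sum_univ_three, hr]⟩
  have := h y₁ y₂ (by simp [y₁]) (by simp [y₂]) (by simp [y₁, y₂]) (by simp [y₁, y₂])
  rw [hz y₁ x (by simp [y₁]), hz y₂ x (by simp [y₂])] at this
  simp only [y₁] at this
  have h2 : (2 : ℂ) ≠ 0 := two_ne_zero
  apply mul_left_cancel₀ h2
  rw [two_mul, this]
  simp

theorem polynomial_mem_sphPoly {n : ℕ} {q : Polynomial ℂ} (hq : q ∈ Polynomial.degreeLT ℂ n) :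
    (fun x : Sph2 => q.eval ((x : Space3) 2 : ℂ)) ∈ sphPoly n := by
  have : (fun x : Sph2 => q.eval ((x : Space3) 2 : ℂ)) =
      ∑ i ∈ q.support, q.coeff i • sphMonomial 0 0 i := by
    ext x
    rw [Polynomial.eval_eq_sum, Polynomial.sum, Finset.sum_apply]
    simp [sphMonomial]
  rw [this]
  refine Submodule.sum_mem _ fun i hi => Submodule.smul_mem _ _ (sphMonomial_mem ?_)
  rw [Polynomial.mem_degreeLT] at hq
  have := (Polynomial.le_degree_of_ne_zero (Polynomial.mem_support_iff.1 hi)).trans_lt hq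
  simpa using this

theorem eq_zero_of_integral_mul_conj_eq_zero {f : Sph2 → ℂ} (hf : Continuous f)
    (h : ∫ x, f x * conj (f x) ∂sphArea = 0) : f = 0 := by
  have h1 : ∫ x, ‖f x‖ ^ 2 ∂sphArea = 0 := by
    have : ∀ x, f x * conj (f x) = ((‖f x‖ ^ 2 : ℝ) : ℂ) := fun x => by
      rw [Complex.mul_conj, Complex.normSq_eq_norm_sq]
    simp_rw [this] at h
    rw [integral_complex_ofReal] at h
    exact_mod_cast h
  have hc : Continuous fun x => ‖f x‖ ^ 2 := by fun_prop
  rw [integral_eq_zero_iff_of_nonneg (fun x => by positivity) hc.integrable_sphArea] at h1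
  ext x
  have h2 : ‖f x‖ ^ 2 = 0 := congrFun ((hc.ae_eq_iff_eq sphArea continuous_zero).1 h1) x
  simpa using h2

theorem integrable_mul_conj {f g : Sph2 → ℂ} (hf : Continuous f) (hg : Continuous g) :
    Integrable (fun x => f x * conj (g x)) sphArea :=
  (hf.mul (Complex.continuous_conj.comp hg)).integrable_sphArea

/-- Two zonal polynomials of degree `l` that are orthogonal to all polynomials of smaller degree are
proportional. -/
theorem IsZonal.exists_smul_eq {l : ℕ} {f g : Sph2 → ℂ} (hf : f ∈ sphPoly (l + 1))
    (hg : g ∈ sphPoly (l + 1)) (hf' : ∀ h ∈ sphPoly l, ∫ x, f x * conj (h x) ∂sphArea = 0)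
    (hg' : ∀ h ∈ sphPoly l, ∫ x, g x * conj (h x) ∂sphArea = 0)
    (hfz : IsZonal f) (hgz : IsZonal g) (hg0 : g ≠ 0) : ∃ c : ℂ, f = c • g := by
  obtain ⟨p, hp, hfp⟩ := hfz.exists_polynomial hf
  obtain ⟨q, hq, hgq⟩ := hgz.exists_polynomial hg
  rw [Polynomial.mem_degreeLT] at hp hq
  have hdrop : ∀ r : Polynomial ℂ, r.degree < (l + 1 : ℕ) → r.coeff l = 0 →
      r ∈ Polynomial.degreeLT ℂ l := by
    intro r hr h0
    rw [Polynomial.mem_degreeLT, Polynomial.degree_lt_iff_coeff_zero] at *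
    intro m hm
    rcases hm.eq_or_lt with rfl | hm
    · exact h0
    · exact hr m hm
  -- A nonzero `g` must have exact degree `l`: otherwise it would be one of the polynomials to which
  -- it is orthogonal, itself. The multiple `c` then cancels the leading coefficient of `p`, and the
  -- same argument shows that `f - c • g` vanishes.
  have hql : q.coeff l ≠ 0 := fun h0 => hg0 <| by
    have hgl : g ∈ sphPoly l := by
      have := polynomial_mem_sphPoly (hdrop q hq h0)
      rwa [← funext hgq] at this
    exact eq_zero_of_integral_mul_conj_eq_zero (continuous_of_mem_sphPoly hg) (hg' g hgl)
  set c := p.coeff l / q.coeff l with hc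
  refine ⟨c, sub_eq_zero.1 ?_⟩
  have hsub : f - c • g ∈ sphPoly l := by
    have : p - c • q ∈ Polynomial.degreeLT ℂ l := by
      refine hdrop _ ?_ ?_
      · rw [← Polynomial.mem_degreeLT] at *
        exact Submodule.sub_mem _ hp (Submodule.smul_mem _ _ hq)
      · rw [Polynomial.coeff_sub, Polynomial.coeff_smul, smul_eq_mul, hc, div_mul_cancel₀ _ hql,
          sub_self]
    convert polynomial_mem_sphPoly this using 1
    ext x
    simp [hfp, hgq]
  have hcf := continuous_of_mem_sphPoly hf
  have hcg := continuous_of_mem_sphPoly hg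
  have hch := continuous_of_mem_sphPoly hsub
  refine eq_zero_of_integral_mul_conj_eq_zero hch ?_
  set h := f - c • g with hh
  have : ∀ x, h x * conj (h x) = f x * conj (h x) - c * (g x * conj (h x)) := fun x => by
    rw [hh]
    simp only [Pi.sub_apply, Pi.smul_apply, smul_eq_mul]
    ring
  simp_rw [this]
  rw [integral_sub (integrable_mul_conj hcf hch) ((integrable_mul_conj hcg hch).const_mul c),
    integral_const_mul, hf' h hsub, hg' h hsub]
  simp

/-! ### Spaces of spherical harmonics -/

section Harmonics

variable {Y : ℕ → ℤ → Sph2 → ℂ}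

theorem mem_Icc_neg_iff {l : ℕ} {m : ℤ} : m ∈ Finset.Icc (-(l : ℤ)) l ↔ |m| ≤ l := by
  rw [Finset.mem_Icc, abs_le]

theorem IsSphericalHarmonicBasis.mem (hY : IsSphericalHarmonicBasis Y) {l : ℕ} {m : ℤ}
    (hm : |m| ≤ l) : Y l m ∈ sphPoly (l + 1) := (hY.harmonic l m hm).mem_sphPoly

theorem IsSphericalHarmonicBasis.continuous (hY : IsSphericalHarmonicBasis Y) {l : ℕ} {m : ℤ}
    (hm : |m| ≤ l) : Continuous (Y l m) := continuous_of_mem_sphPoly (hY.mem hm)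

theorem integral_sum_mul_conj {ι : Type*} (s : Finset ι) (c : ι → ℂ) {y : ι → Sph2 → ℂ}
    (hy : ∀ i ∈ s, Continuous (y i)) {f : Sph2 → ℂ} (hf : Continuous f) :
    ∫ x, (∑ i ∈ s, c i • y i) x * conj (f x) ∂sphArea =
      ∑ i ∈ s, c i * ∫ x, y i x * conj (f x) ∂sphArea := by
  simp_rw [← integral_const_mul]
  rw [← integral_finsetSum _ fun i hi => (integrable_mul_conj (hy i hi) hf).const_mul (c i)]
  refine integral_congr_ae (Eventually.of_forall fun x => ?_)
  simp [Finset.sum_mul, mul_assoc]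

theorem integral_conj_mul_conj (f g : Sph2 → ℂ) :
    ∫ x, g x * conj (f x) ∂sphArea = conj (∫ x, f x * conj (g x) ∂sphArea) := by
  rw [← integral_conj]
  simp [mul_comm]

/-- Dimension count: the harmonics of degree less than `n` are linearly independent by
orthonormality, lie in `sphPoly n`, and are as many as the upper bound for its dimension. -/
theorem IsSphericalHarmonicBasis.span_eq (hY : IsSphericalHarmonicBasis Y) (n : ℕ) :
    Submodule.span ℂ (Set.range fun i : Σ l : Fin n, Finset.Icc (-((l : ℕ) : ℤ)) (l : ℕ) =>
      Y i.1 i.2) = sphPoly n := by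
  set y := fun i : Σ l : Fin n, Finset.Icc (-((l : ℕ) : ℤ)) (l : ℕ) => Y i.1 i.2 with hy
  have hm : ∀ i : Σ l : Fin n, Finset.Icc (-((l : ℕ) : ℤ)) (l : ℕ), |(i.2 : ℤ)| ≤ (i.1 : ℕ) :=
    fun i => mem_Icc_neg_iff.1 i.2.2
  have hle : Submodule.span ℂ (Set.range y) ≤ sphPoly n := by
    rw [Submodule.span_le]
    rintro _ ⟨i, rfl⟩
    exact sphPoly_mono i.1.2 (hY.mem (hm i))
  have hli : LinearIndependent ℂ y := by
    rw [Fintype.linearIndependent_iff]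
    intro c hc i
    have h := integral_sum_mul_conj Finset.univ c (y := y) (fun j _ => hY.continuous (hm j))
      (hY.continuous (hm i))
    rw [hc, Finset.sum_eq_single i] at h
    · rw [hY.orthonormal _ _ _ _ (hm i) (hm i)] at h
      simpa using h.symm
    · intro j _ hji
      rw [hY.orthonormal _ _ _ _ (hm j) (hm i), if_neg, mul_zero]
      rintro ⟨h1, h2⟩
      obtain ⟨⟨j1, hj1⟩, j2, hj2⟩ := j
      obtain ⟨⟨i1, hi1⟩, i2, hi2⟩ := i
      simp only at h1 h2
      subst h1 h2
      exact hji rfl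
    · simp
  refine Submodule.eq_of_le_of_finrank_le hle ?_
  rw [finrank_span_eq_card hli, Fintype.card_sigma]
  refine (finrank_sphPoly_le n).trans_eq (Finset.sum_congr rfl fun l _ => ?_)
  simp
  omega

theorem IsSphericalHarmonicBasis.expansion (hY : IsSphericalHarmonicBasis Y) {n : ℕ}
    {f : Sph2 → ℂ} (hf : f ∈ sphPoly n) :
    f = ∑ l ∈ Finset.range n, ∑ m ∈ Finset.Icc (-(l : ℤ)) l,
      (∫ x, f x * conj (Y l m x) ∂sphArea) • Y l m := by
  rw [← hY.span_eq n] at hf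
  obtain ⟨c, hc⟩ := (Submodule.mem_span_range_iff_exists_fun ℂ).1 hf
  have hm : ∀ i : Σ l : Fin n, Finset.Icc (-((l : ℕ) : ℤ)) (l : ℕ), |(i.2 : ℤ)| ≤ (i.1 : ℕ) :=
    fun i => mem_Icc_neg_iff.1 i.2.2
  have key : ∀ i : Σ l : Fin n, Finset.Icc (-((l : ℕ) : ℤ)) (l : ℕ),
      ∫ x, f x * conj (Y i.1 i.2 x) ∂sphArea = c i := by
    intro i
    rw [← hc, integral_sum_mul_conj Finset.univ c (y := fun i => Y i.1 i.2)
        (fun j _ => hY.continuous (hm j)) (hY.continuous (hm i)), Finset.sum_eq_single i]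
    · rw [hY.orthonormal _ _ _ _ (hm i) (hm i)]
      simp
    · intro j _ hji
      rw [hY.orthonormal _ _ _ _ (hm j) (hm i), if_neg, mul_zero]
      rintro ⟨h1, h2⟩
      obtain ⟨⟨j1, hj1⟩, j2, hj2⟩ := j
      obtain ⟨⟨i1, hi1⟩, i2, hi2⟩ := i
      simp only at h1 h2
      subst h1 h2
      exact hji rfl
    · simp
  rw [Finset.sum_range fun l : ℕ => ∑ m ∈ Finset.Icc (-(l : ℤ)) l,
      (∫ x, f x * conj (Y l m x) ∂sphArea) • Y l m]
  conv_lhs => rw [← hc, Fintype.sum_sigma]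
  refine Finset.sum_congr rfl fun l _ => ?_
  rw [← Finset.sum_attach (Finset.Icc (-((l : ℕ) : ℤ)) (l : ℕ))]
  exact Finset.sum_congr rfl fun m _ => by rw [← key ⟨l, m⟩]

/-- The polynomials of degree at most `l` on the sphere that are orthogonal to all polynomials of
degree less than `l`. -/
noncomputable def harmSpace (l : ℕ) : Submodule ℂ (Sph2 → ℂ) where
  carrier := {f | f ∈ sphPoly (l + 1) ∧ ∀ h ∈ sphPoly l, ∫ x, f x * conj (h x) ∂sphArea = 0}
  zero_mem' := ⟨Submodule.zero_mem _, by simp⟩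
  add_mem' := by
    rintro f g ⟨hf, hf'⟩ ⟨hg, hg'⟩
    refine ⟨Submodule.add_mem _ hf hg, fun h hh => ?_⟩
    have hc := continuous_of_mem_sphPoly hh
    simp only [Pi.add_apply, add_mul]
    rw [integral_add (integrable_mul_conj (continuous_of_mem_sphPoly hf) hc)
      (integrable_mul_conj (continuous_of_mem_sphPoly hg) hc), hf' h hh, hg' h hh, add_zero]
  smul_mem' := by
    rintro c f ⟨hf, hf'⟩
    refine ⟨Submodule.smul_mem _ _ hf, fun h hh => ?_⟩
    simp only [Pi.smul_apply, smul_eq_mul, mul_assoc]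
    rw [integral_const_mul, hf' h hh, mul_zero]

theorem harmSpace_continuous {l : ℕ} {f : Sph2 → ℂ} (hf : f ∈ harmSpace l) : Continuous f :=
  continuous_of_mem_sphPoly hf.1

theorem harmSpace_conj {l : ℕ} {f : Sph2 → ℂ} (hf : f ∈ harmSpace l) :
    (fun x => conj (f x)) ∈ harmSpace l := by
  refine ⟨sphPoly_conj hf.1, fun h hh => ?_⟩
  have h0 := congrArg conj (hf.2 _ (sphPoly_conj hh))
  rw [← integral_conj] at h0
  simpa using h0

theorem harmSpace_rotate {l : ℕ} {f : Sph2 → ℂ} (hf : f ∈ harmSpace l)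
    (g : Space3 ≃ₗᵢ[ℝ] Space3) : (fun x => f (sphRotate g x)) ∈ harmSpace l := by
  refine ⟨sphPoly_rotate hf.1 g, fun h hh => ?_⟩
  rw [← hf.2 _ (sphPoly_rotate hh g.symm),
    ← integral_sphRotate g fun x => f x * conj (h (sphRotate g.symm x))]
  simp_rw [sphRotate_apply_symm]

/-- A polynomial of degree less than `l` is a combination of harmonics of smaller degree, all
orthogonal to `Y l m`. -/
theorem IsSphericalHarmonicBasis.mem_harmSpace (hY : IsSphericalHarmonicBasis Y) {l : ℕ} {m : ℤ}
    (hm : |m| ≤ l) : Y l m ∈ harmSpace l := by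
  refine ⟨hY.mem hm, fun h hh => ?_⟩
  rw [integral_conj_mul_conj, hY.expansion hh, Finset.sum_sigma' (Finset.range l)]
  rw [integral_sum_mul_conj _ _ _ (hY.continuous hm), Finset.sum_eq_zero, map_zero]
  · rintro ⟨l', m'⟩ hlm
    rw [Finset.mem_sigma, Finset.mem_range] at hlm
    rw [hY.orthonormal _ _ _ _ (mem_Icc_neg_iff.1 hlm.2) hm, if_neg, mul_zero]
    exact fun h => hlm.1.ne h.1
  · rintro ⟨l', m'⟩ hlm
    exact hY.continuous (mem_Icc_neg_iff.1 (Finset.mem_sigma.1 hlm).2)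

theorem IsSphericalHarmonicBasis.expansion_harmSpace (hY : IsSphericalHarmonicBasis Y) {l : ℕ}
    {f : Sph2 → ℂ} (hf : f ∈ harmSpace l) :
    f = ∑ m ∈ Finset.Icc (-(l : ℤ)) l, (∫ x, f x * conj (Y l m x) ∂sphArea) • Y l m := by
  have h := hY.expansion hf.1
  rw [Finset.sum_range_succ, Finset.sum_eq_zero, zero_add] at h
  · exact h
  · intro l' hl'
    refine Finset.sum_eq_zero fun m hm => ?_
    rw [hf.2 _ (sphPoly_mono (Finset.mem_range.1 hl') (hY.mem (mem_Icc_neg_iff.1 hm))), zero_smul]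

/-! ### The reproducing kernel and the Funk–Hecke formula -/

/-- The reproducing kernel of the spherical harmonics of degree `l`. -/
noncomputable def harmKernel (Y : ℕ → ℤ → Sph2 → ℂ) (l : ℕ) (x y : Sph2) : ℂ :=
  ∑ m ∈ Finset.Icc (-(l : ℤ)) l, Y l m x * conj (Y l m y)

theorem conj_harmKernel (l : ℕ) (x y : Sph2) : conj (harmKernel Y l x y) = harmKernel Y l y x := by
  simp [harmKernel, mul_comm]

theorem IsSphericalHarmonicBasis.harmKernel_mem (hY : IsSphericalHarmonicBasis Y) (l : ℕ)
    (y : Sph2) : (fun x => harmKernel Y l x y) ∈ harmSpace l := by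
  have : (fun x => harmKernel Y l x y) =
      ∑ m ∈ Finset.Icc (-(l : ℤ)) l, conj (Y l m y) • Y l m := by
    ext x
    simp [harmKernel, mul_comm]
  rw [this]
  exact Submodule.sum_mem _ fun m hm =>
    Submodule.smul_mem _ _ (hY.mem_harmSpace (mem_Icc_neg_iff.1 hm))

theorem IsSphericalHarmonicBasis.reproducing (hY : IsSphericalHarmonicBasis Y) {l : ℕ}
    {f : Sph2 → ℂ} (hf : f ∈ harmSpace l) (x : Sph2) :
    ∫ y, harmKernel Y l x y * f y ∂sphArea = f x := by
  conv_rhs => rw [hY.expansion_harmSpace hf]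
  have hc := harmSpace_continuous hf
  simp only [harmKernel, Finset.sum_mul, Finset.sum_apply, Pi.smul_apply, smul_eq_mul]
  rw [integral_finsetSum]
  · refine Finset.sum_congr rfl fun m hm => ?_
    rw [mul_comm, ← integral_const_mul]
    congr 1
    ext y
    ring
  · intro m hm
    have := integrable_mul_conj hc (hY.continuous (mem_Icc_neg_iff.1 hm))
    refine (this.const_mul (Y l m x)).congr (Eventually.of_forall fun y => ?_)
    ring

/-- Since `harmSpace l` is rotation invariant, the rotated kernel lies in it too. Reproducing the
rotated kernel by the original one, and the original by the rotated one, expresses both by the same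
integral up to conjugation and a change of variable. -/
theorem IsSphericalHarmonicBasis.isZonalKernel_harmKernel (hY : IsSphericalHarmonicBasis Y)
    (l : ℕ) : IsZonalKernel (harmKernel Y l) := by
  refine IsZonalKernel.of_rotation fun g x z => ?_
  have h1 := hY.reproducing (harmSpace_rotate (hY.harmKernel_mem l (sphRotate g z)) g) x
  have h2 := hY.reproducing (harmSpace_rotate (hY.harmKernel_mem l x) g.symm) (sphRotate g z)
  rw [sphRotate_apply_symm] at h2
  rw [← h1, ← conj_harmKernel l z x, ← h2, ← integral_conj, ← integral_sphRotate g.symm]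
  congr 1
  ext y
  rw [map_mul, conj_harmKernel, conj_harmKernel, sphRotate_symm_apply, mul_comm]

/-- The diagonal is constant by zonality, and its integral counts the orthonormal functions of
degree `l`. -/
theorem IsSphericalHarmonicBasis.harmKernel_diag (hY : IsSphericalHarmonicBasis Y) (l : ℕ)
    (x : Sph2) : (sphArea.real Set.univ : ℂ) * harmKernel Y l x x = 2 * l + 1 := by
  have h : ∫ y, harmKernel Y l y y ∂sphArea = 2 * l + 1 := by
    simp only [harmKernel]
    rw [integral_finsetSum _ fun m hm => integrable_mul_conj
      (hY.continuous (mem_Icc_neg_iff.1 hm)) (hY.continuous (mem_Icc_neg_iff.1 hm)),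
      Finset.sum_congr rfl fun m hm => hY.orthonormal _ _ _ _ (mem_Icc_neg_iff.1 hm)
        (mem_Icc_neg_iff.1 hm)]
    simp only [and_self, if_true, Finset.sum_const, Int.card_Icc, nsmul_eq_mul, mul_one]
    have : ((l : ℤ) + 1 - -l).toNat = 2 * l + 1 := by omega
    rw [this]
    push_cast
    ring
  rw [← h, integral_congr_ae (Eventually.of_forall fun y =>
    (hY.isZonalKernel_harmKernel l).diag y x), integral_const, Complex.real_smul]

theorem IsSphericalHarmonicBasis.harmKernel_northPole_ne_zero (hY : IsSphericalHarmonicBasis Y)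
    (l : ℕ) : (fun x => harmKernel Y l x northPole) ≠ 0 := fun h0 => by
  have h := hY.harmKernel_diag l northPole
  rw [congrFun h0 northPole, Pi.zero_apply, mul_zero] at h
  have : (2 * l + 1 : ℂ) ≠ 0 := by exact_mod_cast (2 * l).succ_ne_zero
  exact this h.symm

/-- **Funk–Hecke formula**: the spherical harmonics of degree `l` are eigenfunctions of the integral
operators with zonal kernels, with an eigenvalue that depends on `l` only. -/
theorem IsSphericalHarmonicBasis.funkHecke (hY : IsSphericalHarmonicBasis Y) {k : Sph2 → Sph2 → ℂ}
    (hk : Continuous fun p : Sph2 × Sph2 => k p.1 p.2) (hz : IsZonalKernel k) (l : ℕ) :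
    ∃ c : ℂ, ∀ m : ℤ, |m| ≤ l → ∀ x, ∫ y, k x y * Y l m y ∂sphArea = c * Y l m x := by
  have hkx : ∀ x, Continuous (k x) := fun x => hk.comp (Continuous.prodMk_right x)
  -- `q` is the kernel of the integral operator of `k` composed with the projection onto degree `l`.
  -- It is again zonal, and the aim is to show that it is a multiple of the reproducing kernel.
  set q : Sph2 → Sph2 → ℂ := fun x y => ∫ u, k x u * harmKernel Y l u y ∂sphArea with hq
  have hpz := hY.isZonalKernel_harmKernel l
  have hqz : IsZonalKernel q := by
    refine IsZonalKernel.of_rotation fun g x y => ?_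
    simp only [hq]
    rw [← integral_sphRotate g]
    simp_rw [hz.rotate, hpz.rotate]
  have hqe : ∀ x y, q x y = ∑ m ∈ Finset.Icc (-(l : ℤ)) l,
      (∫ u, k x u * Y l m u ∂sphArea) * conj (Y l m y) := by
    intro x y
    simp only [hq, harmKernel, Finset.mul_sum]
    rw [integral_finsetSum]
    · refine Finset.sum_congr rfl fun m _ => ?_
      rw [← integral_mul_const]
      simp only [mul_assoc]
    · intro m hm
      have := ((hkx x).mul (hY.continuous (mem_Icc_neg_iff.1 hm))).integrable_sphArea
      refine (this.mul_const (conj (Y l m y))).congr (Eventually.of_forall fun u => ?_)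
      simp [mul_assoc]
  -- The expansion `hqe` concerns the second variable; the symmetry of zonal kernels transfers it to
  -- the first.
  have hqm : (fun x => q x northPole) ∈ harmSpace l := by
    have : (fun x => q x northPole) = ∑ m ∈ Finset.Icc (-(l : ℤ)) l,
        (∫ u, k northPole u * Y l m u ∂sphArea) • fun y => conj (Y l m y) := by
      ext x
      rw [hqz.symm, hqe]
      simp
    rw [this]
    exact Submodule.sum_mem _ fun m hm => Submodule.smul_mem _ _
      (harmSpace_conj (hY.mem_harmSpace (mem_Icc_neg_iff.1 hm)))
  have hpm := hY.harmKernel_mem l northPole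
  -- The zonal functions in `harmSpace l` form a line, which settles the case of the north pole;
  -- rotating `y` to the pole gives all other pairs.
  obtain ⟨c, hc⟩ := IsZonal.exists_smul_eq hqm.1 hpm.1 hqm.2 hpm.2 hqz.isZonal hpz.isZonal
    (hY.harmKernel_northPole_ne_zero l)
  have hqc : ∀ x y, q x y = c * harmKernel Y l x y := by
    intro x y
    obtain ⟨g, -, hg, -⟩ := exists_rotation_map_pair y y northPole northPole (by simp)
    rw [← hqz.rotate g, ← hpz.rotate g, hg]
    exact congrFun hc (sphRotate g x)
  refine ⟨c, fun m hm x => ?_⟩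
  have h1 : ∫ y, q x y * Y l m y ∂sphArea = c * Y l m x := by
    simp_rw [hqc, mul_assoc]
    rw [integral_const_mul, hY.reproducing (hY.mem_harmSpace hm)]
  rw [← h1]
  -- By orthonormality, integrating `q x` against `Y l m` returns the integral of `k x` against `Y l
  -- m`. This is stated in conjugated form, the expansion of `q x` being in the conjugate harmonics.
  have h2 : ∫ y, (∑ m' ∈ Finset.Icc (-(l : ℤ)) l, conj (∫ u, k x u * Y l m' u ∂sphArea) •
      Y l m') y * conj (Y l m y) ∂sphArea = conj (∫ y, k x y * Y l m y ∂sphArea) := by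
    rw [integral_sum_mul_conj _ _ (fun m' hm' => hY.continuous (mem_Icc_neg_iff.1 hm'))
      (hY.continuous hm), Finset.sum_eq_single m]
    · rw [hY.orthonormal _ _ _ _ hm hm]
      simp
    · intro m' hm' hne
      rw [hY.orthonormal _ _ _ _ (mem_Icc_neg_iff.1 hm') hm, if_neg (fun h => hne h.2), mul_zero]
    · exact fun h => absurd (mem_Icc_neg_iff.2 hm) h
  rw [← Complex.conj_conj (∫ y, k x y * Y l m y ∂sphArea), ← h2, ← integral_conj]
  congr 1
  ext y
  simp [hqe]

end Harmonics

/-! ### The Hilbert basis of spherical harmonics -/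

/-- The pairs `(l, m)` with `-l ≤ m ≤ l`. -/
abbrev HarmIndex : Type := Σ l : ℕ, Finset.Icc (-(l : ℤ)) (l : ℤ)

theorem HarmIndex.abs_le (i : HarmIndex) : |(i.2 : ℤ)| ≤ (i.1 : ℕ) := mem_Icc_neg_iff.1 i.2.2

theorem HarmIndex.ext_iff' {i j : HarmIndex} : i = j ↔ i.1 = j.1 ∧ (i.2 : ℤ) = j.2 := by
  constructor
  · rintro rfl
    exact ⟨rfl, rfl⟩
  · obtain ⟨i1, i2, hi⟩ := i
    obtain ⟨j1, j2, hj⟩ := j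
    rintro ⟨h1, h2⟩
    simp only at h1 h2
    subst h1 h2
    rfl

theorem HarmIndex.hasSum_fst {G : Type*} [AddCommMonoid G] [TopologicalSpace G] [ContinuousAdd G]
    [RegularSpace G] {g : ℕ → G} {a : G} (h : HasSum (fun i : HarmIndex => g i.1) a) :
    HasSum (fun l : ℕ => (2 * l + 1) • g l) a :=
  h.sigma fun l => by
    have := hasSum_fintype fun _ : Finset.Icc (-(l : ℤ)) (l : ℤ) => g l
    convert this using 1
    rw [Finset.sum_const, Finset.card_univ, Fintype.card_coe, Int.card_Icc]
    congr 1
    omega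

section Basis

variable {Y : ℕ → ℤ → Sph2 → ℂ}

theorem IsSphericalHarmonicBasis.memLp (hY : IsSphericalHarmonicBasis Y) (i : HarmIndex) :
    MemLp (Y i.1 i.2) 2 sphArea := by
  obtain ⟨M, hM⟩ := isCompact_univ.exists_bound_of_continuousOn (hY.continuous i.abs_le).continuousOn
  exact MemLp.of_bound (hY.continuous i.abs_le).aestronglyMeasurable M
    (Eventually.of_forall fun x => hM x (Set.mem_univ x))

/-- The spherical harmonics as elements of `L²`. -/
noncomputable def IsSphericalHarmonicBasis.toL2 (hY : IsSphericalHarmonicBasis Y) (i : HarmIndex) :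
    SphL2 := (hY.memLp i).toLp (Y i.1 i.2)

theorem IsSphericalHarmonicBasis.coeFn_toL2 (hY : IsSphericalHarmonicBasis Y) (i : HarmIndex) :
    hY.toL2 i =ᵐ[sphArea] Y i.1 i.2 := (hY.memLp i).coeFn_toLp

theorem IsSphericalHarmonicBasis.inner_toL2 (hY : IsSphericalHarmonicBasis Y) (i : HarmIndex)
    (h : SphL2) : inner ℂ (hY.toL2 i) h = ∫ x, h x * conj (Y i.1 i.2 x) ∂sphArea := by
  rw [L2.inner_def]
  refine integral_congr_ae ?_
  filter_upwards [hY.coeFn_toL2 i] with x hx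
  rw [hx, RCLike.inner_apply]

theorem IsSphericalHarmonicBasis.orthonormal_toL2 (hY : IsSphericalHarmonicBasis Y) :
    Orthonormal ℂ hY.toL2 := by
  rw [orthonormal_iff_ite]
  intro i j
  rw [hY.inner_toL2]
  have : ∫ x, hY.toL2 j x * conj (Y i.1 i.2 x) ∂sphArea =
      ∫ x, Y j.1 j.2 x * conj (Y i.1 i.2 x) ∂sphArea := by
    refine integral_congr_ae ?_
    filter_upwards [hY.coeFn_toL2 j] with x hx
    rw [hx]
  rw [this, hY.orthonormal _ _ _ _ j.abs_le i.abs_le]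
  simp only [HarmIndex.ext_iff', eq_comm]

theorem integrable_sphL2_mul_conj (h : SphL2) {f : Sph2 → ℂ} (hf : Continuous f) :
    Integrable (fun x => h x * conj (f x)) sphArea := by
  obtain ⟨M, hM⟩ := isCompact_univ.exists_bound_of_continuousOn hf.continuousOn
  refine (sphL2_integrable h).mul_bdd (c := M)
    (Complex.continuous_conj.comp hf).aestronglyMeasurable (Eventually.of_forall fun x => ?_)
  simpa using hM x (Set.mem_univ x)

/-- The coordinate functions on the sphere, as continuous maps. -/
noncomputable def sphCoordMap (i : Fin 3) : C(Sph2, ℂ) := ⟨_, continuous_sphCoord i⟩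

theorem exists_mem_sphPoly_of_mem_adjoin {f : C(Sph2, ℂ)}
    (hf : f ∈ StarAlgebra.adjoin ℂ (Set.range sphCoordMap)) :
    ∃ n, (f : Sph2 → ℂ) ∈ sphPoly (n + 1) := by
  induction hf using StarAlgebra.adjoin_induction with
  | mem f h =>
    obtain ⟨i, rfl⟩ := h
    exact ⟨1, sphCoord_mem i⟩
  | algebraMap r =>
    refine ⟨0, ?_⟩
    convert Submodule.smul_mem (sphPoly 1) r one_mem_sphPoly using 1
    ext x
    simp
  | add f g _ _ h₁ h₂ =>
    obtain ⟨n, hn⟩ := h₁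
    obtain ⟨m, hm⟩ := h₂
    exact ⟨n + m, Submodule.add_mem _ (sphPoly_mono (by omega) hn) (sphPoly_mono (by omega) hm)⟩
  | mul f g _ _ h₁ h₂ =>
    obtain ⟨n, hn⟩ := h₁
    obtain ⟨m, hm⟩ := h₂
    exact ⟨n + m, mul_mem_sphPoly hn hm⟩
  | star f _ h =>
    obtain ⟨n, hn⟩ := h
    exact ⟨n, sphPoly_conj hn⟩

theorem adjoin_sphCoordMap_topologicalClosure :
    (StarAlgebra.adjoin ℂ (Set.range sphCoordMap)).topologicalClosure = ⊤ := by
  refine ContinuousMap.starSubalgebra_topologicalClosure_eq_top_of_separatesPoints _ ?_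
  intro x y hxy
  have : ∃ i : Fin 3, (x : Space3) i ≠ (y : Space3) i := by
    by_contra! h
    exact hxy (Subtype.ext (PiLp.ext h))
  obtain ⟨i, hi⟩ := this
  refine ⟨_, ⟨sphCoordMap i, StarAlgebra.subset_adjoin ℂ _ ⟨i, rfl⟩, rfl⟩, ?_⟩
  simpa [sphCoordMap] using hi

/-- Completeness by Stone–Weierstrass: `h` is orthogonal to all polynomials, which are uniformly
dense in the continuous functions, and these are dense in L². -/
theorem IsSphericalHarmonicBasis.eq_zero_of_inner_eq_zero (hY : IsSphericalHarmonicBasis Y)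
    (h : SphL2) (hh : ∀ i, inner ℂ (hY.toL2 i) h = 0) : h = 0 := by
  have hpoly : ∀ n, ∀ f ∈ sphPoly n, ∫ x, h x * conj (f x) ∂sphArea = 0 := by
    intro n f hf
    rw [hY.expansion hf, Finset.sum_sigma' (Finset.range n)]
    simp only [Finset.sum_apply, map_sum, Finset.mul_sum, Pi.smul_apply, smul_eq_mul, map_mul]
    have hc : ∀ i ∈ (Finset.range n).sigma fun l => Finset.Icc (-(l : ℤ)) (l : ℤ),
        |i.2| ≤ (i.1 : ℕ) := fun i hi => mem_Icc_neg_iff.1 (Finset.mem_sigma.1 hi).2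
    rw [integral_finsetSum]
    · refine Finset.sum_eq_zero fun i hi => ?_
      simp_rw [mul_left_comm (h _)]
      rw [integral_const_mul, ← hY.inner_toL2 ⟨i.1, i.2, (Finset.mem_sigma.1 hi).2⟩, hh, mul_zero]
    · intro i hi
      simp_rw [mul_left_comm (h _)]
      exact (integrable_sphL2_mul_conj h (hY.continuous (hc i hi))).const_mul _
  have hinner : ∀ f : C(Sph2, ℂ), inner ℂ (ContinuousMap.toLp 2 sphArea ℂ f) h =
      ∫ x, h x * conj (f x) ∂sphArea := by
    intro f
    rw [L2.inner_def]
    refine integral_congr_ae ?_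
    filter_upwards [ContinuousMap.coeFn_toLp (𝕜 := ℂ) (p := 2) sphArea f] with x hx
    rw [hx, RCLike.inner_apply]
  have hC : ∀ f : C(Sph2, ℂ), inner ℂ (ContinuousMap.toLp 2 sphArea ℂ f) h = 0 := by
    have hcl : IsClosed {f : C(Sph2, ℂ) | inner ℂ (ContinuousMap.toLp 2 sphArea ℂ f) h = 0} :=
      isClosed_eq (by fun_prop) continuous_const
    intro f
    have hf : f ∈ (StarAlgebra.adjoin ℂ (Set.range sphCoordMap)).topologicalClosure := by
      rw [adjoin_sphCoordMap_topologicalClosure]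
      trivial
    refine hcl.closure_subset_iff.2 ?_ hf
    intro f hf
    obtain ⟨n, hn⟩ := exists_mem_sphPoly_of_mem_adjoin hf
    rw [Set.mem_ofPred_eq, hinner, hpoly _ _ hn]
  have hd := ContinuousMap.toLp_denseRange ℂ sphArea ℂ (p := 2) (α := Sph2) (by norm_num)
  have := hd.induction_on (p := fun g : SphL2 => inner ℂ g h = 0) h
    (isClosed_eq (by fun_prop) continuous_const) hC
  exact inner_self_eq_zero.1 this

/-- The spherical harmonics form a Hilbert basis of `L²` of the sphere. -/
noncomputable def IsSphericalHarmonicBasis.hilbertBasis (hY : IsSphericalHarmonicBasis Y) :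
    HilbertBasis HarmIndex ℂ SphL2 :=
  HilbertBasis.mkOfOrthogonalEqBot hY.orthonormal_toL2 <| by
    rw [Submodule.eq_bot_iff]
    intro h hh
    refine hY.eq_zero_of_inner_eq_zero h fun i => ?_
    exact (Submodule.mem_orthogonal _ _).1 hh _ (Submodule.subset_span ⟨i, rfl⟩)

@[simp]
theorem IsSphericalHarmonicBasis.hilbertBasis_apply (hY : IsSphericalHarmonicBasis Y)
    (i : HarmIndex) : hY.hilbertBasis i = hY.toL2 i :=
  congrFun (HilbertBasis.coe_mkOfOrthogonalEqBot _ _) i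

end Basis

/-! ### A lower bound for the trace norm -/

-- |A|² v = |c|² v, so w = |A| v - |c| v satisfies |A| w = -|c| w; positivity of |A| forces w = 0 if
-- c ≠ 0. If c = 0, then ‖|A| v‖² = ⟨v, |A|² v⟩ = 0.
open ContinuousLinearMap in
theorem cfcAbs_apply_of_eigenvector {E : Type*} [NormedAddCommGroup E] [InnerProductSpace ℂ E]
    [CompleteSpace E] {A : E →L[ℂ] E} {v : E} {c : ℂ} (h : A v = c • v)
    (h' : adjoint A v = conj c • v) : CFC.abs A v = (‖c‖ : ℂ) • v := by
  set B := CFC.abs A with hB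
  have hpos : B.IsPositive := nonneg_iff_isPositive B |>.1 (CFC.abs_nonneg A)
  have hBB : B (B v) = ((‖c‖ : ℂ) * ‖c‖) • v := by
    have : B * B = star A * A := CFC.abs_mul_abs A
    have hv := congrArg (fun S : E →L[ℂ] E => S v) this
    change B (B v) = star A (A v) at hv
    rw [hv, h, star_eq_adjoint, map_smul, h', smul_smul, Complex.mul_conj, Complex.normSq_eq_norm_sq]
    push_cast
    rw [sq]
  set w := B v - (‖c‖ : ℂ) • v with hw
  have hBw : B w = -((‖c‖ : ℂ) • w) := by
    rw [hw, map_sub, map_smul, hBB, smul_sub, smul_smul]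
    abel
  rcases eq_or_ne c 0 with rfl | hc
  · have h0 : inner ℂ (B v) (B v) = (0 : ℂ) := by
      rw [hpos.isSymmetric.apply_clm, hBB]
      simp
    simpa using inner_self_eq_zero.1 h0
  · have h1 := hpos.re_inner_nonneg_left w
    rw [hBw, inner_neg_left, inner_smul_left, inner_self_eq_norm_sq_to_K] at h1
    have h2 : ‖c‖ * ‖w‖ ^ 2 ≤ 0 := by
      have : RCLike.re (-(conj (‖c‖ : ℂ) * ((‖w‖ : ℝ) : ℂ) ^ 2)) = -(‖c‖ * ‖w‖ ^ 2) := by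
        rw [Complex.conj_ofReal]
        norm_cast
      have h3 := h1.trans_eq this
      linarith
    have h3 : ‖w‖ = 0 := by
      have : 0 < ‖c‖ := norm_pos_iff.2 hc
      by_contra hne
      have := mul_pos this (pow_pos ((norm_nonneg w).lt_of_ne' hne) 2)
      linarith
    exact sub_eq_zero.1 (norm_eq_zero.1 h3)

/-- An operator diagonal in `b` has a diagonal adjoint, so |A| is diagonal with entries |c i|;
finite sets of basis vectors compete in the supremum defining the trace norm. -/
theorem HilbertBasis.sum_norm_le_traceNorm {ι E : Type*} [NormedAddCommGroup E]
    [InnerProductSpace ℂ E] [CompleteSpace E] (b : HilbertBasis ι ℂ E) {A : E →L[ℂ] E} {c : ι → ℂ}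
    (h : ∀ i, A (b i) = c i • b i) :
    ∑' i, ENNReal.ofReal ‖c i‖ ≤ traceNorm A := by
  classical
  have hadj : ∀ i, ContinuousLinearMap.adjoint A (b i) = conj (c i) • b i := by
    intro i
    refine b.repr.injective (lp.ext (funext fun j => ?_))
    rw [b.repr_apply_apply, b.repr_apply_apply, ContinuousLinearMap.adjoint_inner_right, h,
      inner_smul_left, inner_smul_right, orthonormal_iff_ite.1 b.orthonormal]
    split_ifs with hij
    · rw [hij]
    · simp
  rw [ENNReal.tsum_eq_iSup_sum]
  refine iSup_le fun s => ?_
  have hinj := b.orthonormal.linearIndependent.injective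
  have hon : Orthonormal ℂ fun v : s.image b => (v : E) := by
    have := b.orthonormal.toSubtypeRange
    exact this.comp (fun v : s.image b => (⟨v.1, by
      obtain ⟨i, -, hi⟩ := Finset.mem_image.1 v.2
      exact ⟨i, hi⟩⟩ : Set.range b)) fun v w hvw => Subtype.ext (congrArg (fun u => u.1) hvw)
  refine le_trans (le_of_eq ?_) (le_iSup₂ (f := fun (s : Finset E)
    (_ : Orthonormal ℂ (fun v : s => (v : E))) =>
    ∑ v ∈ s, ENNReal.ofReal (inner ℂ v (CFC.abs A v)).re) (s.image b) hon)
  rw [Finset.sum_image hinj.injOn]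
  refine Finset.sum_congr rfl fun i _ => ?_
  rw [cfcAbs_apply_of_eigenvector (h i) (hadj i), inner_smul_right,
    orthonormal_iff_ite.1 b.orthonormal, if_pos rfl]
  simp

theorem IsSphericalHarmonicBasis.tsum_norm_le_traceNorm {Y : ℕ → ℤ → Sph2 → ℂ}
    (hY : IsSphericalHarmonicBasis Y) {k : Sph2 → Sph2 → ℝ}
    (hk : Continuous fun p : Sph2 × Sph2 => k p.1 p.2) {c : HarmIndex → ℂ}
    (h : ∀ i x, ∫ y, (k x y : ℂ) * Y i.1 i.2 y ∂sphArea = c i * Y i.1 i.2 x) :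
    ∑' i, ENNReal.ofReal ‖c i‖ ≤ traceNorm (kernelOperator k hk) := by
  refine hY.hilbertBasis.sum_norm_le_traceNorm fun i => ?_
  rw [hY.hilbertBasis_apply]
  refine Lp.ext ?_
  filter_upwards [kernelOperator_apply k hk (hY.toL2 i), Lp.coeFn_smul (c i) (hY.toL2 i),
    hY.coeFn_toL2 i] with x h1 h2 h3
  rw [h1, h2, Pi.smul_apply, h3, smul_eq_mul, ← h]
  refine integral_congr_ae ?_
  filter_upwards [hY.coeFn_toL2 i] with y hy
  rw [hy]

/-! ### Square-integrable random elements of a Hilbert space -/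

section RandomElement

variable {Ω : Type*} [MeasurableSpace Ω] {P : Measure Ω}

theorem lintegral_enorm_sq_coeFn {E : Type*} [NormedAddCommGroup E] (F : Lp E 2 P) :
    ∫⁻ ω, ‖F ω‖ₑ ^ 2 ∂P = ‖F‖ₑ ^ 2 := by
  have h := eLpNorm_nnreal_pow_eq_lintegral (f := F) (μ := P) (p := 2) two_ne_zero
  rw [Lp.enorm_def]
  simpa using h.symm

theorem lintegral_enorm_sq_congr {E : Type*} [NormedAddCommGroup E] {f g : Ω → E}
    (h : f =ᵐ[P] g) : ∫⁻ ω, ‖f ω‖ₑ ^ 2 ∂P = ∫⁻ ω, ‖g ω‖ₑ ^ 2 ∂P := by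
  refine lintegral_congr_ae ?_
  filter_upwards [h] with ω hω
  rw [hω]

variable {E : Type*} [NormedAddCommGroup E] [InnerProductSpace ℂ E]

theorem norm_sq_eq_integral (F : Lp E 2 P) : ‖F‖ ^ 2 = ∫ ω, ‖F ω‖ ^ 2 ∂P := by
  have h : inner ℂ F F = ∫ ω, inner ℂ (F ω) (F ω) ∂P := L2.inner_def F F
  simp_rw [inner_self_eq_norm_sq_to_K] at h
  have h2 : ∫ ω, ((‖F ω‖ : ℂ)) ^ 2 ∂P = ((∫ ω, ‖F ω‖ ^ 2 ∂P : ℝ) : ℂ) := by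
    rw [← integral_complex_ofReal]
    simp
  have h3 : ((‖F‖ ^ 2 : ℝ) : ℂ) = ((∫ ω, ‖F ω‖ ^ 2 ∂P : ℝ) : ℂ) := by
    rw [← h2, Complex.ofReal_pow]
    exact h
  exact_mod_cast h3

/-- The map `F ↦ ⟨e, F⟩` on square-integrable random elements. -/
noncomputable def coeffL (P : Measure Ω) (e : E) : Lp E 2 P →L[ℂ] Lp ℂ 2 P :=
  (innerSL ℂ e).compLpL 2 P

theorem coeFn_coeffL (e : E) (F : Lp E 2 P) : coeffL P e F =ᵐ[P] fun ω => inner ℂ e (F ω) := by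
  filter_upwards [(innerSL ℂ e).coeFn_compLp F] with ω hω
  exact hω

/-- Parseval's identity at each outcome, integrated by dominated convergence. The products of
coefficients are dominated by sums of squares, which add up to the integrable function ‖F‖² + ‖G‖².
-/
theorem HilbertBasis.hasSum_inner_coeffL {ι : Type*} [Countable ι] (b : HilbertBasis ι ℂ E)
    (F G : Lp E 2 P) :
    HasSum (fun i => inner ℂ (coeffL P (b i) F) (coeffL P (b i) G)) (inner ℂ F G) := by
  have h1 : ∀ i, inner ℂ (coeffL P (b i) F) (coeffL P (b i) G) =
      ∫ ω, inner ℂ (F ω) (b i) * inner ℂ (b i) (G ω) ∂P := by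
    intro i
    rw [L2.inner_def]
    refine integral_congr_ae ?_
    filter_upwards [coeFn_coeffL (b i) F, coeFn_coeffL (b i) G] with ω h1 h2
    rw [h1, h2, RCLike.inner_apply, inner_conj_symm, mul_comm]
  simp_rw [h1]
  rw [L2.inner_def]
  have hsq : ∀ x : E, HasSum (fun i => ‖inner ℂ (b i) x‖ ^ 2) (‖x‖ ^ 2) := by
    intro x
    have h := b.hasSum_inner_mul_inner x x
    rw [inner_self_eq_norm_sq_to_K] at h
    have h' := Complex.hasSum_re h
    convert h' using 1
    · ext i
      rw [← inner_conj_symm x (b i), ← Complex.normSq_eq_conj_mul_self, Complex.ofReal_re,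
        Complex.normSq_eq_norm_sq]
    · norm_cast
  have hmem : ∀ F : Lp E 2 P, Integrable (fun ω => ‖F ω‖ ^ 2) P := fun F =>
    (Lp.memLp F).integrable_norm_pow (p := 2) two_ne_zero
  have hb : ∀ ω, HasSum (fun i => ‖inner ℂ (b i) (F ω)‖ ^ 2 + ‖inner ℂ (b i) (G ω)‖ ^ 2)
      (‖F ω‖ ^ 2 + ‖G ω‖ ^ 2) := fun ω => (hsq (F ω)).add (hsq (G ω))
  refine hasSum_integral_of_dominated_convergence
    (fun i ω => ‖inner ℂ (b i) (F ω)‖ ^ 2 + ‖inner ℂ (b i) (G ω)‖ ^ 2) ?_ ?_ ?_ ?_ ?_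
  · intro i
    exact ((Lp.aestronglyMeasurable F).inner aestronglyMeasurable_const).mul
      (aestronglyMeasurable_const.inner (Lp.aestronglyMeasurable G))
  · intro i
    refine Eventually.of_forall fun ω => ?_
    rw [norm_mul, norm_inner_symm (F ω)]
    nlinarith [sq_nonneg (‖inner ℂ (b i) (F ω)‖ - ‖inner ℂ (b i) (G ω)‖),
      sq_nonneg ‖inner ℂ (b i) (F ω)‖, sq_nonneg ‖inner ℂ (b i) (G ω)‖]
  · exact Eventually.of_forall fun ω => (hb ω).summable
  · simp_rw [fun ω => (hb ω).tsum_eq]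
    exact (hmem F).add (hmem G)
  · exact Eventually.of_forall fun ω => b.hasSum_inner_mul_inner _ _

theorem coeFn_sum_smul {ι : Type*} (S : Finset ι) (z : ι → ℂ) {f : ι → Lp E 2 P} {g : ι → Ω → E}
    (h : ∀ i ∈ S, f i =ᵐ[P] g i) :
    (∑ i ∈ S, z i • f i : Lp E 2 P) =ᵐ[P] fun ω => ∑ i ∈ S, z i • g i ω := by
  classical
  induction S using Finset.induction_on with
  | empty =>
    simp only [Finset.sum_empty]
    exact Lp.coeFn_zero E 2 P
  | insert i S hi ih =>
    rw [Finset.sum_insert hi]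
    filter_upwards [Lp.coeFn_add (z i • f i) (∑ i ∈ S, z i • f i), Lp.coeFn_smul (z i) (f i),
      h i (Finset.mem_insert_self i S), ih fun j hj => h j (Finset.mem_insert_of_mem hj)]
      with ω h1 h2 h3 h4
    rw [h1, Pi.add_apply, h2, Pi.smul_apply, h3, h4, Finset.sum_insert hi]

/-- The hypothesis on `w` says that the sum is the orthogonal projection of `w` onto the span of the
`v i`, so this is Pythagoras. Writing ⟨v i, w⟩ as `γ i * z i` avoids dividing by `γ i`, which may
vanish. -/
theorem norm_sub_sum_sq_of_orthogonal {ι : Type*} (s : Finset ι) [DecidableEq ι] {v : ι → E} {w : E}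
    {γ z : ι → ℂ} (hv : ∀ i ∈ s, ∀ j ∈ s, inner ℂ (v i) (v j) = if i = j then γ i else 0)
    (hw : ∀ i ∈ s, inner ℂ (v i) w = γ i * z i) :
    ((‖w - ∑ i ∈ s, z i • v i‖ ^ 2 : ℝ) : ℂ) =
      ((‖w‖ ^ 2 : ℝ) : ℂ) - ∑ i ∈ s, γ i * (z i * conj (z i)) := by
  set S := ∑ i ∈ s, z i • v i with hS
  have hvS : ∀ i ∈ s, inner ℂ (v i) S = γ i * z i := by
    intro i hi
    rw [hS, inner_sum, Finset.sum_eq_single i]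
    · rw [inner_smul_right, hv i hi i hi, if_pos rfl, mul_comm]
    · intro j hj hji
      rw [inner_smul_right, hv i hi j hj, if_neg hji.symm, mul_zero]
    · exact fun h => absurd hi h
  have hSS : inner ℂ S S = ∑ i ∈ s, γ i * (z i * conj (z i)) := by
    conv_lhs => arg 2; rw [hS]
    rw [sum_inner]
    refine Finset.sum_congr rfl fun i hi => ?_
    rw [inner_smul_left, hvS i hi]
    ring
  have horth : inner ℂ S (w - S) = 0 := by
    conv_lhs => arg 2; rw [hS]
    rw [sum_inner]
    refine Finset.sum_eq_zero fun i hi => ?_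
    rw [inner_smul_left, inner_sub_right, hvS i hi, hw i hi, sub_self, mul_zero]
  have hww : inner ℂ w w = inner ℂ (w - S) (w - S) + inner ℂ S S := by
    have horth' : inner ℂ (w - S) S = 0 := by rw [← inner_conj_symm, horth, map_zero]
    conv_lhs => rw [← sub_add_cancel w S]
    rw [inner_add_left, inner_add_right, inner_add_right, horth, horth']
    ring
  rw [inner_self_eq_norm_sq_to_K, inner_self_eq_norm_sq_to_K, hSS] at hww
  push_cast
  exact (sub_eq_of_eq_add hww).symm

end RandomElement

/-! ### Second-order structure of isotropic stationary fields -/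

section FieldCovariance

variable {Ω : Type*} [MeasurableSpace Ω] {P : Measure Ω} [IsProbabilityMeasure P]
  {T : Sph2 → ℤ → Ω → ℝ}

omit [IsProbabilityMeasure P] in
theorem IsIsotropicStationary.integral_mul (hT : IsIsotropicStationary P T) (x y : Sph2)
    (t s : ℤ) : ∫ ω, T x t ω * T y s ω ∂P = autocovKernel P T (t - s) x y := by
  have hd : LinearMap.det ((LinearIsometryEquiv.refl ℝ Space3).toLinearEquiv :
      Space3 →ₗ[ℝ] Space3) = 1 := LinearMap.det_id
  have h := hT.invariant x y (LinearIsometryEquiv.refl ℝ Space3) t s (-s) hd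
  rw [h, add_neg_cancel]
  rfl

omit [IsProbabilityMeasure P] in
theorem IsIsotropicStationary.isZonalKernel (hT : IsIsotropicStationary P T) (t : ℤ) :
    IsZonalKernel (autocovKernel P T t) := by
  intro x y x' y' h
  obtain ⟨g, hd, rfl, rfl⟩ := exists_rotation_map_pair x y x' y' h
  have := hT.invariant x y g t 0 0 hd
  rw [add_zero, add_zero] at this
  exact this

/-- The variance does not depend on the point of the sphere, so it is integrable over a finite
measure, and Tonelli's theorem applies. -/
theorem IsIsotropicStationary.memLp_prod (hT : IsIsotropicStationary P T) (t : ℤ) :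
    MemLp (fun p : Sph2 × Ω => T p.1 t p.2) 2 (sphArea.prod P) := by
  have hm := (hT.measurable t).aestronglyMeasurable (μ := sphArea.prod P)
  rw [memLp_two_iff_integrable_sq hm]
  refine (integrable_prod_iff (hm.pow 2)).2 ?_
  refine ⟨Eventually.of_forall fun x => (hT.memLp x t).integrable_sq, ?_⟩
  have : ∀ x, ∫ ω, ‖T x t ω ^ 2‖ ∂P = autocovKernel P T 0 northPole northPole := fun x => by
    rw [(hT.isZonalKernel 0).diag northPole x, ← sub_self t, ← hT.integral_mul]
    simp [sq]
  change Integrable (fun x => ∫ ω, ‖T x t ω ^ 2‖ ∂P) sphArea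
  simp_rw [this]
  exact integrable_const _

theorem IsIsotropicStationary.ae_memLp (hT : IsIsotropicStationary P T) (t : ℤ) :
    ∀ᵐ ω ∂P, MemLp (fun x => (T x t ω : ℂ)) 2 sphArea := by
  have h := (hT.memLp_prod t).integrable_sq.prod_left_ae
  filter_upwards [h] with ω hω
  have hm : AEStronglyMeasurable (fun x => T x t ω) sphArea :=
    ((hT.measurable t).comp measurable_prodMk_right).aestronglyMeasurable
  exact ((memLp_two_iff_integrable_sq hm).2 hω).ofReal

theorem IsIsotropicStationary.ae_coeFn_fieldElement (hT : IsIsotropicStationary P T) (t : ℤ) :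
    ∀ᵐ ω ∂P, fieldElement T t ω =ᵐ[sphArea] fun x => (T x t ω : ℂ) := by
  filter_upwards [hT.ae_memLp t] with ω hω
  rw [fieldElement, dif_pos hω]
  exact hω.coeFn_toLp

variable {Y : ℕ → ℤ → Sph2 → ℂ}

theorem IsIsotropicStationary.ae_inner_fieldElement (hT : IsIsotropicStationary P T)
    (hY : IsSphericalHarmonicBasis Y) (i : HarmIndex) (t : ℤ) :
    ∀ᵐ ω ∂P, inner ℂ (hY.toL2 i) (fieldElement T t ω) = harmonicCoeff Y T i.1 i.2 t ω := by
  filter_upwards [hT.ae_coeFn_fieldElement t] with ω hω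
  rw [hY.inner_toL2, harmonicCoeff]
  refine integral_congr_ae ?_
  filter_upwards [hω] with x hx
  rw [hx]

theorem IsIsotropicStationary.integrable_prod (hT : IsIsotropicStationary P T) (t : ℤ)
    {f : Sph2 → ℂ} (hf : Continuous f) {X : Ω → ℂ} (hX : MemLp X 2 P) :
    Integrable (fun p : Sph2 × Ω => (T p.1 t p.2 : ℂ) * conj (f p.1) * X p.2)
      (sphArea.prod P) := by
  obtain ⟨M, hM⟩ := isCompact_univ.exists_bound_of_continuousOn hf.continuousOn
  have h1 : MemLp (fun p : Sph2 × Ω => (T p.1 t p.2 : ℂ)) 2 (sphArea.prod P) :=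
    (hT.memLp_prod t).ofReal
  have h2 := h1.integrable_mul (hX.comp_snd sphArea)
  have h3 : AEStronglyMeasurable (fun p : Sph2 × Ω => conj (f p.1)) (sphArea.prod P) :=
    ((Complex.continuous_conj.comp hf).comp_aestronglyMeasurable
      measurable_fst.aestronglyMeasurable)
  refine (h2.mul_bdd (c := M) h3 (Eventually.of_forall fun p => ?_)).congr
    (Eventually.of_forall fun p => ?_)
  · simpa using hM p.1 (Set.mem_univ _)
  · simp only [Pi.mul_apply]
    ring

theorem IsIsotropicStationary.aestronglyMeasurable_harmonicCoeff (hT : IsIsotropicStationary P T)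
    (hY : IsSphericalHarmonicBasis Y) (i : HarmIndex) (t : ℤ) :
    AEStronglyMeasurable (harmonicCoeff Y T i.1 i.2 t) P := by
  have h := (hT.integrable_prod t (hY.continuous i.abs_le)
    (memLp_const (1 : ℂ))).aestronglyMeasurable.prod_swap.integral_prod_right'
  refine h.congr (Eventually.of_forall fun ω => ?_)
  simp [harmonicCoeff]

/-- T_t is almost surely the L² limit of its finite harmonic expansions, whose scalar coefficients
are measurable by Fubini's theorem. -/
theorem IsIsotropicStationary.aestronglyMeasurable_fieldElement (hT : IsIsotropicStationary P T)
    (hY : IsSphericalHarmonicBasis Y) (t : ℤ) : AEStronglyMeasurable (fieldElement T t) P := by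
  refine aestronglyMeasurable_of_tendsto_ae (atTop : Filter (Finset HarmIndex))
    (f := fun s ω => ∑ i ∈ s, harmonicCoeff Y T i.1 i.2 t ω • hY.toL2 i) ?_ ?_
  · intro s
    exact Finset.aestronglyMeasurable_fun_sum _ fun i _ =>
      (hT.aestronglyMeasurable_harmonicCoeff hY i t).smul aestronglyMeasurable_const
  · have h := ae_all_iff.2 fun i => hT.ae_inner_fieldElement hY i t
    filter_upwards [h] with ω hω
    have := hY.hilbertBasis.hasSum_repr (fieldElement T t ω)
    simp_rw [HilbertBasis.repr_apply_apply, hY.hilbertBasis_apply, hω] at this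
    exact this

theorem IsIsotropicStationary.ae_norm_sq_fieldElement (hT : IsIsotropicStationary P T) (t : ℤ) :
    ∀ᵐ ω ∂P, ‖fieldElement T t ω‖ ^ 2 = ∫ x, T x t ω ^ 2 ∂sphArea := by
  filter_upwards [hT.ae_coeFn_fieldElement t] with ω hω
  rw [norm_sq_eq_integral]
  refine integral_congr_ae ?_
  filter_upwards [hω] with x hx
  simp [hx]

theorem IsIsotropicStationary.memLp_fieldElement (hT : IsIsotropicStationary P T)
    (hY : IsSphericalHarmonicBasis Y) (t : ℤ) : MemLp (fieldElement T t) 2 P := by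
  rw [memLp_two_iff_integrable_sq_norm (hT.aestronglyMeasurable_fieldElement hY t)]
  refine (hT.memLp_prod t).integrable_sq.integral_prod_right.congr ?_
  filter_upwards [hT.ae_norm_sq_fieldElement t] with ω hω
  rw [hω]

/-- The random element `T_t` as an element of `L²(Ω; L²)`. -/
noncomputable def IsIsotropicStationary.toL2 (hT : IsIsotropicStationary P T)
    (hY : IsSphericalHarmonicBasis Y) (t : ℤ) : Lp SphL2 2 P :=
  (hT.memLp_fieldElement hY t).toLp (fieldElement T t)

theorem IsIsotropicStationary.coeFn_toL2 (hT : IsIsotropicStationary P T)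
    (hY : IsSphericalHarmonicBasis Y) (t : ℤ) : hT.toL2 hY t =ᵐ[P] fieldElement T t :=
  (hT.memLp_fieldElement hY t).coeFn_toLp

/-- The harmonic coefficient `a_{l,m}(t)` as an element of `L²(Ω)`. -/
noncomputable def IsIsotropicStationary.coeff (hT : IsIsotropicStationary P T)
    (hY : IsSphericalHarmonicBasis Y) (i : HarmIndex) (t : ℤ) : Lp ℂ 2 P :=
  coeffL P (hY.toL2 i) (hT.toL2 hY t)

theorem IsIsotropicStationary.coeFn_coeff (hT : IsIsotropicStationary P T)
    (hY : IsSphericalHarmonicBasis Y) (i : HarmIndex) (t : ℤ) :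
    hT.coeff hY i t =ᵐ[P] harmonicCoeff Y T i.1 i.2 t := by
  filter_upwards [coeFn_coeffL (hY.toL2 i) (hT.toL2 hY t), hT.coeFn_toL2 hY t,
    hT.ae_inner_fieldElement hY i t] with ω h1 h2 h3
  rw [IsIsotropicStationary.coeff, h1, h2, h3]

theorem IsIsotropicStationary.integral_coeff_mul (hT : IsIsotropicStationary P T)
    (hY : IsSphericalHarmonicBasis Y) (i : HarmIndex) (t : ℤ) {X : Ω → ℂ} (hX : MemLp X 2 P) :
    ∫ ω, harmonicCoeff Y T i.1 i.2 t ω * X ω ∂P =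
      ∫ x, (∫ ω, (T x t ω : ℂ) * X ω ∂P) * conj (Y i.1 i.2 x) ∂sphArea := by
  have h := integral_integral_swap
    (f := fun x ω => (T x t ω : ℂ) * conj (Y i.1 i.2 x) * X ω) (hT.integrable_prod t (hY.continuous i.abs_le) hX)
  simp_rw [harmonicCoeff, ← integral_mul_const]
  rw [← h]
  congr 1
  ext x
  congr 1
  ext ω
  ring

omit [IsProbabilityMeasure P] in
/-- The autocovariance operators act as scalars on the spherical harmonics of a given degree. -/
theorem IsIsotropicStationary.exists_eigenvalue (hT : IsIsotropicStationary P T)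
    (hY : IsSphericalHarmonicBasis Y)
    (hcont : ∀ t : ℤ, Continuous fun p : Sph2 × Sph2 => autocovKernel P T t p.1 p.2) :
    ∃ c : ℕ → ℤ → ℂ, ∀ (i : HarmIndex) (t : ℤ) (x : Sph2),
      ∫ y, (autocovKernel P T t x y : ℂ) * Y i.1 i.2 y ∂sphArea = c i.1 t * Y i.1 i.2 x := by
  have h : ∀ (l : ℕ) (t : ℤ), ∃ c : ℂ, ∀ m : ℤ, |m| ≤ l → ∀ x,
      ∫ y, (autocovKernel P T t x y : ℂ) * Y l m y ∂sphArea = c * Y l m x := fun l t =>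
    hY.funkHecke (k := fun x y => (autocovKernel P T t x y : ℂ))
      (Complex.continuous_ofReal.comp (hcont t))
      (fun x y x' y' hxy => congrArg Complex.ofReal (hT.isZonalKernel t x y x' y' hxy)) l
  choose c hc using h
  exact ⟨c, fun i t x => hc i.1 t i.2 i.abs_le x⟩

/-- Exchanging expectation and integral turns the covariance into the integral of r_{t-s}(x,y) Y(y)
over y, where the eigenvalue equation applies. -/
theorem IsIsotropicStationary.integral_field_mul_conj_coeff (hT : IsIsotropicStationary P T)
    (hY : IsSphericalHarmonicBasis Y) {c : ℕ → ℤ → ℂ}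
    (hc : ∀ (i : HarmIndex) (t : ℤ) (x : Sph2),
      ∫ y, (autocovKernel P T t x y : ℂ) * Y i.1 i.2 y ∂sphArea = c i.1 t * Y i.1 i.2 x)
    (i : HarmIndex) (t s : ℤ) (x : Sph2) :
    ∫ ω, (T x t ω : ℂ) * conj (harmonicCoeff Y T i.1 i.2 s ω) ∂P =
      c i.1 (t - s) * Y i.1 i.2 x := by
  have h := congrArg conj (hT.integral_coeff_mul hY i s (X := fun ω => (T x t ω : ℂ))
    (hT.memLp x t).ofReal)
  rw [← integral_conj, ← integral_conj] at h
  rw [← hc]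
  convert h using 1
  · congr 1
    ext ω
    simp [mul_comm]
  · congr 1
    ext y
    have : ∫ ω, (T y s ω : ℂ) * (T x t ω : ℂ) ∂P = (autocovKernel P T (t - s) x y : ℂ) := by
      rw [← hT.integral_mul, ← integral_complex_ofReal]
      simp [mul_comm]
    rw [this]
    simp

theorem IsIsotropicStationary.inner_coeff_aux (hT : IsIsotropicStationary P T)
    (hY : IsSphericalHarmonicBasis Y) {c : ℕ → ℤ → ℂ}
    (hc : ∀ (i : HarmIndex) (t : ℤ) (x : Sph2),
      ∫ y, (autocovKernel P T t x y : ℂ) * Y i.1 i.2 y ∂sphArea = c i.1 t * Y i.1 i.2 x)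
    (i j : HarmIndex) (t s : ℤ) :
    ∫ ω, harmonicCoeff Y T i.1 i.2 t ω * conj (harmonicCoeff Y T j.1 j.2 s ω) ∂P =
      if i = j then c j.1 (t - s) else 0 := by
  have hX : MemLp (fun ω => conj (harmonicCoeff Y T j.1 j.2 s ω)) 2 P :=
    ((memLp_congr_ae (hT.coeFn_coeff hY j s)).1 (Lp.memLp _)).star
  rw [hT.integral_coeff_mul hY i t hX]
  simp_rw [hT.integral_field_mul_conj_coeff hY hc, mul_assoc]
  rw [integral_const_mul, hY.orthonormal _ _ _ _ j.abs_le i.abs_le]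
  rcases eq_or_ne i j with rfl | hij
  · simp
  · rw [if_neg hij, if_neg, mul_zero]
    exact fun h => hij (HarmIndex.ext_iff'.2 ⟨h.1.symm, h.2.symm⟩)

variable (hT : IsIsotropicStationary P T) (hY : IsSphericalHarmonicBasis Y)
  (hcont : ∀ t : ℤ, Continuous fun p : Sph2 × Sph2 => autocovKernel P T t p.1 p.2)

include hT hY hcont

/-- The eigenvalue furnished by Funk–Hecke is read off from the covariance of the coefficient with m
= 0, which is the definition of C_l(t). -/
theorem IsIsotropicStationary.angularCov_eigenvalue (i : HarmIndex) (t : ℤ) (x : Sph2) :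
    ∫ y, (autocovKernel P T t x y : ℂ) * Y i.1 i.2 y ∂sphArea =
      angularCov P Y T i.1 t * Y i.1 i.2 x := by
  obtain ⟨c, hc⟩ := hT.exists_eigenvalue hY hcont
  have h := hT.inner_coeff_aux hY hc ⟨i.1, 0, by simp⟩ ⟨i.1, 0, by simp⟩ t 0
  rw [if_pos rfl, sub_zero] at h
  rw [angularCov, h, hc]

theorem IsIsotropicStationary.inner_coeff (i j : HarmIndex) (t s : ℤ) :
    inner ℂ (hT.coeff hY j s) (hT.coeff hY i t) =
      if i = j then angularCov P Y T i.1 (t - s) else 0 := by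
  have h := hT.inner_coeff_aux hY (hT.angularCov_eigenvalue hY hcont) i j t s
  rw [L2.inner_def]
  have h' : ∫ ω, inner ℂ (hT.coeff hY j s ω) (hT.coeff hY i t ω) ∂P =
      ∫ ω, harmonicCoeff Y T i.1 i.2 t ω * conj (harmonicCoeff Y T j.1 j.2 s ω) ∂P := by
    refine integral_congr_ae ?_
    filter_upwards [hT.coeFn_coeff hY i t, hT.coeFn_coeff hY j s] with ω h1 h2
    rw [h1, h2, RCLike.inner_apply]
  rw [h', h]
  split_ifs with hij
  · rw [hij]
  · rfl

/-- The trace-norm hypothesis enters here, and in this form only is it used afterwards. Summing over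
`HarmIndex` counts degree l with multiplicity 2l + 1. -/
theorem IsIsotropicStationary.summable_angularCov
    (hsum : ∑' t : ℤ, traceNorm (kernelOperator (autocovKernel P T t) (hcont t)) < ∞) :
    Summable fun p : HarmIndex × ℤ => ‖angularCov P Y T p.1.1 p.2‖ := by
  have h1 : ∑' p : ℤ × HarmIndex, ENNReal.ofReal ‖angularCov P Y T p.2.1 p.1‖ < ∞ := by
    rw [ENNReal.tsum_prod']
    refine (ENNReal.tsum_le_tsum fun t => ?_).trans_lt hsum
    exact hY.tsum_norm_le_traceNorm (hcont t) (c := fun i => angularCov P Y T i.1 t)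
      fun i x => hT.angularCov_eigenvalue hY hcont i t x
  have h2 := ENNReal.summable_toReal h1.ne
  rw [← (Equiv.prodComm ℤ HarmIndex).summable_iff]
  refine h2.congr fun p => ?_
  simp

/-- Mercer's expansion on the diagonal. Parseval for E‖T_0‖² gives area · r_0(x,x) = ∑ (2l+1)
C_l(0), the variance being constant, and 2l + 1 = area · K_l(x,x). -/
theorem IsIsotropicStationary.hasSum_angularCov_zero (x : Sph2) :
    HasSum (fun l : ℕ => angularCov P Y T l 0 * harmKernel Y l x x)
      (autocovKernel P T 0 x x : ℂ) := by
  have h1 := hY.hilbertBasis.hasSum_inner_coeffL (hT.toL2 hY 0) (hT.toL2 hY 0)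
  have h2 : ∀ i, inner ℂ (coeffL P (hY.hilbertBasis i) (hT.toL2 hY 0))
      (coeffL P (hY.hilbertBasis i) (hT.toL2 hY 0)) = angularCov P Y T i.1 0 := by
    intro i
    have := hT.inner_coeff hY hcont i i 0 0
    rw [if_pos rfl, sub_zero] at this
    rw [hY.hilbertBasis_apply]
    exact this
  simp_rw [h2] at h1
  have h3 : inner ℂ (hT.toL2 hY 0) (hT.toL2 hY 0) =
      (sphArea.real Set.univ : ℂ) * (autocovKernel P T 0 x x : ℂ) := by
    rw [inner_self_eq_norm_sq_to_K, ← Complex.ofReal_mul]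
    have : ‖hT.toL2 hY 0‖ ^ 2 = sphArea.real Set.univ * autocovKernel P T 0 x x := by
      rw [norm_sq_eq_integral]
      have hae : ∀ᵐ ω ∂P, ‖hT.toL2 hY 0 ω‖ ^ 2 = ∫ y, T y 0 ω ^ 2 ∂sphArea := by
        filter_upwards [hT.coeFn_toL2 hY 0, hT.ae_norm_sq_fieldElement 0] with ω ha hb
        rw [ha, hb]
      rw [integral_congr_ae hae]
      have hsw := integral_integral_swap (f := fun y ω => T y 0 ω ^ 2)
        (hT.memLp_prod 0).integrable_sq
      rw [← hsw]
      have : ∀ y, ∫ ω, T y 0 ω ^ 2 ∂P = autocovKernel P T 0 x x := fun y => by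
        rw [(hT.isZonalKernel 0).diag x y, autocovKernel]
        simp [sq]
      simp_rw [this]
      rw [integral_const, smul_eq_mul]
    rw [← this]
    norm_cast
  rw [h3] at h1
  have h4 := HarmIndex.hasSum_fst (g := fun l => angularCov P Y T l 0) h1
  simp only [nsmul_eq_mul, Nat.cast_add, Nat.cast_mul, Nat.cast_ofNat, Nat.cast_one] at h4
  have hA : (sphArea.real Set.univ : ℂ) ≠ 0 := by
    exact_mod_cast sphArea_real_pos.ne'
  have h5 := h4.mul_left (sphArea.real Set.univ : ℂ)⁻¹
  rw [inv_mul_cancel_left₀ hA] at h5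
  refine h5.congr_fun fun l => ?_
  rw [← hY.harmKernel_diag l x]
  field_simp

theorem IsIsotropicStationary.tendsto_expansion (t : ℤ) (x : Sph2) :
    Tendsto (fun L : ℕ => ∫⁻ ω, ‖(T x t ω : ℂ) - ∑ l ∈ Finset.range (L + 1),
      ∑ m ∈ Finset.Icc (-(l : ℤ)) l, harmonicCoeff Y T l m t ω * Y l m x‖ₑ ^ 2 ∂P)
      atTop (𝓝 0) := by
  classical
  set w : Lp ℂ 2 P := ((hT.memLp x t).ofReal (K := ℂ)).toLp (fun ω => (T x t ω : ℂ)) with hw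
  have hwc : w =ᵐ[P] fun ω => (T x t ω : ℂ) := MemLp.coeFn_toLp _
  set s : ℕ → Finset HarmIndex := fun L => (Finset.range (L + 1)).sigma fun l => Finset.univ with hs
  have hsum : ∀ (L : ℕ) (F : ℕ → ℤ → ℂ), ∑ i ∈ s L, F i.1 i.2 =
      ∑ l ∈ Finset.range (L + 1), ∑ m ∈ Finset.Icc (-(l : ℤ)) l, F l m := by
    intro L F
    rw [hs, Finset.sum_sigma]
    exact Finset.sum_congr rfl fun l _ => Finset.sum_coe_sort (Finset.Icc (-(l : ℤ)) l) (F l)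
  -- Hence Y_{l,m}(x) is exactly the projection coefficient of T(x,t) along a_{l,m}(t), whose
  -- variance is C_l(0).
  have hinner : ∀ i, inner ℂ (hT.coeff hY i t) w = angularCov P Y T i.1 0 * Y i.1 i.2 x := by
    intro i
    rw [← sub_self t, ← hT.integral_field_mul_conj_coeff hY (hT.angularCov_eigenvalue hY hcont),
      L2.inner_def]
    refine integral_congr_ae ?_
    filter_upwards [hT.coeFn_coeff hY i t, hwc] with ω h1 h2
    rw [h1, h2, RCLike.inner_apply]
  have hnorm : ∀ L, ((‖w - ∑ i ∈ s L, Y i.1 i.2 x • hT.coeff hY i t‖ ^ 2 : ℝ) : ℂ) =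
      (autocovKernel P T 0 x x : ℂ) -
        ∑ l ∈ Finset.range (L + 1), angularCov P Y T l 0 * harmKernel Y l x x := by
    intro L
    rw [norm_sub_sum_sq_of_orthogonal (s L) (γ := fun i => angularCov P Y T i.1 0)
      (fun i _ j _ => by
        rw [hT.inner_coeff hY hcont, sub_self]
        by_cases hij : i = j
        · rw [if_pos hij, if_pos hij.symm, hij]
        · rw [if_neg hij, if_neg (Ne.symm hij)]) (fun i _ => hinner i)]
    congr 1
    · congr 1
      rw [norm_sq_eq_integral, ← sub_self t, ← hT.integral_mul]
      refine integral_congr_ae ?_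
      filter_upwards [hwc] with ω hω
      simp [hω, sq]
    · rw [hsum L fun l m => angularCov P Y T l 0 * (Y l m x * conj (Y l m x))]
      simp_rw [harmKernel, Finset.mul_sum]
  have hlim : Tendsto (fun L => ‖w - ∑ i ∈ s L, Y i.1 i.2 x • hT.coeff hY i t‖ ^ 2) atTop
      (𝓝 0) := by
    have h1 := ((hT.hasSum_angularCov_zero hY hcont x).tendsto_sum_nat.comp
      (tendsto_add_atTop_nat 1)).const_sub (autocovKernel P T 0 x x : ℂ)
    rw [sub_self] at h1
    have h2 := (Complex.continuous_re.tendsto _).comp h1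
    refine Tendsto.congr (fun L => ?_) h2
    have := congrArg Complex.re (hnorm L)
    rw [Complex.ofReal_re] at this
    rw [this]
    rfl
  have hlim' := ENNReal.tendsto_ofReal hlim
  rw [ENNReal.ofReal_zero] at hlim'
  refine Tendsto.congr (fun L => ?_) hlim'
  rw [ENNReal.ofReal_pow (norm_nonneg _), ofReal_norm, ← lintegral_enorm_sq_coeFn]
  refine lintegral_enorm_sq_congr ?_
  have hsm := coeFn_sum_smul (s L) (fun i => Y i.1 i.2 x) fun i _ => hT.coeFn_coeff hY i t
  filter_upwards [Lp.coeFn_sub w (∑ i ∈ s L, Y i.1 i.2 x • hT.coeff hY i t), hwc, hsm]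
    with ω h1 h2 h3
  rw [h1, Pi.sub_apply, h2, h3, hsum L fun l m => Y l m x • harmonicCoeff Y T l m t ω]
  simp_rw [smul_eq_mul, mul_comm]

end FieldCovariance

/-! ### Fourier analysis on `(-π, π]` -/

/-- Lebesgue measure on `(-π, π]`. -/
noncomputable abbrev freqMeasure : Measure ℝ := volume.restrict (Set.Ioc (-Real.pi) Real.pi)

/-- The Hilbert space of square-integrable functions on `(-π, π]`. -/
abbrev FreqL2 : Type := Lp ℂ 2 freqMeasure

theorem continuous_charFn (t : ℤ) : Continuous (charFn t) := by
  unfold charFn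
  fun_prop

theorem norm_charFn (t : ℤ) (ν : ℝ) : ‖charFn t ν‖ = 1 := by
  have : Complex.I * t * ν = ((t * ν : ℝ) : ℂ) * Complex.I := by push_cast; ring
  rw [charFn, this, Complex.norm_exp_ofReal_mul_I]

theorem conj_charFn (t : ℤ) (ν : ℝ) : conj (charFn t ν) = charFn (-t) ν := by
  rw [charFn, charFn, ← Complex.exp_conj]
  simp

theorem charFn_mul (s t : ℤ) (ν : ℝ) : charFn s ν * charFn t ν = charFn (s + t) ν := by
  rw [charFn, charFn, charFn, ← Complex.exp_add]
  congr 1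
  push_cast
  ring

theorem integral_charFn (n : ℤ) :
    ∫ ν, charFn n ν ∂freqMeasure = if n = 0 then (2 * Real.pi : ℂ) else 0 := by
  rw [← intervalIntegral.integral_of_le (by linarith [Real.pi_pos])]
  split_ifs with h
  · subst h
    simp [charFn]
    ring
  · have hc : Complex.I * n ≠ 0 := mul_ne_zero Complex.I_ne_zero (by exact_mod_cast h)
    simp only [charFn]
    rw [integral_exp_mul_complex hc, div_eq_zero_iff]
    refine Or.inl (sub_eq_zero.2 (Complex.exp_eq_exp_iff_exists_int.2 ⟨n, ?_⟩))
    push_cast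
    ring

theorem memLp_charFn (t : ℤ) : MemLp (charFn t) 2 freqMeasure :=
  MemLp.of_bound (continuous_charFn t).aestronglyMeasurable 1
    (Eventually.of_forall fun ν => (norm_charFn t ν).le)

/-- The character `ν ↦ e^{itν}` as an element of `L²(-π, π)`. -/
noncomputable def charL2 (t : ℤ) : FreqL2 := (memLp_charFn t).toLp (charFn t)

theorem coeFn_charL2 (t : ℤ) : charL2 t =ᵐ[freqMeasure] charFn t := (memLp_charFn t).coeFn_toLp

theorem inner_charL2 (t : ℤ) (f : FreqL2) :
    inner ℂ (charL2 t) f = ∫ ν, f ν * conj (charFn t ν) ∂freqMeasure := by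
  rw [L2.inner_def]
  refine integral_congr_ae ?_
  filter_upwards [coeFn_charL2 t] with ν hν
  rw [hν, RCLike.inner_apply]

/-- The inner products are, up to normalisation, the Fourier coefficients of `f` on [-π, π], and
Parseval's identity gives a zero norm. -/
theorem eq_zero_of_inner_charL2_eq_zero (f : FreqL2) (h : ∀ t, inner ℂ (charL2 t) f = 0) :
    f = 0 := by
  have hab : -Real.pi < Real.pi := by linarith [Real.pi_pos]
  have hcoef : ∀ n, fourierCoeffOn hab f n = 0 := by
    intro n
    rw [fourierCoeffOn_eq_integral, intervalIntegral.integral_of_le hab.le]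
    have : ∫ ν, f ν * conj (charFn n ν) ∂freqMeasure = 0 := by rw [← inner_charL2, h]
    refine smul_eq_zero_of_right _ ?_
    rw [← this]
    refine integral_congr_ae (Eventually.of_forall fun ν => ?_)
    beta_reduce
    rw [conj_charFn, smul_eq_mul, fourier_coe_apply, charFn, mul_comm]
    congr 2
    have : (Real.pi : ℂ) ≠ 0 := by exact_mod_cast Real.pi_ne_zero
    push_cast
    field_simp
    ring
  have h1 := hasSum_sq_fourierCoeffOn hab (f := f) (Lp.memLp f)
  simp_rw [hcoef] at h1
  simp only [norm_zero, ne_eq, OfNat.ofNat_ne_zero, not_false_eq_true, zero_pow] at h1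
  have h2 := h1.unique hasSum_zero
  rw [intervalIntegral.integral_of_le hab.le, ← norm_sq_eq_integral] at h2
  have h3 : (Real.pi - -Real.pi)⁻¹ ≠ 0 := inv_ne_zero (sub_pos.2 hab).ne'
  have h4 := (smul_eq_zero.1 h2).resolve_left h3
  simpa using h4

/-- The trigonometric polynomial with given coefficients. -/
noncomputable def trigPoly : (ℤ →₀ ℂ) →ₗ[ℂ] FreqL2 := Finsupp.linearCombination ℂ charL2

theorem denseRange_trigPoly : DenseRange trigPoly := by
  have h : (Submodule.span ℂ (Set.range charL2)).topologicalClosure = ⊤ := by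
    rw [Submodule.topologicalClosure_eq_top_iff, Submodule.eq_bot_iff]
    intro f hf
    refine eq_zero_of_inner_charL2_eq_zero f fun t => ?_
    exact (Submodule.mem_orthogonal _ _).1 hf _ (Submodule.subset_span ⟨t, rfl⟩)
  rw [← Finsupp.range_linearCombination, ← Submodule.dense_iff_topologicalClosure_eq_top] at h
  exact h

theorem ext_charL2 {f g : FreqL2} (h : ∀ t, inner ℂ (charL2 t) f = inner ℂ (charL2 t) g) :
    f = g := by
  refine sub_eq_zero.1 (eq_zero_of_inner_charL2_eq_zero _ fun t => ?_)
  rw [inner_sub_right, h, sub_self]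

theorem memLp_mul_coeFn {ψ : ℝ → ℂ} (hψ : Continuous ψ) {M : ℝ} (hM : ∀ ν, ‖ψ ν‖ ≤ M)
    (f : FreqL2) : MemLp (fun ν => ψ ν * f ν) 2 freqMeasure :=
  (Lp.memLp f).of_le_mul (c := M)
    (hψ.aestronglyMeasurable.mul (Lp.aestronglyMeasurable f))
    (Eventually.of_forall fun ν => by
      rw [norm_mul]
      exact mul_le_mul_of_nonneg_right (hM ν) (norm_nonneg _))

/-- Multiplication by a bounded function on `L²(-π, π)`. -/
noncomputable def freqMul (ψ : ℝ → ℂ) (hψ : Continuous ψ) (M : ℝ) (hM : ∀ ν, ‖ψ ν‖ ≤ M) :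
    FreqL2 →L[ℂ] FreqL2 :=
  LinearMap.mkContinuous
    { toFun := fun f => (memLp_mul_coeFn hψ hM f).toLp (fun ν => ψ ν * f ν)
      map_add' := fun f g => by
        rw [← MemLp.toLp_add]
        refine MemLp.toLp_congr _ _ ?_
        filter_upwards [Lp.coeFn_add f g] with ν hν
        rw [hν, Pi.add_apply, Pi.add_apply, mul_add]
      map_smul' := fun c f => by
        rw [RingHom.id_apply, ← MemLp.toLp_const_smul]
        refine MemLp.toLp_congr _ _ ?_
        filter_upwards [Lp.coeFn_smul c f] with ν hν
        rw [hν, Pi.smul_apply, Pi.smul_apply, smul_eq_mul, smul_eq_mul, mul_left_comm] }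
    M fun f => by
      refine Lp.norm_le_mul_norm_of_ae_le_mul ?_
      refine (memLp_mul_coeFn hψ hM f).coeFn_toLp.mono fun ν hν => ?_
      rw [LinearMap.coe_mk, AddHom.coe_mk, hν, norm_mul]
      exact mul_le_mul_of_nonneg_right (hM ν) (norm_nonneg _)

section FreqMul

variable {ψ : ℝ → ℂ} {hψ : Continuous ψ} {M : ℝ} {hM : ∀ ν, ‖ψ ν‖ ≤ M}

theorem coeFn_freqMul (f : FreqL2) : freqMul ψ hψ M hM f =ᵐ[freqMeasure] fun ν => ψ ν * f ν :=
  (memLp_mul_coeFn hψ hM f).coeFn_toLp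

theorem norm_freqMul_le (f : FreqL2) : ‖freqMul ψ hψ M hM f‖ ≤ M * ‖f‖ := by
  refine Lp.norm_le_mul_norm_of_ae_le_mul ?_
  filter_upwards [coeFn_freqMul (hψ := hψ) (hM := hM) f] with ν hν
  rw [hν, norm_mul]
  exact mul_le_mul_of_nonneg_right (hM ν) (norm_nonneg _)

theorem inner_freqMul (f g : FreqL2) : inner ℂ f (freqMul ψ hψ M hM g) =
    ∫ ν, ψ ν * (g ν * conj (f ν)) ∂freqMeasure := by
  rw [L2.inner_def]
  refine integral_congr_ae ?_
  filter_upwards [coeFn_freqMul (hψ := hψ) (hM := hM) g] with ν hν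
  rw [hν, RCLike.inner_apply, mul_assoc]

theorem inner_charL2_freqMul (s t : ℤ) : inner ℂ (charL2 s) (freqMul ψ hψ M hM (charL2 t)) =
    ∫ ν, ψ ν * charFn (t - s) ν ∂freqMeasure := by
  rw [inner_freqMul]
  refine integral_congr_ae ?_
  filter_upwards [coeFn_charL2 s, coeFn_charL2 t] with ν h1 h2
  rw [h1, h2, conj_charFn, charFn_mul, sub_eq_add_neg]

/-- A stationary pair of operators on `L²(-π, π)` has its mixed covariance given by the spectral
density. -/
theorem inner_apply_eq_inner_freqMul {G : Type*} [NormedAddCommGroup G] [InnerProductSpace ℂ G]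
    [CompleteSpace G] (A B : FreqL2 →L[ℂ] G)
    (h : ∀ s t, inner ℂ (A (charL2 s)) (B (charL2 t)) =
      ∫ ν, ψ ν * charFn (t - s) ν ∂freqMeasure) (f g : FreqL2) :
    inner ℂ (A f) (B g) = inner ℂ f (freqMul ψ hψ M hM g) := by
  -- Both bounded operators have the same matrix coefficients between characters, and the characters
  -- span a dense subspace.
  have hAB : (ContinuousLinearMap.adjoint A).comp B = freqMul ψ hψ M hM := by
    refine ContinuousLinearMap.ext_on (s := Set.range charL2) ?_ ?_
    · have := denseRange_trigPoly
      rw [trigPoly, DenseRange, ← LinearMap.coe_range, Finsupp.range_linearCombination] at this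
      exact this
    · rintro _ ⟨t, rfl⟩
      refine ext_charL2 fun s => ?_
      rw [inner_charL2_freqMul, ContinuousLinearMap.comp_apply,
        ContinuousLinearMap.adjoint_inner_right, h]
  rw [← hAB, ContinuousLinearMap.comp_apply, ContinuousLinearMap.adjoint_inner_right]

end FreqMul

/-! ### Spectral densities -/

section Density

variable {Ω : Type*} [MeasurableSpace Ω] {P : Measure Ω}
  {T : Sph2 → ℤ → Ω → ℝ} {Y : ℕ → ℤ → Sph2 → ℂ} {l : ℕ}

/-- A bound for the spectral density. -/
noncomputable def specBound (P : Measure Ω) (Y : ℕ → ℤ → Sph2 → ℂ) (T : Sph2 → ℤ → Ω → ℝ)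
    (l : ℕ) : ℝ := (2 * Real.pi)⁻¹ * ∑' t : ℤ, ‖angularCov P Y T l t‖

theorem spectralDensity_eq (ν : ℝ) : spectralDensity P Y T l ν =
    (2 * Real.pi : ℂ)⁻¹ * ∑' t : ℤ, charFn (-t) ν * angularCov P Y T l t := by
  simp [spectralDensity, charFn]

theorem continuous_spectralDensity (h : Summable fun t => ‖angularCov P Y T l t‖) :
    Continuous (spectralDensity P Y T l) := by
  rw [show spectralDensity P Y T l = _ from funext spectralDensity_eq]
  refine continuous_const.mul (continuous_tsum
    (fun t => (continuous_charFn (-t)).mul continuous_const) h fun t ν => ?_)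
  rw [norm_mul, norm_charFn, one_mul]

theorem norm_spectralDensity_le (h : Summable fun t => ‖angularCov P Y T l t‖) (ν : ℝ) :
    ‖spectralDensity P Y T l ν‖ ≤ specBound P Y T l := by
  have hs : Summable fun t : ℤ => ‖charFn (-t) ν * angularCov P Y T l t‖ := by
    simpa [norm_mul, norm_charFn] using h
  rw [spectralDensity_eq, norm_mul, specBound]
  have h1 : ‖(2 * Real.pi : ℂ)⁻¹‖ = (2 * Real.pi)⁻¹ := by
    rw [norm_inv, ← Complex.ofReal_ofNat, ← Complex.ofReal_mul, Complex.norm_real,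
      Real.norm_of_nonneg (by positivity)]
  rw [h1]
  refine mul_le_mul_of_nonneg_left ((norm_tsum_le_tsum_norm hs).trans_eq ?_) (by positivity)
  simp [norm_charFn]

/-- Absolute summability allows term-by-term integration, and orthogonality of the characters leaves
only the term t = n. -/
theorem integral_spectralDensity_mul_charFn (h : Summable fun t => ‖angularCov P Y T l t‖)
    (n : ℤ) : ∫ ν, spectralDensity P Y T l ν * charFn n ν ∂freqMeasure = angularCov P Y T l n := by
  have hint : ∀ t : ℤ, Integrable (fun ν => charFn (n - t) ν * angularCov P Y T l t)
      freqMeasure := fun t =>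
    ((memLp_charFn (n - t)).integrable (by norm_num)).mul_const _
  have hs := hasSum_integral_of_summable_integral_norm hint (by
    simp only [norm_mul, norm_charFn, one_mul, integral_const, smul_eq_mul]
    exact h.mul_left _)
  have hp : (2 * Real.pi : ℂ) ≠ 0 := by
    exact_mod_cast (mul_pos two_pos Real.pi_pos).ne'
  have h1 : ∀ ν, spectralDensity P Y T l ν * charFn n ν =
      (2 * Real.pi : ℂ)⁻¹ * ∑' t : ℤ, charFn (n - t) ν * angularCov P Y T l t := by
    intro ν
    rw [spectralDensity_eq, mul_assoc, ← tsum_mul_right]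
    congr 2
    ext t
    rw [mul_right_comm, charFn_mul, neg_add_eq_sub]
  simp_rw [h1]
  rw [integral_const_mul, ← hs.tsum_eq]
  simp_rw [integral_mul_const, integral_charFn]
  rw [tsum_eq_single n fun t ht => by rw [if_neg (sub_ne_zero.2 ht.symm), zero_mul],
    if_pos (sub_self n), inv_mul_cancel_left₀ hp]

end Density

/-! ### Indicators of intervals -/

/-- The indicator function of `(a, b]` as an element of `L²(-π, π)`. -/
noncomputable def freqInd (a b : ℝ) : FreqL2 :=
  indicatorConstLp 2 (measurableSet_Ioc (a := a) (b := b)) (measure_ne_top freqMeasure _) 1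

theorem coeFn_freqInd (a b : ℝ) :
    freqInd a b =ᵐ[freqMeasure] (Set.Ioc a b).indicator fun _ => (1 : ℂ) :=
  indicatorConstLp_coeFn

theorem freqInd_sub {a b c : ℝ} (hab : a ≤ b) (hbc : b ≤ c) :
    freqInd a c - freqInd a b = freqInd b c := by
  refine Lp.ext ?_
  filter_upwards [Lp.coeFn_sub (freqInd a c) (freqInd a b), coeFn_freqInd a c, coeFn_freqInd a b,
    coeFn_freqInd b c] with ν h1 h2 h3 h4
  rw [h1, Pi.sub_apply, h2, h3, h4, ← Set.Ioc_union_Ioc_eq_Ioc hab hbc,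
    Set.indicator_union_of_disjoint (Set.Ioc_disjoint_Ioc_of_le le_rfl)]
  ring

theorem freqInd_self (a : ℝ) : freqInd a a = 0 := by
  rw [← freqInd_sub (le_refl a) (le_refl a), sub_self]

theorem inner_freqInd_freqMul {ψ : ℝ → ℂ} {hψ : Continuous ψ} {M : ℝ} {hM : ∀ ν, ‖ψ ν‖ ≤ M}
    (a b c d : ℝ) : inner ℂ (freqInd a b) (freqMul ψ hψ M hM (freqInd c d)) =
      ∫ ν in Set.Ioc a b ∩ Set.Ioc c d, ψ ν ∂freqMeasure := by
  rw [inner_freqMul, ← integral_indicator (measurableSet_Ioc.inter measurableSet_Ioc)]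
  refine integral_congr_ae ?_
  filter_upwards [coeFn_freqInd a b, coeFn_freqInd c d] with ν h1 h2
  rw [h1, h2]
  by_cases hab : ν ∈ Set.Ioc a b <;> by_cases hcd : ν ∈ Set.Ioc c d <;>
    simp [Set.indicator, hab, hcd, -Set.mem_Ioc]

theorem norm_sq_freqInd {a b : ℝ} (ha : -Real.pi ≤ a) (hab : a ≤ b) (hb : b ≤ Real.pi) :
    ‖freqInd a b‖ ^ 2 = b - a := by
  have hsub : Set.Ioc a b ⊆ Set.Ioc (-Real.pi) Real.pi := Set.Ioc_subset_Ioc ha hb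
  rw [norm_sq_eq_integral]
  have : ∀ᵐ ν ∂freqMeasure, ‖freqInd a b ν‖ ^ 2 = (Set.Ioc a b).indicator (fun _ => (1 : ℝ)) ν := by
    filter_upwards [coeFn_freqInd a b] with ν hν
    rw [hν]
    by_cases h : ν ∈ Set.Ioc a b <;> simp [Set.indicator, h, -Set.mem_Ioc]
  rw [integral_congr_ae this, integral_indicator measurableSet_Ioc,
    Measure.restrict_restrict measurableSet_Ioc, Set.inter_eq_left.2 hsub]
  simp [hab]

theorem inner_freqInd_eq_zero {a b c d : ℝ} (h : b ≤ c) :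
    inner ℂ (freqInd a b) (freqInd c d) = 0 := by
  rw [L2.inner_def]
  refine integral_eq_zero_of_ae ?_
  filter_upwards [coeFn_freqInd a b, coeFn_freqInd c d] with ν h1 h2
  rw [h1, h2]
  by_cases hab : ν ∈ Set.Ioc a b
  · have : ν ∉ Set.Ioc c d := fun hcd => not_lt.2 (hab.2.trans h) hcd.1
    simp [Set.indicator, this, -Set.mem_Ioc]
  · simp [Set.indicator, hab, -Set.mem_Ioc]

/-! ### The spectral operator of the field -/

section SpectralOp

variable {Ω : Type*} [MeasurableSpace Ω] {P : Measure Ω}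
  {T : Sph2 → ℤ → Ω → ℝ} {Y : ℕ → ℤ → Sph2 → ℂ}

theorem summable_specBound
    (hS : Summable fun p : HarmIndex × ℤ => ‖angularCov P Y T p.1.1 p.2‖) :
    Summable fun i : HarmIndex => specBound P Y T i.1 :=
  hS.prod.mul_left _

theorem summable_angularCov_fiber
    (hS : Summable fun p : HarmIndex × ℤ => ‖angularCov P Y T p.1.1 p.2‖) (l : ℕ) :
    Summable fun t : ℤ => ‖angularCov P Y T l t‖ :=
  hS.prod_factor (⟨l, 0, by simp⟩ : HarmIndex)

/-- Multiplication by the spectral density. -/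
noncomputable def specMul
    (hS : Summable fun p : HarmIndex × ℤ => ‖angularCov P Y T p.1.1 p.2‖) (l : ℕ) :
    FreqL2 →L[ℂ] FreqL2 :=
  freqMul (spectralDensity P Y T l) (continuous_spectralDensity (summable_angularCov_fiber hS l))
    (specBound P Y T l) (norm_spectralDensity_le (summable_angularCov_fiber hS l))

variable [IsProbabilityMeasure P] (hT : IsIsotropicStationary P T)
  (hY : IsSphericalHarmonicBasis Y)

/-- The linear combinations of the random elements `T_t`. -/
noncomputable def IsIsotropicStationary.fieldComb : (ℤ →₀ ℂ) →ₗ[ℂ] Lp SphL2 2 P :=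
  Finsupp.linearCombination ℂ (hT.toL2 hY)

variable (hcont : ∀ t : ℤ, Continuous fun p : Sph2 × Sph2 => autocovKernel P T t p.1 p.2)
  (hS : Summable fun p : HarmIndex × ℤ => ‖angularCov P Y T p.1.1 p.2‖)

include hcont in
theorem IsIsotropicStationary.inner_coeffL_toL2 (i : HarmIndex) (s t : ℤ) :
    inner ℂ (coeffL P (hY.toL2 i) (hT.toL2 hY s)) (coeffL P (hY.toL2 i) (hT.toL2 hY t)) =
      inner ℂ (charL2 s) (specMul hS i.1 (charL2 t)) := by
  have h := hT.inner_coeff hY hcont i i t s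
  rw [if_pos rfl] at h
  rw [specMul, inner_charL2_freqMul,
    integral_spectralDensity_mul_charFn (summable_angularCov_fiber hS i.1), ← h]
  rfl

include hcont in
theorem IsIsotropicStationary.inner_coeffL_fieldComb (i : HarmIndex) (c d : ℤ →₀ ℂ) :
    inner ℂ (coeffL P (hY.toL2 i) (hT.fieldComb hY c)) (coeffL P (hY.toL2 i) (hT.fieldComb hY d)) =
      inner ℂ (trigPoly c) (specMul hS i.1 (trigPoly d)) := by
  simp only [IsIsotropicStationary.fieldComb, trigPoly, Finsupp.linearCombination_apply,
    Finsupp.sum, map_sum, map_smul, sum_inner, inner_sum, inner_smul_left, inner_smul_right,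
    hT.inner_coeffL_toL2 hY hcont hS]

include hcont hS in
-- Parseval over the harmonics writes the squared norm as a sum of ⟨p, f_l p⟩, each at most the
-- bound of f_l times ‖p‖². Boundedness makes the map e^{itν} ↦ T_t well defined on trigonometric
-- polynomials and extendable by continuity.
theorem IsIsotropicStationary.norm_fieldComb_le (c : ℤ →₀ ℂ) :
    ‖hT.fieldComb hY c‖ ≤
      Real.sqrt (∑' i : HarmIndex, specBound P Y T i.1) * ‖trigPoly c‖ := by
  have h1 := hY.hilbertBasis.hasSum_inner_coeffL (hT.fieldComb hY c) (hT.fieldComb hY c)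
  simp_rw [hY.hilbertBasis_apply, hT.inner_coeffL_fieldComb hY hcont hS] at h1
  have hb : ∀ i : HarmIndex, ‖inner ℂ (trigPoly c) (specMul hS i.1 (trigPoly c))‖ ≤
      specBound P Y T i.1 * ‖trigPoly c‖ ^ 2 := fun i => by
    refine (norm_inner_le_norm _ _).trans ?_
    have : ‖specMul hS i.1 (trigPoly c)‖ ≤ specBound P Y T i.1 * ‖trigPoly c‖ := norm_freqMul_le _
    nlinarith [norm_nonneg (trigPoly c)]
  have h2 := tsum_of_norm_bounded
    ((summable_specBound hS).hasSum.mul_right (‖trigPoly c‖ ^ 2)) hb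
  rw [h1.tsum_eq, inner_self_eq_norm_sq_to_K] at h2
  have h3 : ‖hT.fieldComb hY c‖ ^ 2 ≤
      (∑' i : HarmIndex, specBound P Y T i.1) * ‖trigPoly c‖ ^ 2 := by
    simpa using h2
  have h4 := Real.sqrt_le_sqrt h3
  rwa [Real.sqrt_sq (norm_nonneg _), Real.sqrt_mul' _ (sq_nonneg _),
    Real.sqrt_sq (norm_nonneg _)] at h4

/-- The spectral operator: it maps the character `ν ↦ e^{itν}` to `T_t`. -/
noncomputable def IsIsotropicStationary.spectralOp : FreqL2 →L[ℂ] Lp SphL2 2 P :=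
  (hT.fieldComb hY).extendOfNorm trigPoly

include hcont hS

theorem IsIsotropicStationary.spectralOp_trigPoly (c : ℤ →₀ ℂ) :
    hT.spectralOp hY (trigPoly c) = hT.fieldComb hY c :=
  LinearMap.extendOfNorm_eq denseRange_trigPoly ⟨_, hT.norm_fieldComb_le hY hcont hS⟩ c

theorem IsIsotropicStationary.spectralOp_charL2 (t : ℤ) :
    hT.spectralOp hY (charL2 t) = hT.toL2 hY t := by
  have h := hT.spectralOp_trigPoly hY hcont hS (Finsupp.single t 1)
  simpa [trigPoly, IsIsotropicStationary.fieldComb] using h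

theorem IsIsotropicStationary.inner_coeffL_spectralOp (i : HarmIndex) (f g : FreqL2) :
    inner ℂ (coeffL P (hY.toL2 i) (hT.spectralOp hY f))
      (coeffL P (hY.toL2 i) (hT.spectralOp hY g)) = inner ℂ f (specMul hS i.1 g) := by
  refine inner_apply_eq_inner_freqMul ((coeffL P (hY.toL2 i)).comp (hT.spectralOp hY))
    ((coeffL P (hY.toL2 i)).comp (hT.spectralOp hY)) (fun s t => ?_) f g
  rw [ContinuousLinearMap.comp_apply, ContinuousLinearMap.comp_apply,
    hT.spectralOp_charL2 hY hcont hS, hT.spectralOp_charL2 hY hcont hS,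
    hT.inner_coeffL_toL2 hY hcont hS, specMul, inner_charL2_freqMul]

theorem IsIsotropicStationary.inner_coeffL_spectralOp_of_ne {i j : HarmIndex} (hij : i ≠ j)
    (f g : FreqL2) : inner ℂ (coeffL P (hY.toL2 i) (hT.spectralOp hY f))
      (coeffL P (hY.toL2 j) (hT.spectralOp hY g)) = 0 := by
  -- Distinct coefficients are uncorrelated at all pairs of times, that is, their cross-spectral
  -- density is zero.
  have h := inner_apply_eq_inner_freqMul (ψ := fun _ => 0) (hψ := continuous_const) (M := 0)
    (hM := by simp) ((coeffL P (hY.toL2 i)).comp (hT.spectralOp hY))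
    ((coeffL P (hY.toL2 j)).comp (hT.spectralOp hY)) (fun s t => ?_) f g
  · rw [ContinuousLinearMap.comp_apply, ContinuousLinearMap.comp_apply, inner_freqMul] at h
    simpa using h
  · rw [ContinuousLinearMap.comp_apply, ContinuousLinearMap.comp_apply,
      hT.spectralOp_charL2 hY hcont hS, hT.spectralOp_charL2 hY hcont hS]
    have := hT.inner_coeff hY hcont j i t s
    rw [if_neg hij.symm] at this
    rw [← IsIsotropicStationary.coeff, ← IsIsotropicStationary.coeff, this]
    simp

theorem IsIsotropicStationary.hasSum_inner_spectralOp (f g : FreqL2) :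
    HasSum (fun i : HarmIndex => inner ℂ f (specMul hS i.1 g))
      (inner ℂ (hT.spectralOp hY f) (hT.spectralOp hY g)) := by
  have h := hY.hilbertBasis.hasSum_inner_coeffL (hT.spectralOp hY f) (hT.spectralOp hY g)
  simpa only [hY.hilbertBasis_apply, hT.inner_coeffL_spectralOp hY hcont hS] using h

end SpectralOp

/-! ### Partitions and Stieltjes sums -/

/-- `u 0, …, u J` is a partition of `[-π, π]`. -/
structure IsFreqPartition (J : ℕ) (u : ℕ → ℝ) : Prop where
  first : u 0 = -Real.pi
  last : u J = Real.pi
  lt : ∀ j < J, u j < u (j + 1)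

theorem IsFreqPartition.mono {J : ℕ} {u : ℕ → ℝ} (hu : IsFreqPartition J u) {i j : ℕ}
    (hij : i ≤ j) (hj : j ≤ J) : u i ≤ u j := by
  induction j, hij using Nat.le_induction with
  | base => exact le_rfl
  | succ j _ ih => exact (ih (by omega)).trans (hu.lt j (by omega)).le

theorem IsFreqPartition.mem_Icc {J : ℕ} {u : ℕ → ℝ} (hu : IsFreqPartition J u) {j : ℕ}
    (hj : j ≤ J) : u j ∈ Set.Icc (-Real.pi) Real.pi :=
  ⟨hu.first ▸ hu.mono (Nat.zero_le j) hj, hu.last ▸ hu.mono hj le_rfl⟩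

theorem IsFreqPartition.exists_mem_Ioc {J : ℕ} {u : ℕ → ℝ} (hu : IsFreqPartition J u) {ν : ℝ}
    (hν : ν ∈ Set.Ioc (-Real.pi) Real.pi) : ∃ j < J, ν ∈ Set.Ioc (u j) (u (j + 1)) := by
  classical
  have hex : ∃ j, ν ≤ u j := ⟨J, hu.last ▸ hν.2⟩
  have hpos : Nat.find hex ≠ 0 := fun h => by
    have := Nat.find_spec hex
    rw [h, hu.first] at this
    exact not_lt.2 this hν.1
  obtain ⟨j, hj⟩ := Nat.exists_eq_succ_of_ne_zero hpos
  have hle : Nat.find hex ≤ J := Nat.find_min' hex (hu.last ▸ hν.2)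
  refine ⟨j, by omega, not_le.1 (Nat.find_min hex (by omega)), ?_⟩
  have := Nat.find_spec hex
  rwa [hj] at this

theorem norm_sum_range_sq_of_orthogonal {E : Type*} [NormedAddCommGroup E] [InnerProductSpace ℂ E]
    {D : ℕ → E} {J : ℕ} (w : ℕ → ℂ) (h : ∀ i j, i < j → j < J → inner ℂ (D i) (D j) = 0) :
    ‖∑ j ∈ Finset.range J, w j • D j‖ ^ 2 = ∑ j ∈ Finset.range J, ‖w j‖ ^ 2 * ‖D j‖ ^ 2 := by
  induction J with
  | zero => simp
  | succ J ih =>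
    have h0 : inner ℂ (∑ j ∈ Finset.range J, w j • D j) (w J • D J) = 0 := by
      rw [sum_inner]
      refine Finset.sum_eq_zero fun j hj => ?_
      rw [inner_smul_left, inner_smul_right, h j J (Finset.mem_range.1 hj) (Nat.lt_succ_self J),
        mul_zero, mul_zero]
    have h1 := norm_add_sq_eq_norm_sq_add_norm_sq_of_inner_eq_zero (𝕜 := ℂ) _ _ h0
    rw [Finset.sum_range_succ, Finset.sum_range_succ, ← ih fun i j hij hj => h i j hij (by omega),
      sq, h1, norm_smul]
    ring

/-- The step function with value `w j` on `(u j, u (j + 1)]`. -/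
noncomputable def stepL2 (J : ℕ) (u : ℕ → ℝ) (w : ℕ → ℂ) : FreqL2 :=
  ∑ j ∈ Finset.range J, w j • freqInd (u j) (u (j + 1))

theorem IsFreqPartition.norm_sq_stepL2 {J : ℕ} {u : ℕ → ℝ} (hu : IsFreqPartition J u)
    (w : ℕ → ℂ) :
    ‖stepL2 J u w‖ ^ 2 = ∑ j ∈ Finset.range J, ‖w j‖ ^ 2 * (u (j + 1) - u j) := by
  rw [stepL2, norm_sum_range_sq_of_orthogonal w fun i j hij hj =>
    inner_freqInd_eq_zero (hu.mono (by omega) (by omega))]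
  refine Finset.sum_congr rfl fun j hj => ?_
  have hj' := Finset.mem_range.1 hj
  rw [norm_sq_freqInd (hu.mem_Icc (by omega)).1 (hu.lt j hj').le (hu.mem_Icc (by omega)).2]

theorem IsFreqPartition.ae_stepL2 {J : ℕ} {u : ℕ → ℝ} (hu : IsFreqPartition J u) (w : ℕ → ℂ) :
    ∀ᵐ ν ∂freqMeasure, ∀ j < J, ν ∈ Set.Ioc (u j) (u (j + 1)) → stepL2 J u w ν = w j := by
  have h := coeFn_sum_smul (P := freqMeasure) (Finset.range J) w
    (f := fun j => freqInd (u j) (u (j + 1))) fun j _ => coeFn_freqInd (u j) (u (j + 1))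
  filter_upwards [h] with ν hν j hj hmem
  rw [stepL2, hν, Finset.sum_eq_single j]
  · rw [Set.indicator_of_mem hmem, smul_eq_mul, mul_one]
  · intro i hi hij
    rw [Set.indicator_of_notMem, smul_zero]
    intro hi'
    rcases lt_or_gt_of_ne hij with hlt | hlt
    · exact not_lt.2 (hi'.2.trans (hu.mono (by omega) (by omega))) hmem.1
    · exact not_lt.2 (hmem.2.trans (hu.mono (by omega) (Finset.mem_range.1 hi).le)) hi'.1
  · exact fun h => absurd (Finset.mem_range.2 hj) h

theorem exists_norm_charL2_sub_stepL2_le (t : ℤ) {ε : ℝ} (hε : 0 < ε) :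
    ∃ δ : ℝ, 0 < δ ∧ ∀ (J : ℕ) (u : ℕ → ℝ), IsFreqPartition J u →
      (∀ j < J, u (j + 1) - u j < δ) → ‖charL2 t - stepL2 J u fun j => charFn t (u j)‖ < ε := by
  set K : ℝ := (measureUnivNNReal freqMeasure : ℝ) ^ ((2 : ℝ≥0∞).toReal)⁻¹ with hK
  have hK0 : 0 ≤ K := by positivity
  -- `K` converts a uniform bound into an L² bound; the `+ 1` makes the final inequality strict.
  have hε' : 0 < ε / (K + 1) := by positivity
  have huc := (isCompact_Icc (a := -Real.pi) (b := Real.pi)).uniformContinuousOn_of_continuous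
    (continuous_charFn t).continuousOn
  obtain ⟨δ, hδ, h⟩ := Metric.uniformContinuousOn_iff.1 huc _ hε'
  refine ⟨δ, hδ, fun J u hu hmesh => ?_⟩
  have hb : ‖charL2 t - stepL2 J u fun j => charFn t (u j)‖ ≤ K * (ε / (K + 1)) := by
    refine Lp.norm_le_of_ae_bound hε'.le ?_
    filter_upwards [Lp.coeFn_sub (charL2 t) (stepL2 J u fun j => charFn t (u j)), coeFn_charL2 t,
      hu.ae_stepL2 fun j => charFn t (u j), ae_restrict_mem measurableSet_Ioc] with ν h1 h2 h3 hν
    obtain ⟨j, hj, hmem⟩ := hu.exists_mem_Ioc hν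
    rw [h1, Pi.sub_apply, h2, h3 j hj hmem, ← dist_eq_norm]
    refine (h ν ⟨hν.1.le, hν.2⟩ (u j) (hu.mem_Icc hj.le) ?_).le
    rw [Real.dist_eq, abs_of_pos (sub_pos.2 hmem.1)]
    linarith [hmesh j hj, hmem.2]
  refine hb.trans_lt ?_
  rw [mul_div_assoc', div_lt_iff₀ (by positivity)]
  nlinarith

/-- The Stieltjes sum with weights `w` of the increments of `Z`. -/
noncomputable def stieltjesSum {E : Type*} [AddCommGroup E] [Module ℂ E] (Z : ℝ → E) (J : ℕ)
    (u : ℕ → ℝ) (w : ℕ → ℂ) : E :=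
  ∑ j ∈ Finset.range J, w j • (Z (u (j + 1)) - Z (u j))

section Stieltjes

variable {Ω : Type*} [MeasurableSpace Ω] {P : Measure Ω} {E : Type*} [NormedAddCommGroup E]
  [InnerProductSpace ℂ E]

/-- Translates the mean-square error in the definition of the Stieltjes integral, which is about
functions, into a norm in L²(Ω; E). -/
theorem IsFreqPartition.lintegral_stieltjes {J : ℕ} {u : ℕ → ℝ} (hu : IsFreqPartition J u)
    {I : Ω → E} {F : Lp E 2 P} (hI : F =ᵐ[P] I) {Z : ℝ → Ω → E} {Z' : ℝ → Lp E 2 P}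
    (hZ : ∀ ν ∈ Set.Icc (-Real.pi) Real.pi, Z' ν =ᵐ[P] Z ν) (w : ℕ → ℂ) :
    ∫⁻ ω, ‖I ω - ∑ j ∈ Finset.range J, w j • (Z (u (j + 1)) ω - Z (u j) ω)‖ₑ ^ 2 ∂P =
      ‖F - stieltjesSum Z' J u w‖ₑ ^ 2 := by
  rw [← lintegral_enorm_sq_coeFn]
  refine (lintegral_enorm_sq_congr ?_).symm
  have h := coeFn_sum_smul (P := P) (Finset.range J) w
    (f := fun j => Z' (u (j + 1)) - Z' (u j)) (g := fun j ω => Z (u (j + 1)) ω - Z (u j) ω)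
    fun j hj => by
      have hj' := Finset.mem_range.1 hj
      filter_upwards [Lp.coeFn_sub (Z' (u (j + 1))) (Z' (u j)), hZ _ (hu.mem_Icc hj'),
        hZ _ (hu.mem_Icc hj'.le)] with ω h1 h2 h3
      rw [h1, Pi.sub_apply, h2, h3]
  filter_upwards [Lp.coeFn_sub F (stieltjesSum Z' J u w), hI, h] with ω h1 h2 h3
  rw [h1, Pi.sub_apply, h2, stieltjesSum, h3]

end Stieltjes

/-! ### Existence of the Cramér process -/

section Existence

variable {Ω : Type*} [MeasurableSpace Ω] {P : Measure Ω} [IsProbabilityMeasure P]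
  {T : Sph2 → ℤ → Ω → ℝ} {Y : ℕ → ℤ → Sph2 → ℂ} (hT : IsIsotropicStationary P T)
  (hY : IsSphericalHarmonicBasis Y)
  (hcont : ∀ t : ℤ, Continuous fun p : Sph2 × Sph2 => autocovKernel P T t p.1 p.2)
  (hS : Summable fun p : HarmIndex × ℤ => ‖angularCov P Y T p.1.1 p.2‖)

/-- The Cramér process of the field, `Z_ν` being the image of the indicator of `(-π, ν]` under the
spectral operator. -/
noncomputable def IsIsotropicStationary.cramer (ν : ℝ) : Lp SphL2 2 P :=
  hT.spectralOp hY (freqInd (-Real.pi) ν)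

theorem IsIsotropicStationary.cramer_sub {a b : ℝ} (ha : -Real.pi ≤ a) (hab : a ≤ b) :
    hT.cramer hY b - hT.cramer hY a = hT.spectralOp hY (freqInd a b) := by
  rw [IsIsotropicStationary.cramer, IsIsotropicStationary.cramer, ← map_sub, freqInd_sub ha hab]

/-- This reduces the convergence of Stieltjes sums in the random space to the approximation of
characters by step functions. -/
theorem IsIsotropicStationary.stieltjesSum_cramer {J : ℕ} {u : ℕ → ℝ} (hu : IsFreqPartition J u)
    (w : ℕ → ℂ) : stieltjesSum (hT.cramer hY) J u w = hT.spectralOp hY (stepL2 J u w) := by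
  rw [stieltjesSum, stepL2, map_sum]
  refine Finset.sum_congr rfl fun j hj => ?_
  have hj' := Finset.mem_range.1 hj
  rw [map_smul, hT.cramer_sub hY (hu.mem_Icc hj'.le).1 (hu.lt j hj').le]

omit [IsProbabilityMeasure P] in
theorem inner_freqInd_specMul {ν β : ℝ} (hν : ν ∈ Set.Icc (-Real.pi) Real.pi)
    (hβ : β ∈ Set.Icc (-Real.pi) Real.pi) (l : ℕ) :
    inner ℂ (freqInd (-Real.pi) β) (specMul hS l (freqInd (-Real.pi) ν)) =
      ∫ θ in (-Real.pi)..(min ν β), spectralDensity P Y T l θ := by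
  rw [specMul, inner_freqInd_freqMul, Set.Ioc_inter_Ioc, max_self, min_comm,
    intervalIntegral.integral_of_le (le_min hν.1 hβ.1), Measure.restrict_restrict measurableSet_Ioc,
    Set.inter_eq_left.2]
  exact Set.Ioc_subset_Ioc le_rfl ((min_le_left _ _).trans hν.2)

include hcont hS in
theorem IsIsotropicStationary.isCramerProcess_cramer :
    IsCramerProcess P Y T fun ν => hT.cramer hY ν where
  memLp ν _ := Lp.memLp _
  hasSum_norm ν hν := by
    have h := hT.hasSum_inner_spectralOp hY hcont hS (freqInd (-Real.pi) ν) (freqInd (-Real.pi) ν)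
    simp_rw [inner_freqInd_specMul hS hν hν, min_self] at h
    have h' := HarmIndex.hasSum_fst
      (g := fun l => ∫ θ in (-Real.pi)..ν, spectralDensity P Y T l θ) h
    simp only [nsmul_eq_mul, Nat.cast_add, Nat.cast_mul, Nat.cast_ofNat, Nat.cast_one] at h'
    rw [inner_self_eq_norm_sq_to_K] at h'
    rw [← norm_sq_eq_integral]
    push_cast
    exact h'
  orthogonal ν₁ h₁ ν₂ h₂ ν₃ h₃ ν₄ h₄ h12 h23 h34 := by
    have h : ∫ ω, inner ℂ (hT.cramer hY ν₃ ω - hT.cramer hY ν₄ ω)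
        (hT.cramer hY ν₁ ω - hT.cramer hY ν₂ ω) ∂P =
        inner ℂ (hT.cramer hY ν₃ - hT.cramer hY ν₄) (hT.cramer hY ν₁ - hT.cramer hY ν₂) := by
      rw [L2.inner_def]
      refine integral_congr_ae ?_
      filter_upwards [Lp.coeFn_sub (hT.cramer hY ν₃) (hT.cramer hY ν₄),
        Lp.coeFn_sub (hT.cramer hY ν₁) (hT.cramer hY ν₂)] with ω h1 h2
      rw [h1, h2, Pi.sub_apply, Pi.sub_apply]
    rw [h, hT.cramer_sub hY h₄.1 h34.le, hT.cramer_sub hY h₂.1 h12.le]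
    have hs := hT.hasSum_inner_spectralOp hY hcont hS (freqInd ν₄ ν₃) (freqInd ν₂ ν₁)
    refine hs.unique ?_
    have h0 : ∀ i : HarmIndex, inner ℂ (freqInd ν₄ ν₃) (specMul hS i.1 (freqInd ν₂ ν₁)) = 0 := by
      intro i
      rw [specMul, inner_freqInd_freqMul, Set.disjoint_iff_inter_eq_empty.1
        (Set.Ioc_disjoint_Ioc_of_le h23)]
      simp
    simp_rw [h0]
    exact hasSum_zero
  representation t := by
    refine ⟨hT.memLp_fieldElement hY t, fun ε hε => ?_⟩
    set A := hT.spectralOp hY with hA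
    -- `ε` bounds a squared norm and may be infinite, so a real radius is obtained from a limit
    -- instead of a square root.
    obtain ⟨r, hr0, hr⟩ : ∃ r : ℝ, 0 < r ∧ ENNReal.ofReal r ^ 2 < ε := by
      have : Tendsto (fun r : ℝ => ENNReal.ofReal r ^ 2) (𝓝[>] 0) (𝓝 0) := by
        have h := (ENNReal.continuous_pow 2).comp ENNReal.continuous_ofReal
        have h' := (h.tendsto 0).mono_left (nhdsWithin_le_nhds (s := Set.Ioi 0))
        simpa [Function.comp_def] using h'
      obtain ⟨r, hr, hr0⟩ := ((this.eventually (gt_mem_nhds hε)).and self_mem_nhdsWithin).exists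
      exact ⟨r, hr0, hr⟩
    obtain ⟨δ, hδ, h⟩ := exists_norm_charL2_sub_stepL2_le t
      (ε := r / (‖A‖ + 1)) (by positivity)
    refine ⟨δ, hδ, fun J u h0 hJ hlt hmesh => ?_⟩
    have hu : IsFreqPartition J u := ⟨h0, hJ, hlt⟩
    rw [hu.lintegral_stieltjes (hT.coeFn_toL2 hY t) (Z' := hT.cramer hY)
      (fun _ _ => EventuallyEq.rfl) fun j => charFn t (u j), hT.stieltjesSum_cramer hY hu,
      ← hT.spectralOp_charL2 hY hcont hS, ← map_sub, ← hA]
    refine lt_of_le_of_lt ?_ hr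
    rw [← ofReal_norm]
    gcongr
    refine (A.le_opNorm _).trans ?_
    have h1 := (h J u hu hmesh).le
    calc ‖A‖ * _ ≤ (‖A‖ + 1) * (r / (‖A‖ + 1)) := by
          gcongr
          linarith
      _ = r := by field_simp

end Existence

/-! ### Partitions through a given point -/

/-- With `ν` as a node, the indicator of (-π, ν] is exactly a step function on the partition. -/
theorem exists_freqPartition_through {ν : ℝ} (hν : ν ∈ Set.Icc (-Real.pi) Real.pi) (N : ℕ) :
    ∃ (J k : ℕ) (u : ℕ → ℝ), IsFreqPartition J u ∧ k ≤ J ∧ u k = ν ∧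
      ∀ j < J, u (j + 1) - u j ≤ 2 * Real.pi / (N + 1) := by
  have hpi := Real.pi_pos
  have hN : (0 : ℝ) < N + 1 := by positivity
  have hunif : ∃ u : ℕ → ℝ, IsFreqPartition (N + 1) u ∧
      ∀ j < N + 1, u (j + 1) - u j ≤ 2 * Real.pi / (N + 1) := by
    refine ⟨fun j => -Real.pi + j * (2 * Real.pi / (N + 1)), ⟨by simp, ?_, fun j _ => ?_⟩,
      fun j _ => ?_⟩
    · push_cast
      field_simp
      ring
    · push_cast
      have : 0 < 2 * Real.pi / (N + 1) := by positivity
      linarith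
    · push_cast
      apply le_of_eq
      ring
  -- If `ν` is an endpoint, one side of it is empty and the uniform partition serves.
  rcases hν.1.eq_or_lt with rfl | h1
  · obtain ⟨u, hu, hm⟩ := hunif
    exact ⟨N + 1, 0, u, hu, Nat.zero_le _, hu.first, hm⟩
  rcases hν.2.eq_or_lt with rfl | h2
  · obtain ⟨u, hu, hm⟩ := hunif
    exact ⟨N + 1, N + 1, u, hu, le_rfl, hu.last, hm⟩
  set a := (ν + Real.pi) / (N + 1) with ha
  set b := (Real.pi - ν) / (N + 1) with hb
  have ha0 : 0 < a := div_pos (by linarith) hN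
  have hb0 : 0 < b := div_pos (by linarith) hN
  have ha1 : a ≤ 2 * Real.pi / (N + 1) := div_le_div_of_nonneg_right (by linarith) hN.le
  have hb1 : b ≤ 2 * Real.pi / (N + 1) := div_le_div_of_nonneg_right (by linarith) hN.le
  have hNa : (N + 1) * a = ν + Real.pi := by rw [ha]; field_simp
  have hNb : (N + 1) * b = Real.pi - ν := by rw [hb]; field_simp
  -- Each of [-π, ν] and [ν, π] is cut into N + 1 equal pieces, of lengths `a` and `b`, so `ν` is
  -- the node of index N + 1.
  set u : ℕ → ℝ := fun j => if j ≤ N + 1 then -Real.pi + j * a else ν + (j - (N + 1)) * b with hu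
  have hstep : ∀ j, u (j + 1) - u j = a ∨ u (j + 1) - u j = b := by
    intro j
    rcases lt_trichotomy j (N + 1) with h | h | h
    · left
      simp only [hu, if_pos h.le, if_pos (Nat.succ_le_of_lt h)]
      push_cast
      ring
    · right
      subst h
      simp only [hu, if_pos le_rfl, if_neg (Nat.not_succ_le_self _)]
      push_cast
      linarith
    · right
      simp only [hu, if_neg h.not_ge, if_neg (h.trans (Nat.lt_succ_self j)).not_ge]
      push_cast
      ring
  refine ⟨2 * (N + 1), N + 1, u, ⟨by simp [hu], ?_, fun j _ => ?_⟩, by omega, ?_, fun j _ => ?_⟩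
  · simp only [hu, if_neg (show ¬ 2 * (N + 1) ≤ N + 1 by omega)]
    push_cast
    linarith
  · rcases hstep j with h | h <;> linarith
  · simp only [hu, if_pos le_rfl]
    push_cast
    linarith
  · rcases hstep j with h | h <;> linarith

theorem exists_freqPartition_seq {ν : ℝ} (hν : ν ∈ Set.Icc (-Real.pi) Real.pi) :
    ∃ (J k : ℕ → ℕ) (u : ℕ → ℕ → ℝ), (∀ n, IsFreqPartition (J n) (u n)) ∧ (∀ n, k n ≤ J n) ∧
      (∀ n, u n (k n) = ν) ∧
      ∀ δ : ℝ, 0 < δ → ∀ᶠ n in atTop, ∀ j < J n, u n (j + 1) - u n j < δ := by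
  choose J k u h1 h2 h3 h4 using exists_freqPartition_through hν
  refine ⟨J, k, u, h1, h2, h3, fun δ hδ => ?_⟩
  have ht : Tendsto (fun n : ℕ => 2 * Real.pi / ((n : ℝ) + 1)) atTop (𝓝 0) :=
    tendsto_const_nhds.div_atTop (tendsto_natCast_atTop_atTop.atTop_add tendsto_const_nhds)
  filter_upwards [ht.eventually (gt_mem_nhds hδ)] with n hn j hj
  exact (h4 n j hj).trans_lt hn

section StieltjesSum

variable {E : Type*} [AddCommGroup E] [Module ℂ E] (Z : ℝ → E) {J : ℕ} (u : ℕ → ℝ)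

theorem stieltjesSum_sum {ι : Type*} (s : Finset ι) (c : ι → ℂ) (w : ι → ℕ → ℂ) :
    stieltjesSum Z J u (fun j => ∑ i ∈ s, c i * w i j) =
      ∑ i ∈ s, c i • stieltjesSum Z J u (w i) := by
  simp only [stieltjesSum, Finset.sum_smul, Finset.smul_sum, mul_smul]
  exact Finset.sum_comm

theorem stieltjesSum_sub (w w' : ℕ → ℂ) :
    stieltjesSum Z J u (fun j => w j - w' j) = stieltjesSum Z J u w - stieltjesSum Z J u w' := by
  simp only [stieltjesSum, sub_smul, Finset.sum_sub_distrib]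

theorem stieltjesSum_indicator {k : ℕ} (hk : k ≤ J) :
    stieltjesSum Z J u (fun j => if j < k then 1 else 0) = Z (u k) - Z (u 0) := by
  rw [← Finset.sum_range_sub (fun j => Z (u j)) k, stieltjesSum,
    ← Finset.sum_subset (Finset.range_subset_range.2 hk)]
  · refine Finset.sum_congr rfl fun j hj => ?_
    rw [if_pos (Finset.mem_range.1 hj), one_smul]
  · intro j _ hj
    rw [if_neg fun h => hj (Finset.mem_range.2 h), zero_smul]

end StieltjesSum

/-- Step functions are the Stieltjes sums of the process ν ↦ 1_{(-π,ν]}, so the algebra of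
`stieltjesSum` serves on both sides of the comparison. -/
theorem IsFreqPartition.stepL2_eq {J : ℕ} {u : ℕ → ℝ} (hu : IsFreqPartition J u) (w : ℕ → ℂ) :
    stepL2 J u w = stieltjesSum (freqInd (-Real.pi)) J u w :=
  Finset.sum_congr rfl fun j hj => by
    have hj' := Finset.mem_range.1 hj
    rw [freqInd_sub (hu.mem_Icc hj'.le).1 (hu.lt j hj').le]

/-! ### Uniqueness of the Cramér process -/

section Uniqueness

variable {Ω : Type*} [MeasurableSpace Ω] {P : Measure Ω} {T : Sph2 → ℤ → Ω → ℝ}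
  {Y : ℕ → ℤ → Sph2 → ℂ} {Z : ℝ → Ω → SphL2} (hZ : IsCramerProcess P Y T Z)
  (hS : Summable fun p : HarmIndex × ℤ => ‖angularCov P Y T p.1.1 p.2‖)

open Classical in
/-- The values of a Cramér process as elements of `L²(Ω; L²)`. -/
noncomputable def IsCramerProcess.toL2 (ν : ℝ) : Lp SphL2 2 P :=
  if h : ν ∈ Set.Icc (-Real.pi) Real.pi then (hZ.memLp ν h).toLp (Z ν) else 0

theorem IsCramerProcess.coeFn_toL2 {ν : ℝ} (hν : ν ∈ Set.Icc (-Real.pi) Real.pi) :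
    hZ.toL2 ν =ᵐ[P] Z ν := by
  rw [IsCramerProcess.toL2, dif_pos hν]
  exact MemLp.coeFn_toLp _

theorem left_mem_freqIcc : -Real.pi ∈ Set.Icc (-Real.pi) Real.pi :=
  ⟨le_rfl, by linarith [Real.pi_pos]⟩

theorem IsCramerProcess.hasSum_norm_toL2 {ν : ℝ} (hν : ν ∈ Set.Icc (-Real.pi) Real.pi) :
    HasSum (fun l : ℕ => (2 * l + 1 : ℂ) * ∫ θ in (-Real.pi)..ν, spectralDensity P Y T l θ)
      ((‖hZ.toL2 ν‖ ^ 2 : ℝ) : ℂ) := by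
  have h := hZ.hasSum_norm ν hν
  have h' : ‖hZ.toL2 ν‖ ^ 2 = ∫ ω, ‖Z ν ω‖ ^ 2 ∂P := by
    rw [norm_sq_eq_integral]
    refine integral_congr_ae ?_
    filter_upwards [hZ.coeFn_toL2 hν] with ω hω
    rw [hω]
  rwa [h']

/-- The normalisation at ν = -π has only empty integrals. -/
theorem IsCramerProcess.toL2_neg_pi : hZ.toL2 (-Real.pi) = 0 := by
  have h := hZ.hasSum_norm_toL2 left_mem_freqIcc
  simp only [intervalIntegral.integral_same, mul_zero] at h
  have := h.unique hasSum_zero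
  simpa using this

theorem IsCramerProcess.inner_increments {ν₁ ν₂ ν₃ ν₄ : ℝ}
    (h₁ : ν₁ ∈ Set.Icc (-Real.pi) Real.pi) (h₂ : ν₂ ∈ Set.Icc (-Real.pi) Real.pi)
    (h₃ : ν₃ ∈ Set.Icc (-Real.pi) Real.pi) (h₄ : ν₄ ∈ Set.Icc (-Real.pi) Real.pi)
    (h12 : ν₂ < ν₁) (h23 : ν₃ ≤ ν₂) (h34 : ν₄ < ν₃) :
    inner ℂ (hZ.toL2 ν₃ - hZ.toL2 ν₄) (hZ.toL2 ν₁ - hZ.toL2 ν₂) = 0 := by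
  rw [← hZ.orthogonal ν₁ h₁ ν₂ h₂ ν₃ h₃ ν₄ h₄ h12 h23 h34, L2.inner_def]
  refine integral_congr_ae ?_
  filter_upwards [Lp.coeFn_sub (hZ.toL2 ν₃) (hZ.toL2 ν₄),
    Lp.coeFn_sub (hZ.toL2 ν₁) (hZ.toL2 ν₂), hZ.coeFn_toL2 h₁, hZ.coeFn_toL2 h₂,
    hZ.coeFn_toL2 h₃, hZ.coeFn_toL2 h₄] with ω e1 e2 e3 e4 e5 e6
  rw [e1, e2, Pi.sub_apply, Pi.sub_apply, e3, e4, e5, e6]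

theorem IsCramerProcess.norm_sq_sub {a b : ℝ} (ha : -Real.pi ≤ a) (hab : a ≤ b)
    (hb : b ≤ Real.pi) :
    ‖hZ.toL2 b - hZ.toL2 a‖ ^ 2 = ‖hZ.toL2 b‖ ^ 2 - ‖hZ.toL2 a‖ ^ 2 := by
  have horth : inner ℂ (hZ.toL2 a) (hZ.toL2 b - hZ.toL2 a) = 0 := by
    -- Orthogonality is given for nondegenerate intervals only, so the cases a = -π and a = b are
    -- treated apart.
    rcases ha.eq_or_lt with rfl | ha'
    · rw [hZ.toL2_neg_pi, inner_zero_left]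
    rcases hab.eq_or_lt with rfl | hab'
    · rw [sub_self, inner_zero_right]
    have h := hZ.inner_increments (ν₁ := b) (ν₂ := a) (ν₃ := a) (ν₄ := -Real.pi)
      ⟨ha.trans hab, hb⟩ ⟨ha, hab.trans hb⟩ ⟨ha, hab.trans hb⟩ left_mem_freqIcc hab' le_rfl ha'
    rwa [hZ.toL2_neg_pi, sub_zero] at h
  have h := norm_add_sq_eq_norm_sq_add_norm_sq_of_inner_eq_zero (𝕜 := ℂ) _ _ horth
  rw [add_sub_cancel] at h
  rw [sq, sq, sq, h]
  ring

-- E‖Z_b - Z_a‖² is the sum of (2l+1) ∫_a^b f_l by Pythagoras, and each f_l is at most its bound.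
include hS in
theorem IsCramerProcess.norm_sq_sub_le {a b : ℝ} (ha : -Real.pi ≤ a) (hab : a ≤ b)
    (hb : b ≤ Real.pi) :
    ‖hZ.toL2 b - hZ.toL2 a‖ ^ 2 ≤ (∑' i : HarmIndex, specBound P Y T i.1) * (b - a) := by
  have hs := (hZ.hasSum_norm_toL2 ⟨ha.trans hab, hb⟩).sub
    (hZ.hasSum_norm_toL2 ⟨ha, hab.trans hb⟩)
  have hK := (HarmIndex.hasSum_fst (summable_specBound hS).hasSum).mul_right (b - a)
  have hcont : ∀ l, Continuous (spectralDensity P Y T l) := fun l =>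
    continuous_spectralDensity (summable_angularCov_fiber hS l)
  have hle := tsum_of_norm_bounded hK (f := fun l : ℕ => (2 * l + 1 : ℂ) *
      (∫ θ in (-Real.pi)..b, spectralDensity P Y T l θ) -
      (2 * l + 1 : ℂ) * ∫ θ in (-Real.pi)..a, spectralDensity P Y T l θ) fun l => by
    rw [← mul_sub, intervalIntegral.integral_interval_sub_left
      ((hcont l).intervalIntegrable _ _) ((hcont l).intervalIntegrable _ _), norm_mul, nsmul_eq_mul,
      mul_assoc]
    have h1 : ‖(2 * l + 1 : ℂ)‖ = ((2 * l + 1 : ℕ) : ℝ) := by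
      rw [← Complex.norm_natCast]
      push_cast
      rfl
    rw [h1]
    gcongr
    have := intervalIntegral.norm_integral_le_of_norm_le_const (a := a) (b := b)
      (f := spectralDensity P Y T l) (C := specBound P Y T l)
      fun x _ => norm_spectralDensity_le (summable_angularCov_fiber hS l) x
    rwa [abs_of_nonneg (sub_nonneg.2 hab)] at this
  rw [hs.tsum_eq, ← Complex.ofReal_sub, ← hZ.norm_sq_sub ha hab hb, Complex.norm_real,
    Real.norm_of_nonneg (by positivity)] at hle
  exact hle

-- Orthogonal increments turn the squared norm into a sum of |w_j|² E‖ΔZ_j‖², to be compared term by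
-- term with the sum of |w_j|² Δu_j. The estimate uses nothing of the process but its normalisation
-- and orthogonality.
include hS in
theorem IsCramerProcess.norm_stieltjesSum_le {J : ℕ} {u : ℕ → ℝ} (hu : IsFreqPartition J u)
    (w : ℕ → ℂ) : ‖stieltjesSum hZ.toL2 J u w‖ ≤
      Real.sqrt (∑' i : HarmIndex, specBound P Y T i.1) * ‖stepL2 J u w‖ := by
  have hsq : ‖stieltjesSum hZ.toL2 J u w‖ ^ 2 ≤
      (∑' i : HarmIndex, specBound P Y T i.1) * ‖stepL2 J u w‖ ^ 2 := by
    rw [hu.norm_sq_stepL2, stieltjesSum, norm_sum_range_sq_of_orthogonal w fun i j hij hj =>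
      hZ.inner_increments (hu.mem_Icc hj) (hu.mem_Icc hj.le) (hu.mem_Icc (by omega))
        (hu.mem_Icc (by omega)) (hu.lt j hj) (hu.mono (by omega) hj.le) (hu.lt i (by omega)),
      Finset.mul_sum]
    refine Finset.sum_le_sum fun j hj => ?_
    have hj' := Finset.mem_range.1 hj
    rw [mul_left_comm]
    gcongr
    exact hZ.norm_sq_sub_le hS (hu.mem_Icc hj'.le).1 (hu.lt j hj').le (hu.mem_Icc hj').2
  have h4 := Real.sqrt_le_sqrt hsq
  rwa [Real.sqrt_sq (norm_nonneg _), Real.sqrt_mul' _ (sq_nonneg _),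
    Real.sqrt_sq (norm_nonneg _)] at h4

variable [IsProbabilityMeasure P] (hT : IsIsotropicStationary P T)
  (hY : IsSphericalHarmonicBasis Y)
  (hcont : ∀ t : ℤ, Continuous fun p : Sph2 × Sph2 => autocovKernel P T t p.1 p.2)

theorem IsCramerProcess.tendsto_stieltjesSum {J : ℕ → ℕ} {u : ℕ → ℕ → ℝ}
    (hu : ∀ n, IsFreqPartition (J n) (u n))
    (hmesh : ∀ δ : ℝ, 0 < δ → ∀ᶠ n in atTop, ∀ j < J n, u n (j + 1) - u n j < δ) (t : ℤ) :
    Tendsto (fun n => stieltjesSum hZ.toL2 (J n) (u n) fun j => charFn t (u n j)) atTop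
      (𝓝 (hT.toL2 hY t)) := by
  rw [tendsto_iff_norm_sub_tendsto_zero, Metric.tendsto_nhds]
  intro ε hε
  obtain ⟨δ, hδ, h⟩ := (hZ.representation t).2 (ENNReal.ofReal ε ^ 2)
    (by have := ENNReal.ofReal_pos.2 hε; positivity)
  filter_upwards [hmesh δ hδ] with n hn
  have h1 := h (J n) (u n) (hu n).first (hu n).last (hu n).lt hn
  rw [(hu n).lintegral_stieltjes (hT.coeFn_toL2 hY t) (Z' := hZ.toL2)
    (fun ν hν => hZ.coeFn_toL2 hν) fun j => charFn t (u n j)] at h1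
  have h2 := lt_of_not_ge fun hle => (pow_le_pow_left' hle 2).not_gt h1
  rw [← ofReal_norm, ENNReal.ofReal_lt_ofReal_iff hε] at h2
  rw [Real.dist_eq, sub_zero, abs_of_nonneg (norm_nonneg _), norm_sub_rev]
  exact h2

theorem tendsto_stepL2 {J : ℕ → ℕ} {u : ℕ → ℕ → ℝ} (hu : ∀ n, IsFreqPartition (J n) (u n))
    (hmesh : ∀ δ : ℝ, 0 < δ → ∀ᶠ n in atTop, ∀ j < J n, u n (j + 1) - u n j < δ) (t : ℤ) :
    Tendsto (fun n => stepL2 (J n) (u n) fun j => charFn t (u n j)) atTop (𝓝 (charL2 t)) := by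
  rw [tendsto_iff_norm_sub_tendsto_zero, Metric.tendsto_nhds]
  intro ε hε
  obtain ⟨δ, hδ, h⟩ := exists_norm_charL2_sub_stepL2_le t hε
  filter_upwards [hmesh δ hδ] with n hn
  rw [Real.dist_eq, sub_zero, abs_of_nonneg (norm_nonneg _), norm_sub_rev]
  exact h (J n) (u n) (hu n) hn

include hS hcont in
/-- Every Cramér process of the field is the one given by the spectral operator. -/
theorem IsCramerProcess.toL2_eq_cramer {ν : ℝ} (hν : ν ∈ Set.Icc (-Real.pi) Real.pi) :
    hZ.toL2 ν = hT.cramer hY ν := by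
  obtain ⟨J, k, u, hu, hk, huk, hmesh⟩ := exists_freqPartition_seq hν
  set K := Real.sqrt (∑' i : HarmIndex, specBound P Y T i.1)
  -- The sums of the characters with respect to any Cramér process converge to T_t, which the
  -- spectral operator also assigns to them; this ties the unknown `Z` to that operator.
  have hpoly : ∀ c : ℤ →₀ ℂ, ‖hT.spectralOp hY (trigPoly c) - hZ.toL2 ν‖ ≤
      K * ‖trigPoly c - freqInd (-Real.pi) ν‖ := by
    intro c
    have e1 : hT.spectralOp hY (trigPoly c) = ∑ t ∈ c.support, c t • hT.toL2 hY t := by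
      rw [hT.spectralOp_trigPoly hY hcont hS, IsIsotropicStationary.fieldComb,
        Finsupp.linearCombination_apply, Finsupp.sum]
    have e2 : trigPoly c = ∑ t ∈ c.support, c t • charL2 t := by
      rw [trigPoly, Finsupp.linearCombination_apply, Finsupp.sum]
    have l1 : Tendsto (fun n => ‖(∑ t ∈ c.support, c t •
        stieltjesSum hZ.toL2 (J n) (u n) fun j => charFn t (u n j)) - hZ.toL2 ν‖) atTop
        (𝓝 ‖hT.spectralOp hY (trigPoly c) - hZ.toL2 ν‖) := by
      rw [e1]
      exact ((tendsto_finsetSum _ fun t _ =>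
        (hZ.tendsto_stieltjesSum hT hY hu hmesh t).const_smul (c t)).sub_const _).norm
    have l2 : Tendsto (fun n => K * ‖(∑ t ∈ c.support, c t •
        stepL2 (J n) (u n) fun j => charFn t (u n j)) - freqInd (-Real.pi) ν‖) atTop
        (𝓝 (K * ‖trigPoly c - freqInd (-Real.pi) ν‖)) := by
      rw [e2]
      exact ((tendsto_finsetSum _ fun t _ =>
        (tendsto_stepL2 hu hmesh t).const_smul (c t)).sub_const _).norm.const_mul K
    refine le_of_tendsto_of_tendsto' l1 l2 fun n => ?_
    -- The weights are the values of the trigonometric polynomial minus the indicator of (-π, ν].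
    -- The indicator part telescopes to Z_ν - Z_{-π} = Z_ν on one side and to 1_{(-π,ν]} on the
    -- other.
    have hw := hZ.norm_stieltjesSum_le hS (hu n) fun j =>
      (∑ t ∈ c.support, c t * charFn t (u n j)) - if j < k n then 1 else 0
    rw [(hu n).stepL2_eq, stieltjesSum_sub, stieltjesSum_sub,
      stieltjesSum_sum _ _ c.support c fun t j => charFn t (u n j),
      stieltjesSum_sum _ _ c.support c fun t j => charFn t (u n j),
      stieltjesSum_indicator _ _ (hk n), stieltjesSum_indicator _ _ (hk n), huk, (hu n).first,
      hZ.toL2_neg_pi, freqInd_self, sub_zero, sub_zero] at hw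
    simp_rw [(hu n).stepL2_eq]
    exact hw
  -- The inequality is closed in f, so it extends from trigonometric polynomials to f = 1_{(-π,ν]},
  -- where its right side vanishes.
  have hall := denseRange_trigPoly.induction_on
    (p := fun f => ‖hT.spectralOp hY f - hZ.toL2 ν‖ ≤ K * ‖f - freqInd (-Real.pi) ν‖)
    (freqInd (-Real.pi) ν) (isClosed_le (by fun_prop) (by fun_prop)) hpoly
  rw [sub_self, norm_zero, mul_zero] at hall
  exact (sub_eq_zero.1 (norm_le_zero_iff.1 hall)).symm

omit [MeasurableSpace Ω] in
theorem incrementCoeff_eq_inner (Z : ℝ → Ω → SphL2) (i : HarmIndex) (ν : ℝ) (ω : Ω) :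
    incrementCoeff Y Z i.1 i.2 ν ω = inner ℂ (hY.toL2 i) (Z ν ω) := (hY.inner_toL2 i _).symm

-- Pairing with a unit vector is linear and does not increase norms, so the error for the scalar
-- sums is bounded by the error for `Z` at almost every outcome, with the same `δ`.
include hZ hT hY in
theorem IsCramerProcess.isStieltjesIntegral_harmonicCoeff (i : HarmIndex) (t : ℤ) :
    IsStieltjesIntegral P (charFn t) (incrementCoeff Y Z i.1 i.2)
      (harmonicCoeff Y T i.1 i.2 t) := by
  refine ⟨(memLp_congr_ae (hT.coeFn_coeff hY i t)).1 (Lp.memLp _), fun ε hε => ?_⟩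
  obtain ⟨δ, hδ, h⟩ := (hZ.representation t).2 ε hε
  refine ⟨δ, hδ, fun J u h0 hJ hlt hmesh => lt_of_le_of_lt ?_ (h J u h0 hJ hlt hmesh)⟩
  refine lintegral_mono_ae ?_
  filter_upwards [hT.ae_inner_fieldElement hY i t] with ω hω
  have : harmonicCoeff Y T i.1 i.2 t ω - ∑ j ∈ Finset.range J, charFn t (u j) •
      (incrementCoeff Y Z i.1 i.2 (u (j + 1)) ω - incrementCoeff Y Z i.1 i.2 (u j) ω) =
      inner ℂ (hY.toL2 i) (fieldElement T t ω - ∑ j ∈ Finset.range J, charFn t (u j) •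
        (Z (u (j + 1)) ω - Z (u j) ω)) := by
    simp only [inner_sub_right, inner_sum, inner_smul_right, hω, incrementCoeff_eq_inner hY,
      smul_eq_mul]
  rw [this]
  gcongr
  rw [enorm_le_iff_norm_le]
  refine (norm_inner_le_norm _ _).trans_eq ?_
  rw [hY.orthonormal_toL2.1 i, one_mul]

include hZ hT hY hcont hS in
theorem IsCramerProcess.integral_incrementCoeff (i j : HarmIndex) {ν β : ℝ}
    (hν : ν ∈ Set.Icc (-Real.pi) Real.pi) (hβ : β ∈ Set.Icc (-Real.pi) Real.pi) :
    ∫ ω, incrementCoeff Y Z i.1 i.2 ν ω * conj (incrementCoeff Y Z j.1 j.2 β ω) ∂P =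
      if i = j then ∫ θ in (-Real.pi)..(min ν β), spectralDensity P Y T i.1 θ else 0 := by
  have h : ∫ ω, incrementCoeff Y Z i.1 i.2 ν ω * conj (incrementCoeff Y Z j.1 j.2 β ω) ∂P =
      inner ℂ (coeffL P (hY.toL2 j) (hZ.toL2 β)) (coeffL P (hY.toL2 i) (hZ.toL2 ν)) := by
    rw [L2.inner_def]
    refine integral_congr_ae ?_
    filter_upwards [coeFn_coeffL (hY.toL2 j) (hZ.toL2 β), coeFn_coeffL (hY.toL2 i) (hZ.toL2 ν),
      hZ.coeFn_toL2 hν, hZ.coeFn_toL2 hβ] with ω h1 h2 h3 h4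
    rw [h1, h2, h3, h4, RCLike.inner_apply, incrementCoeff_eq_inner hY, incrementCoeff_eq_inner hY]
  rw [h, hZ.toL2_eq_cramer hS hT hY hcont hν, hZ.toL2_eq_cramer hS hT hY hcont hβ,
    IsIsotropicStationary.cramer, IsIsotropicStationary.cramer]
  split_ifs with hij
  · subst hij
    rw [hT.inner_coeffL_spectralOp hY hcont hS, inner_freqInd_specMul hS hν hβ]
  · exact hT.inner_coeffL_spectralOp_of_ne hY hcont hS (Ne.symm hij) _ _

end Uniqueness

theorem mainTheorem7 {Ω : Type*} [MeasurableSpace Ω] (P : Measure Ω) [IsProbabilityMeasure P]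
    (Y : ℕ → ℤ → Sph2 → ℂ) (hY : IsSphericalHarmonicBasis Y)
    (T : Sph2 → ℤ → Ω → ℝ) (hT : IsIsotropicStationary P T)
    (hcont : ∀ t : ℤ, Continuous fun p : Sph2 × Sph2 => autocovKernel P T t p.1 p.2)
    (hsum : ∑' t : ℤ, traceNorm (kernelOperator (autocovKernel P T t) (hcont t)) < ∞) :
    (∃ Z : ℝ → Ω → SphL2, IsCramerProcess P Y T Z) ∧
    ∀ Z : ℝ → Ω → SphL2, IsCramerProcess P Y T Z →
      (∃ I : ℕ → ℤ → ℤ → Ω → ℂ,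
        (∀ (l : ℕ) (m t : ℤ), |m| ≤ l →
          IsStieltjesIntegral P (charFn t) (incrementCoeff Y Z l m) (I l m t)) ∧
        ∀ (t : ℤ) (x : Sph2), Tendsto (fun L : ℕ =>
          ∫⁻ ω, ‖(T x t ω : ℂ) - ∑ l ∈ Finset.range (L + 1), ∑ m ∈ Finset.Icc (-(l : ℤ)) l,
            I l m t ω * Y l m x‖ₑ ^ 2 ∂P) atTop (𝓝 0)) ∧
      ∀ (l l' : ℕ) (m m' : ℤ), |m| ≤ l → |m'| ≤ l' →
        ∀ ν ∈ Set.Icc (-Real.pi) Real.pi, ∀ β ∈ Set.Icc (-Real.pi) Real.pi,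
          ∫ ω, incrementCoeff Y Z l m ν ω * conj (incrementCoeff Y Z l' m' β ω) ∂P =
            if l = l' ∧ m = m' then
              ∫ θ in (-Real.pi)..(min ν β), spectralDensity P Y T l θ
            else 0 := by
  have hS := hT.summable_angularCov hY hcont hsum
  refine ⟨⟨_, hT.isCramerProcess_cramer hY hcont hS⟩, fun Z hZ =>
    ⟨⟨harmonicCoeff Y T, fun l m t hm => ?_, fun t x => hT.tendsto_expansion hY hcont t x⟩,
      fun l l' m m' hm hm' ν hν β hβ => ?_⟩⟩
  · exact hZ.isStieltjesIntegral_harmonicCoeff hT hY ⟨l, m, mem_Icc_neg_iff.2 hm⟩ t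
  · have h := hZ.integral_incrementCoeff hS hT hY hcont ⟨l, m, mem_Icc_neg_iff.2 hm⟩
      ⟨l', m', mem_Icc_neg_iff.2 hm'⟩ hν hβ
    simpa only [HarmIndex.ext_iff'] using h
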